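/- Let $r\ge 0$ and read all indices modulo $r+1$. Let $(M_j,\omega_j)$, $j=0,\dots,r$, be symplectic manifolds (finite dimensional, Hausdorff, second countable, without boundary, not necessarily compact), and let $\underline L=(L_{j(j+1)})_{j=0,\dots,r}$ be a cyclic generalized Lagrangian correspondence with compact factors, i.e. each $L_{j(j+1)}\subset M_j^-\times M_{j+1}$ is a compact embedded Lagrangian submanifold with respect to $(-\omega_j)\oplus\omega_{j+1}$. Let $\underline\delta=(\delta_j)_{j=0,\dots,r}$ with $\delta_j>0$, and let $\mathcal H_t(\underline\delta)=\bigoplus_{j=0}^r\mathcal C^\infty([0,\delta_j]\times M_j,\mathbb R)$ carry the $\mathcal C^\infty$ topology (uniform convergence of all derivatives on compact subsets of charts). For $\underline H=(H_j)_j\in\mathcal H_t(\underline\delta)$ let $\phi^{H_j}_{\delta_j}$ be the time $\delta_j$ flow of the Hamiltonian vector field of $H_j$ (defined on the open set of initial points whose trajectory exists on all of $[0,\delta_j]$; on all of $M_j$ if $M_j$ is compact). For $I\subset\{0,\dots,r\}$ the partial fiber product $\times_{I,\underline H}\underline L$ is the set of tuples $$\bigl((m_j',m_{j+1})\bigr)_{j=0,\dots,r}\in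 L_{01}\times L_{12}\times\dots\times L_{r(r+1)}\quad\text{with}\quad \phi^{H_i}_{\delta_i}(m_i)=m_i'\quad\text{for all } i\in I,$$ where $m_0:=m_{r+1}$. Its defining equations are called transversal if at every such tuple the linearized map $$\bigoplus_{j=0}^r T_{(m_j',m_{j+1})}L_{j(j+1)}\longrightarrow\bigoplus_{i\in I}T_{m_i'}M_i,\qquad \bigl((v_j',v_{j+1})\bigr)_j\longmapsto\bigl(v_i'-D\phi^{H_i}_{\delta_i}(v_i)\bigr)_{i\in I},\qquad v_0:=v_{r+1},$$ is surjective. Theorem. There is a dense open subset $\mathrm{Ham}^*(\underline L)\subset\mathcal H_t(\underline\delta)$ such that for every $\underline H\in\mathrm{Ham}^*(\underline L)$ the flow $\phi^{H_{j+1}}_{\delta_{j+1}}$ is defined at every point of the projection of $L_{j(j+1)}$ to $M_{j+1}$ for all $j$ (automatic if the $M_j$ are compact), and for every subset $I\subset\{0,\dots,r\}$ the defining equations of $\times_{I,\underline H}\underline L$ are transversal. The case $I=\{0,\dots,r\}$ is the full set of generators of the quilted Floer complex. -/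

import Mathlib

open Set Topology
open scoped Manifold ContDiff

/-- A differential 2-form `σ` on `M`, read in the preferred chart around `x₀`: the pullback of `σ`
by the inverse of that chart. -/
noncomputable def chartForm {d : ℕ} {M : Type*} [TopologicalSpace M]
    [ChartedSpace (EuclideanSpace ℝ (Fin d)) M]
    (σ : ∀ x : M, TangentSpace (𝓡 d) x [⋀^Fin 2]→L[ℝ] ℝ) (x₀ : M)
    (y : EuclideanSpace ℝ (Fin d)) : EuclideanSpace ℝ (Fin d) [⋀^Fin 2]→L[ℝ] ℝ :=
  (σ ((extChartAt (𝓡 d) x₀).symm y)).compContinuousLinearMap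
    (mfderiv 𝓘(ℝ, EuclideanSpace ℝ (Fin d)) (𝓡 d) (extChartAt (𝓡 d) x₀).symm y)

/-- A symplectic form: a smooth, closed, nondegenerate differential 2-form. Smoothness and
closedness are tested in the charts of the atlas. -/
structure SymplecticForm (d : ℕ) (M : Type*) [TopologicalSpace M]
    [ChartedSpace (EuclideanSpace ℝ (Fin d)) M] where
  form : ∀ x : M, TangentSpace (𝓡 d) x [⋀^Fin 2]→L[ℝ] ℝ
  smooth : ∀ x₀ : M, ContDiffOn ℝ ∞ (chartForm form x₀) (extChartAt (𝓡 d) x₀).target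
  closed : ∀ x₀ : M, ∀ y ∈ (extChartAt (𝓡 d) x₀).target, extDeriv (chartForm form x₀) y = 0
  nondegenerate : ∀ (x : M) (v : TangentSpace (𝓡 d) x),
    (∀ w : TangentSpace (𝓡 d) x, form x ![v, w] = 0) → v = 0

/-- `ι : Q → M × M'` parametrizes an embedded Lagrangian submanifold of `M⁻ × M'`, that is of
`M × M'` with the symplectic form `(-σ) ⊕ σ'`: it is a smooth embedding, and each tangent space of
its image equals its own symplectic complement. -/
structure IsLagrangianCorrespondence {d d' n : ℕ} {M M' Q : Type*}
    [TopologicalSpace M] [ChartedSpace (EuclideanSpace ℝ (Fin d)) M]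
    [TopologicalSpace M'] [ChartedSpace (EuclideanSpace ℝ (Fin d')) M']
    [TopologicalSpace Q] [ChartedSpace (EuclideanSpace ℝ (Fin n)) Q]
    (σ : SymplecticForm d M) (σ' : SymplecticForm d' M') (ι : Q → M × M') : Prop where
  isSmoothEmbedding : Manifold.IsSmoothEmbedding (𝓡 n) ((𝓡 d).prod (𝓡 d')) ∞ ι
  lagrangian : ∀ (p : Q) (v : TangentSpace (𝓡 d) (ι p).1 × TangentSpace (𝓡 d') (ι p).2),
    v ∈ range (mfderiv (𝓡 n) ((𝓡 d).prod (𝓡 d')) ι p) ↔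
      ∀ w ∈ range (mfderiv (𝓡 n) ((𝓡 d).prod (𝓡 d')) ι p),
        - σ.form (ι p).1 ![v.1, w.1] + σ'.form (ι p).2 ![v.2, w.2] = 0

section Hamiltonian

variable {d : ℕ} {M : Type*} [TopologicalSpace M] [ChartedSpace (EuclideanSpace ℝ (Fin d)) M]
  {δ : ℝ}

open Classical in
/-- Extension by zero of a function on `[0,δ] × M` to `ℝ × M`; only its values on `[0,δ] × M`
are ever used. -/
noncomputable def zeroExtend (h : Icc (0 : ℝ) δ → M → ℝ) (t : ℝ) (x : M) : ℝ :=
  if ht : t ∈ Icc (0 : ℝ) δ then h ⟨t, ht⟩ x else 0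

variable (d M δ) in
/-- The space `C^∞([0,δ] × M, ℝ)` of time-dependent Hamiltonian functions, smooth up to the
boundary times `0` and `δ`. -/
def HamiltonianSpace : Type _ :=
  {h : Icc (0 : ℝ) δ → M → ℝ //
    ContMDiffOn (𝓘(ℝ, ℝ).prod (𝓡 d)) 𝓘(ℝ, ℝ) ∞
      (fun p : ℝ × M => zeroExtend h p.1 p.2) (Icc 0 δ ×ˢ univ)}

/-- The domain `[0,δ] × (target of the chart around x₀)` of a Hamiltonian in local coordinates. -/
def chartDomain (d : ℕ) {M : Type*} [TopologicalSpace M]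
    [ChartedSpace (EuclideanSpace ℝ (Fin d)) M] (δ : ℝ) (x₀ : M) :
    Set (ℝ × EuclideanSpace ℝ (Fin d)) :=
  Icc 0 δ ×ˢ (extChartAt (𝓡 d) x₀).target

/-- The `k`-th total derivative, in time and in the chart around `x₀`, of a Hamiltonian function. -/
noncomputable def HamiltonianSpace.chartDeriv (h : HamiltonianSpace d M δ) (k : ℕ) (x₀ : M) :
    ℝ × EuclideanSpace ℝ (Fin d) → (ℝ × EuclideanSpace ℝ (Fin d)) [×k]→L[ℝ] ℝ :=
  iteratedFDerivWithin ℝ k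
    (fun p : ℝ × EuclideanSpace ℝ (Fin d) =>
      zeroExtend h.1 p.1 ((extChartAt (𝓡 d) x₀).symm p.2))
    (chartDomain d δ x₀)

/-- The `C^∞` topology on `C^∞([0,δ] × M, ℝ)`: uniform convergence of all derivatives in all charts
on compact subsets of `[0,δ] × (chart target)`. -/
noncomputable instance HamiltonianSpace.instTopologicalSpace : TopologicalSpace (HamiltonianSpace d M δ) :=
  ⨅ (k : ℕ) (x₀ : M), TopologicalSpace.induced
    (fun h => UniformOnFun.ofFun {K | IsCompact K ∧ K ⊆ chartDomain d δ x₀} (h.chartDeriv k x₀))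
    inferInstance

/-- `γ` solves `γ' (t) = X_{h_t} (γ t)` on `[0,δ]`, where the Hamiltonian vector field is determined
by `σ (X_{h_t}, ·) = d h_t`. Values of `γ` outside `[0,δ]` are irrelevant. -/
def IsHamiltonianTrajectory (σ : SymplecticForm d M) (h : HamiltonianSpace d M δ) (γ : ℝ → M) :
    Prop :=
  ∀ t ∈ Icc (0 : ℝ) δ, ∃ X : TangentSpace (𝓡 d) (γ t),
    (∀ w : TangentSpace (𝓡 d) (γ t),
      σ.form (γ t) ![X, w] = mfderiv (𝓡 d) 𝓘(ℝ, ℝ) (zeroExtend h.1 t) (γ t) w) ∧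
    HasMFDerivWithinAt 𝓘(ℝ, ℝ) (𝓡 d) γ (Icc 0 δ) t ((1 : ℝ →L[ℝ] ℝ).smulRight X)

/-- The set of initial points at time `0` from which the Hamiltonian flow exists on all of `[0,δ]`
(everything, if `M` is compact). -/
def flowDomain (σ : SymplecticForm d M) (h : HamiltonianSpace d M δ) : Set M :=
  {m | ∃ γ : ℝ → M, γ 0 = m ∧ IsHamiltonianTrajectory σ h γ}

open Classical in
/-- The time `δ` Hamiltonian flow map `φ_δ^h`, with a junk value outside its domain. -/
noncomputable def hamiltonianFlow (σ : SymplecticForm d M) (h : HamiltonianSpace d M δ) (m : M) :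
    M :=
  if hm : m ∈ flowDomain σ h then hm.choose δ else m

end Hamiltonian

section FiberProduct

variable {r : ℕ} {d n : Fin (r + 1) → ℕ} {M Q : Fin (r + 1) → Type*} {δ : Fin (r + 1) → ℝ}
  [∀ j, TopologicalSpace (M j)] [∀ j, ChartedSpace (EuclideanSpace ℝ (Fin (d j))) (M j)]
  [∀ j, TopologicalSpace (Q j)] [∀ j, ChartedSpace (EuclideanSpace ℝ (Fin (n j))) (Q j)]

/-- The partial fiber product: tuples of points `ι j (p j) = (m_j', m_{j+1})` of the correspondences
`L_{j(j+1)} = range (ι j)` with `φ (m_i) = m_i'` for all `i ∈ I`. Indices are cyclic, addition in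
`Fin (r + 1)` being modulo `r + 1`, and each `i` is written as `i = j + 1`. -/
def partialFiberProduct (σ : ∀ j, SymplecticForm (d j) (M j)) (ι : ∀ j, Q j → M j × M (j + 1))
    (H : ∀ j, HamiltonianSpace (d j) (M j) (δ j)) (I : Set (Fin (r + 1))) : Set (∀ j, Q j) :=
  {p | ∀ j, j + 1 ∈ I →
    (ι j (p j)).2 ∈ flowDomain (σ (j + 1)) (H (j + 1)) ∧
    hamiltonianFlow (σ (j + 1)) (H (j + 1)) (ι j (p j)).2 = (ι (j + 1) (p (j + 1))).1}

/-- The linearization `v_i' - Dφ (v_i)`, `i = j + 1`, of the equation `φ (m_i) = m_i'` at `p`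
in the direction `u`. It takes values in the tangent space of `M i` at `m_i' = φ (m_i)`. -/
noncomputable def linearizedEquation (σ : ∀ j, SymplecticForm (d j) (M j))
    (ι : ∀ j, Q j → M j × M (j + 1)) (H : ∀ j, HamiltonianSpace (d j) (M j) (δ j))
    (p : ∀ j, Q j) (u : ∀ j, TangentSpace (𝓡 (n j)) (p j)) (j : Fin (r + 1)) :
    TangentSpace (𝓡 (d (j + 1))) (ι (j + 1) (p (j + 1))).1 :=
  let v' : EuclideanSpace ℝ (Fin (d (j + 1))) :=
    (mfderiv (𝓡 (n (j + 1))) ((𝓡 (d (j + 1))).prod (𝓡 (d (j + 1 + 1)))) (ι (j + 1)) (p (j + 1))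
      (u (j + 1))).1
  let v : EuclideanSpace ℝ (Fin (d (j + 1))) :=
    (mfderiv (𝓡 (n j)) ((𝓡 (d j)).prod (𝓡 (d (j + 1)))) (ι j) (p j) (u j)).2
  let Dφv : EuclideanSpace ℝ (Fin (d (j + 1))) :=
    mfderiv (𝓡 (d (j + 1))) (𝓡 (d (j + 1))) (hamiltonianFlow (σ (j + 1)) (H (j + 1)))
      (ι j (p j)).2 v
  (v' - Dφv : EuclideanSpace ℝ (Fin (d (j + 1))))

/-- The equations `φ (m_i) = m_i'`, `i ∈ I`, are transversal: at every solution their simultaneous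
linearization, from the tangent space of the product of the correspondences to the sum over
`i ∈ I` of the tangent spaces of `M i`, is surjective. -/
def DefiningEquationsTransversal (σ : ∀ j, SymplecticForm (d j) (M j))
    (ι : ∀ j, Q j → M j × M (j + 1)) (H : ∀ j, HamiltonianSpace (d j) (M j) (δ j))
    (I : Set (Fin (r + 1))) : Prop :=
  ∀ p ∈ partialFiberProduct σ ι H I,
    Function.Surjective
      (fun (u : ∀ j, TangentSpace (𝓡 (n j)) (p j)) (j : {j : Fin (r + 1) // j + 1 ∈ I}) =>
        linearizedEquation σ ι H p u j.1)

end FiberProduct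

/-! ## Sard's theorem and parametric transversality -/

/-! Idea of the proof. Let `D` be the set of tuples of Hamiltonians whose flows are defined on the
projections of all the correspondences. `D` is open, because the flow domain is open jointly in the
Hamiltonian and the initial point and the correspondences are compact. `D` is dense, because
compactly supported Hamiltonians have complete flows and approximate every Hamiltonian in a topology
that only sees compact sets. For each `I`, transversality at a point `p` is an open condition on
pairs `(H, p)` with `H ∈ D`. Compactness of the product of the correspondences therefore makes
transversality at all points open in `H`.

Density is local in `p` (`dense_inter_setOf_forall`). It suffices to find, for each `H₀ ∈ D` and
each `p₀`, one neighbourhood `K` of `p₀` such that every `H` near `H₀` is a limit of Hamiltonians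
transversal along `K`. Since `K` does not depend on `H`, finitely many such neighbourhoods cover the
compact product, and finitely many open dense conditions can be intersected; no Baire argument is
needed. The same applies to the finitely many subsets `I`.

The local statement is parametric transversality (`dense_setOf_regular`). If the equations contain a
finite-dimensional parameter `s` in which their derivative is invertible, the zero set is a
manifold, and by Sard's theorem almost every `s` is a regular value of its projection to the
parameter space; for such `s` the equations are transversal. The parameters come from
`exists_control`. In a chart around the end point of a trajectory, choose the desired variation
`β(t) s`, where `β` is zero at early times and one at time `δ`. The variational equation then
determines the covector along the trajectory whose Hamiltonian vector field produces this variation.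
A cut-off function that is linear in the chart realizes that covector, so the end point moves
exactly by `s` to first order.

The analytic input is the dependence of flows on initial values and on the Hamiltonian. Cut-offs,
Picard-Lindelöf and Gronwall give solutions near a given one. The derivative of the end point solves
the linearized equation, and feeding the linearized system back into the same argument gives
smoothness. What is transported through charts and compositions is `C1Family`: smoothness in the
initial point for each Hamiltonian, together with joint continuity of values and first derivatives.
This is enough because surjectivity of a derivative is an open condition, while Sard's theorem is
applied to one Hamiltonian at a time. -/

open MeasureTheory in
theorem measure_image_eq_zero_of_locally {X Y : Type*} [TopologicalSpace X]
    [SecondCountableTopology X] [MeasurableSpace Y] {μ : Measure Y} {f : X → Y} {S : Set X}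
    (h : ∀ x ∈ S, ∃ V ∈ 𝓝 x, μ (f '' (S ∩ V)) = 0) : μ (f '' S) = 0 := by
  choose! V hV hμ using h
  -- Second countability gives a countable subcover (Lindelöf), and countable unions of null sets
  -- are null.
  obtain ⟨t, htS, htc, hcov⟩ := TopologicalSpace.countable_cover_nhdsWithin
    (f := fun x => S ∩ V x) (s := S)
    (fun x hx => Filter.inter_mem self_mem_nhdsWithin (mem_nhdsWithin_of_mem_nhds (hV x hx)))
  refine measure_mono_null (image_mono hcov) ?_
  rw [image_iUnion₂]
  exact (measure_biUnion_null_iff htc).2 fun x hx => hμ x (htS hx)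

/-- A smooth inverse function theorem on open sets. -/
theorem exists_smooth_local_inverse {E F : Type*} [NormedAddCommGroup E] [NormedSpace ℝ E]
    [FiniteDimensional ℝ E] [NormedAddCommGroup F] [NormedSpace ℝ F]
    {h : E → F} {U : Set E} (hU : IsOpen U) (hh : ContDiffOn ℝ ∞ h U) {x₀ : E} (hx₀ : x₀ ∈ U)
    (e : E ≃L[ℝ] F) (he : fderiv ℝ h x₀ = e) :
    ∃ (ψ : F → E) (W : Set F), IsOpen W ∧ h x₀ ∈ W ∧ ContDiffOn ℝ ∞ ψ W ∧
      (∀ z ∈ W, ψ z ∈ U ∧ h (ψ z) = z) ∧ ∃ V ∈ 𝓝 x₀, ∀ x ∈ V, h x ∈ W ∧ ψ (h x) = x := by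
  have : CompleteSpace E := FiniteDimensional.complete ℝ E
  have hcd : ∀ x ∈ U, ContDiffAt ℝ ∞ h x := fun x hx => hh.contDiffAt (hU.mem_nhds hx)
  have hd : HasFDerivAt h (e : E →L[ℝ] F) x₀ := by
    rw [← he]; exact ((hcd x₀ hx₀).differentiableAt (by simp)).hasFDerivAt
  set φ := (hcd x₀ hx₀).toOpenPartialHomeomorph h hd (by simp) with hφ
  have hφc : (φ : E → F) = h := rfl
  have hx₀φ : x₀ ∈ φ.source := (hcd x₀ hx₀).mem_toOpenPartialHomeomorph_source hd (by simp)
  -- the open set of points where the derivative is invertible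
  have hcont : ContinuousOn (fderiv ℝ h) U := hh.continuousOn_fderiv_of_isOpen hU (by simp)
  have hinv : ∀ᶠ x in 𝓝 x₀, fderiv ℝ h x ∈ range ((↑) : (E ≃L[ℝ] F) → E →L[ℝ] F) :=
    (hcont.continuousAt (hU.mem_nhds hx₀)).eventually (he ▸ ContinuousLinearEquiv.nhds e)
  obtain ⟨A, hAsub, hAo, hxA⟩ := mem_nhds_iff.1
    (Filter.inter_mem (hU.mem_nhds hx₀) hinv)
  -- The inverse is smooth at a point only where the derivative at its preimage is invertible, so
  -- the target is cut down to the points whose preimages lie in `A`.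
  refine ⟨φ.symm, φ.target ∩ φ.symm ⁻¹' A, φ.isOpen_inter_preimage_symm hAo, ?_, ?_, ?_, ?_⟩
  · exact ⟨φ.map_source hx₀φ, by rw [mem_preimage, ← hφc, φ.left_inv hx₀φ]; exact hxA⟩
  · rintro z ⟨hz, hzA⟩
    obtain ⟨hzU, e', he'⟩ := hAsub hzA
    refine (φ.contDiffAt_symm (f₀' := e') hz ?_ (hcd _ hzU)).contDiffWithinAt
    rw [he', hφc]
    exact ((hcd _ hzU).differentiableAt (by simp)).hasFDerivAt
  · rintro z ⟨hz, hzA⟩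
    exact ⟨(hAsub hzA).1, φ.right_inv hz⟩
  · refine ⟨φ.source ∩ A, (φ.open_source.inter hAo).mem_nhds ⟨hx₀φ, hxA⟩, fun x hx => ?_⟩
    refine ⟨⟨φ.map_source hx.1, ?_⟩, φ.left_inv hx.1⟩
    rw [mem_preimage, ← hφc, φ.left_inv hx.1]; exact hx.2

/-- Straightening the level sets of a function with nonzero differential. -/
theorem exists_straightening {E : Type*} [NormedAddCommGroup E] [NormedSpace ℝ E]
    [FiniteDimensional ℝ E] {w : E → ℝ} {U : Set E} (hU : IsOpen U) (hw : ContDiffOn ℝ ∞ w U)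
    {x₀ : E} (hx₀ : x₀ ∈ U) (hd : fderiv ℝ w x₀ ≠ 0) :
    ∃ (ψ : ℝ × (LinearMap.ker (fderiv ℝ w x₀).toLinearMap) → E)
      (W : Set (ℝ × (LinearMap.ker (fderiv ℝ w x₀).toLinearMap))),
      IsOpen W ∧ ContDiffOn ℝ ∞ ψ W ∧ (∀ z ∈ W, ψ z ∈ U ∧ w (ψ z) = z.1) ∧
      ∃ V ∈ 𝓝 x₀, ∀ x ∈ V, ∃ z ∈ W, ψ z = x := by
  set ℓ := fderiv ℝ w x₀ with hℓ
  obtain ⟨v, hv⟩ : ∃ v, ℓ v = 1 := by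
    obtain ⟨v, hv⟩ : ∃ v, ℓ v ≠ 0 := by
      by_contra! H; exact hd (ContinuousLinearMap.ext H)
    exact ⟨(ℓ v)⁻¹ • v, by simp [hv]⟩
  let π : E →L[ℝ] LinearMap.ker ℓ.toLinearMap :=
    (ContinuousLinearMap.id ℝ E - ℓ.smulRight v).codRestrict _ (fun x => by simp [hv])
  -- With `ℓ v = 1`, the space splits as `ℝ v ⊕ ker ℓ`, and `e` is the derivative of `x ↦ (w x, π
  -- x)` at `x₀`. The local inverse of this map therefore has `w` as its first coordinate.
  let e : E ≃L[ℝ] ℝ × LinearMap.ker ℓ.toLinearMap :=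
    ContinuousLinearEquiv.equivOfInverse (ℓ.prod π)
      (((ContinuousLinearMap.fst ℝ ℝ _).smulRight v) +
        (Submodule.subtypeL _).comp (ContinuousLinearMap.snd ℝ ℝ _))
      (fun x => by simp [π])
      (fun z => by
        have : ℓ z.2 = 0 := z.2.2
        ext <;> simp [π, hv, this])
  have hdw : DifferentiableAt ℝ w x₀ := (hw.contDiffAt (hU.mem_nhds hx₀)).differentiableAt (by simp)
  obtain ⟨ψ, W, hWo, -, hψ, h1, V, hV, h2⟩ := exists_smooth_local_inverse
    (h := fun x => (w x, π x)) hU (hw.prodMk π.contDiff.contDiffOn) hx₀ e (by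
      refine HasFDerivAt.fderiv ?_
      exact hdw.hasFDerivAt.prodMk π.hasFDerivAt)
  refine ⟨ψ, W, hWo, hψ, fun z hz => ⟨(h1 z hz).1, ?_⟩, V, hV, fun x hx => ⟨_, (h2 x hx).1, (h2 x hx).2⟩⟩
  exact congrArg Prod.fst (h1 z hz).2

theorem fderiv_eq_zero_of_iteratedFDeriv_one {E F : Type*} [NormedAddCommGroup E] [NormedSpace ℝ E]
    [NormedAddCommGroup F] [NormedSpace ℝ F] {f : E → F} {x : E}
    (h : iteratedFDeriv ℝ 1 f x = 0) : fderiv ℝ f x = 0 := by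
  rw [← norm_eq_zero, ← norm_iteratedFDeriv_zero (𝕜 := ℝ), norm_iteratedFDeriv_fderiv, h, norm_zero]

/-- A surjection `A` has a right inverse `R`. For `B` near `A` the composite `B R` is near the
identity, hence invertible, and this makes `B` surjective. -/
theorem isOpen_setOf_surjective {E F : Type*} [NormedAddCommGroup E] [NormedSpace ℝ E]
    [NormedAddCommGroup F] [NormedSpace ℝ F] [FiniteDimensional ℝ F] :
    IsOpen {A : E →L[ℝ] F | Function.Surjective A} := by
  rw [isOpen_iff_mem_nhds]
  intro A hA
  have : CompleteSpace F := FiniteDimensional.complete ℝ F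
  obtain ⟨R, hR⟩ := A.toLinearMap.exists_rightInverse_of_surjective (LinearMap.range_eq_top.2 hA)
  let R' : F →L[ℝ] E := LinearMap.toContinuousLinearMap R
  have hc : Filter.Tendsto (fun B : E →L[ℝ] F => B.comp R') (𝓝 A)
      (𝓝 ((ContinuousLinearEquiv.refl ℝ F : F ≃L[ℝ] F) : F →L[ℝ] F)) := by
    have h1 : A.comp R' = ((ContinuousLinearEquiv.refl ℝ F : F ≃L[ℝ] F) : F →L[ℝ] F) := by
      ext x; exact LinearMap.congr_fun hR x
    rw [← h1]
    exact (continuous_id.clm_comp continuous_const).tendsto A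
  filter_upwards [hc.eventually (ContinuousLinearEquiv.nhds _)] with B hB
  obtain ⟨e, he⟩ := hB
  intro y
  exact ⟨R' (e.symm y), by
    have := DFunLike.congr_fun he (e.symm y)
    simpa using this.symm⟩

/-- If the derivatives of orders `1, …, k` vanish at `x`, the increments from `x` are of order
`k + 1`, locally uniformly. -/
theorem norm_sub_le_of_iteratedFDeriv_eq_zero {E : Type} [NormedAddCommGroup E] [NormedSpace ℝ E]
    {U V : Set E} (hU : IsOpen U) (hVc : Convex ℝ V) (hVk : IsCompact V) (hVU : V ⊆ U) (k : ℕ) :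
    ∀ {F : Type} [NormedAddCommGroup F] [NormedSpace ℝ F] {f : E → F}, ContDiffOn ℝ ∞ f U →
      ∃ C : ℝ, 0 ≤ C ∧ ∀ x ∈ V, (∀ i, 1 ≤ i → i ≤ k → iteratedFDeriv ℝ i f x = 0) → ∀ y ∈ V,
        ‖f y - f x‖ ≤ C * ‖y - x‖ ^ (k + 1) := by
  induction k with
  | zero =>
    intro F _ _ f hf
    have hcont : ContinuousOn (fderiv ℝ f) V :=
      (hf.continuousOn_fderiv_of_isOpen hU (by simp)).mono hVU
    obtain ⟨C, hC⟩ := hVk.exists_bound_of_continuousOn hcont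
    refine ⟨max C 0, le_max_right _ _, fun x hx _ y hy => ?_⟩
    rw [zero_add, pow_one]
    refine hVc.norm_image_sub_le_of_norm_fderiv_le (𝕜 := ℝ) (fun z hz => ?_)
      (fun z hz => (hC z hz).trans (le_max_left _ _)) hx hy
    exact (hf.contDiffAt (hU.mem_nhds (hVU hz))).differentiableAt (by simp)
  | succ k ih =>
    intro F _ _ f hf
    obtain ⟨C, hC0, hC⟩ := ih (f := fderiv ℝ f) (hf.fderiv_of_isOpen hU (by simp))
    refine ⟨C, hC0, fun x hx hvan y hy => ?_⟩
    have hfx : fderiv ℝ f x = 0 := fderiv_eq_zero_of_iteratedFDeriv_one (hvan 1 le_rfl (by omega))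
    -- The induction hypothesis is applied to `fderiv ℝ f`, which vanishes at `x`. Its increments
    -- are thus its values, and the mean value inequality on the segment gains the missing power.
    have key : ∀ z ∈ segment ℝ x y, ‖fderiv ℝ f z‖ ≤ C * ‖y - x‖ ^ (k + 1) := by
      intro z hz
      have hzV : z ∈ V := hVc.segment_subset hx hy hz
      have := hC x hx (fun i hi hik => by
        rw [← norm_eq_zero, norm_iteratedFDeriv_fderiv, norm_eq_zero]
        exact hvan (i + 1) (by omega) (by omega)) z hzV
      rw [hfx, sub_zero] at this
      refine this.trans ?_
      gcongr
      exact norm_sub_le_of_mem_segment hz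
    have := (convex_segment x y).norm_image_sub_le_of_norm_fderiv_le (𝕜 := ℝ) (f := f)
      (fun z hz => (hf.contDiffAt (hU.mem_nhds (hVU (hVc.segment_subset hx hy hz)))).differentiableAt
        (by simp)) key (left_mem_segment ℝ x y) (right_mem_segment ℝ x y)
    rw [pow_succ, ← mul_assoc]; exact this

/-! ### Sard's theorem by induction on the dimension, and its parametric consequence -/

section Sard

open MeasureTheory

/-- The set where all derivatives of orders `1, …, k` vanish. -/
def flatSet {E F : Type*} [NormedAddCommGroup E] [NormedSpace ℝ E] [NormedAddCommGroup F]
    [NormedSpace ℝ F] (f : E → F) (U : Set E) (k : ℕ) : Set E :=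
  {x ∈ U | ∀ i, 1 ≤ i → i ≤ k → iteratedFDeriv ℝ i f x = 0}

/-- On the flat points `f` is locally Hölder of exponent `m + 1`, with `m` the dimension of the
source. The image then has Hausdorff dimension at most `m / (m + 1) < 1 ≤ n`, so its `n`-dimensional
measure vanishes. -/
theorem volume_image_flatSet_eq_zero {E : Type} [NormedAddCommGroup E] [NormedSpace ℝ E]
    [FiniteDimensional ℝ E] {n : ℕ} (hn : n ≠ 0) {f : E → Fin n → ℝ} {U : Set E} (hU : IsOpen U)
    (hf : ContDiffOn ℝ ∞ f U) : volume (f '' flatSet f U (Module.finrank ℝ E)) = 0 := by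
  set m := Module.finrank ℝ E
  refine measure_image_eq_zero_of_locally fun x hx => ?_
  obtain ⟨r, hr, hrU⟩ := Metric.nhds_basis_closedBall.mem_iff.1 (hU.mem_nhds hx.1)
  refine ⟨Metric.closedBall x r, Metric.closedBall_mem_nhds x hr, ?_⟩
  obtain ⟨C, hC0, hC⟩ := norm_sub_le_of_iteratedFDeriv_eq_zero hU (convex_closedBall x r)
    (isCompact_closedBall x r) hrU m hf
  have hol : HolderOnWith C.toNNReal (m + 1 : ℕ) f (flatSet f U m ∩ Metric.closedBall x r) := by
    intro a ha b hb
    have := hC a ha.2 ha.1.2 b hb.2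
    rw [edist_comm (f a), edist_comm a, edist_eq_enorm_sub, edist_eq_enorm_sub,
      ← ofReal_norm, ← ofReal_norm, NNReal.coe_natCast, ENNReal.rpow_natCast,
      ← ENNReal.ofReal_pow (norm_nonneg _), ← ENNReal.ofReal_coe_nnreal,
      Real.coe_toNNReal C hC0, ← ENNReal.ofReal_mul hC0]
    exact ENNReal.ofReal_le_ofReal this
  have hdim := hol.dimH_image_le (by positivity)
  have hdE : dimH (flatSet f U m ∩ Metric.closedBall x r) ≤ m :=
    (dimH_mono (subset_univ _)).trans (Real.dimH_univ_eq_finrank E).le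
  have hlt : dimH (f '' (flatSet f U m ∩ Metric.closedBall x r)) < ((n : NNReal) : ENNReal) := by
    refine hdim.trans_lt (lt_of_lt_of_le ?_ (b := 1) ?_)
    · refine ENNReal.div_lt_of_lt_mul ?_
      rw [one_mul]
      refine hdE.trans_lt ?_
      simp only [Nat.cast_add, Nat.cast_one, ENNReal.coe_add, ENNReal.coe_natCast, ENNReal.coe_one]
      exact_mod_cast Nat.lt_succ_self m
    · exact_mod_cast Nat.one_le_iff_ne_zero.2 hn
  have := hausdorffMeasure_of_dimH_lt hlt
  have h2 := hausdorffMeasure_pi_real (ι := Fin n)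
  rw [Fintype.card_fin] at h2
  rw [← h2]; exact_mod_cast this

/-- The set of critical points in `U`. -/
def critSet {E F : Type*} [NormedAddCommGroup E] [NormedSpace ℝ E] [NormedAddCommGroup F]
    [NormedSpace ℝ F] (f : E → F) (U : Set E) : Set E :=
  {x ∈ U | ¬ Function.Surjective (fderiv ℝ f x)}

/-- The assertion of Sard's theorem for all smooth maps on `m`-dimensional spaces. -/
def SardInDim (m : ℕ) : Prop :=
  ∀ (E : Type) [NormedAddCommGroup E] [NormedSpace ℝ E] [FiniteDimensional ℝ E],
    Module.finrank ℝ E = m → ∀ (n : ℕ) (f : E → Fin n → ℝ) (U : Set E), IsOpen U →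
      ContDiffOn ℝ ∞ f U → volume (f '' critSet f U) = 0

theorem finrank_ker_of_ne_zero {E : Type*} [NormedAddCommGroup E] [NormedSpace ℝ E]
    [FiniteDimensional ℝ E] {ℓ : E →L[ℝ] ℝ} (hℓ : ℓ ≠ 0) {m : ℕ} (hm : Module.finrank ℝ E = m + 1) :
    Module.finrank ℝ (LinearMap.ker ℓ.toLinearMap) = m := by
  have h1 := LinearMap.finrank_range_add_finrank_ker ℓ.toLinearMap
  have h2 : LinearMap.range ℓ.toLinearMap = ⊤ := by
    refine LinearMap.range_eq_top.2 (LinearMap.surjective fun h => hℓ ?_)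
    ext x; exact LinearMap.congr_fun h x
  rw [h2, finrank_top, Module.finrank_self] at h1
  omega

/-- Near such a point some component `w` of a `k`-th derivative has nonzero differential, while `w`
vanishes on the `k`-flat points. These points thus lie in a hypersurface of dimension `m`. As `k ≥
1` the restriction of `f` to it has derivative zero there, so for `n ≠ 0` they are critical points
of the restriction and `ih` applies. -/
theorem volume_image_flatSet_diff_eq_zero {m : ℕ} (ih : SardInDim m) {E : Type}
    [NormedAddCommGroup E] [NormedSpace ℝ E] [FiniteDimensional ℝ E]
    (hE : Module.finrank ℝ E = m + 1) {n : ℕ} (hn : n ≠ 0) {f : E → Fin n → ℝ} {U : Set E}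
    (hU : IsOpen U) (hf : ContDiffOn ℝ ∞ f U) {k : ℕ} (hk : 1 ≤ k) :
    volume (f '' (flatSet f U k \ flatSet f U (k + 1))) = 0 := by
  refine measure_image_eq_zero_of_locally fun x hx => ?_
  have hne : iteratedFDeriv ℝ (k + 1) f x ≠ 0 := by
    intro h0
    refine hx.2 ⟨hx.1.1, fun i hi hik => ?_⟩
    rcases Nat.lt_or_ge i (k + 1) with h | h
    · exact hx.1.2 i hi (by omega)
    · obtain rfl : i = k + 1 := by omega
      exact h0
  obtain ⟨u, hu⟩ : ∃ u, iteratedFDeriv ℝ (k + 1) f x u ≠ 0 := by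
    by_contra! H; exact hne (ContinuousMultilinearMap.ext H)
  obtain ⟨i, hi⟩ : ∃ i, iteratedFDeriv ℝ (k + 1) f x u i ≠ 0 := by
    by_contra! H; exact hu (funext H)
  have hD : ContDiffOn ℝ ∞ (iteratedFDeriv ℝ k f) U := fun y hy =>
    ((hf.contDiffAt (hU.mem_nhds hy)).iteratedFDeriv_right (m := ∞) (i := k) le_rfl).contDiffWithinAt
  let ev : ContinuousMultilinearMap ℝ (fun _ : Fin k => E) (Fin n → ℝ) →L[ℝ] ℝ :=
    (ContinuousLinearMap.proj (R := ℝ) (φ := fun _ : Fin n => ℝ) i).comp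
      (ContinuousMultilinearMap.apply ℝ (fun _ : Fin k => E) (Fin n → ℝ) (Fin.tail u))
  let w : E → ℝ := fun y => ev (iteratedFDeriv ℝ k f y)
  have hw : ContDiffOn ℝ ∞ w U := ev.contDiff.comp_contDiffOn hD
  have hdw : fderiv ℝ w x ≠ 0 := by
    intro h0
    have h1 : fderiv ℝ w x = ev.comp (fderiv ℝ (iteratedFDeriv ℝ k f) x) :=
      (ev.hasFDerivAt.comp x ((hD.contDiffAt (hU.mem_nhds hx.1.1)).differentiableAt
        (by simp)).hasFDerivAt).fderiv
    rw [iteratedFDeriv_succ_apply_left] at hi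
    apply hi
    have := DFunLike.congr_fun (h1.symm.trans h0) (u 0)
    simpa [ev] using this
  obtain ⟨ψ, W, hWo, hψ, h1, V, hV, h2⟩ := exists_straightening hU hw hx.1.1 hdw
  refine ⟨V, hV, ?_⟩
  let W₀ : Set (LinearMap.ker (fderiv ℝ w x).toLinearMap) := {y | ((0 : ℝ), y) ∈ W}
  have hW₀ : IsOpen W₀ := hWo.preimage (by fun_prop)
  have hg₀ : ContDiffOn ℝ ∞ (fun y => ψ ((0 : ℝ), y)) W₀ :=
    hψ.comp (contDiff_const.prodMk contDiff_id).contDiffOn fun y hy => hy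
  have hg : ContDiffOn ℝ ∞ (fun y => f (ψ ((0 : ℝ), y))) W₀ := hf.comp hg₀ fun y hy => (h1 _ hy).1
  refine measure_mono_null ?_ (ih _ (finrank_ker_of_ne_zero hdw hE) n _ W₀ hW₀ hg)
  rintro _ ⟨y, ⟨hy, hyV⟩, rfl⟩
  obtain ⟨⟨t, z⟩, hz, rfl⟩ := h2 y hyV
  have hw0 : w (ψ (t, z)) = 0 := by
    simp only [w, hy.1.2 k hk le_rfl, map_zero]
  obtain rfl : t = 0 := by rw [← hw0, (h1 _ hz).2]
  refine ⟨z, ⟨hz, ?_⟩, rfl⟩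
  have hDf : fderiv ℝ f (ψ (0, z)) = 0 :=
    fderiv_eq_zero_of_iteratedFDeriv_one (hy.1.2 1 le_rfl hk)
  have hd1 : DifferentiableAt ℝ f (ψ (0, z)) :=
    (hf.contDiffAt (hU.mem_nhds (h1 _ hz).1)).differentiableAt (by simp)
  have hd2 : DifferentiableAt ℝ (fun y => ψ ((0 : ℝ), y)) z :=
    (hg₀.contDiffAt (hW₀.mem_nhds hz)).differentiableAt (by simp)
  have : fderiv ℝ (fun y => f (ψ ((0 : ℝ), y))) z = 0 := by
    rw [fderiv_fun_comp z hd1 hd2, hDf, ContinuousLinearMap.zero_comp]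
  rw [this]
  intro hs
  obtain ⟨v, hv⟩ := hs 1
  have := congrFun hv ⟨0, Nat.pos_of_ne_zero hn⟩
  simp at this

/-- The points with zero derivative split into those that fail to be flat at some order up to `m +
1`, handled on hypersurfaces, and those flat to order `m + 1 = dim E`, handled by the Hölder
estimate. -/
theorem volume_image_flatSet_one_eq_zero {m : ℕ} (ih : SardInDim m) {E : Type}
    [NormedAddCommGroup E] [NormedSpace ℝ E] [FiniteDimensional ℝ E]
    (hE : Module.finrank ℝ E = m + 1) {n : ℕ} (hn : n ≠ 0) {f : E → Fin n → ℝ} {U : Set E}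
    (hU : IsOpen U) (hf : ContDiffOn ℝ ∞ f U) : volume (f '' flatSet f U 1) = 0 := by
  have key : ∀ k, volume (f '' (flatSet f U 1 \ flatSet f U (k + 1))) = 0 := by
    intro k
    induction k with
    | zero => simp
    | succ k ihk =>
      refine measure_mono_null (t := f '' (flatSet f U 1 \ flatSet f U (k + 1)) ∪
        f '' (flatSet f U (k + 1) \ flatSet f U (k + 2))) ?_ ?_
      · rw [← image_union]
        refine image_mono fun x hx => ?_
        by_cases h : x ∈ flatSet f U (k + 1)
        · exact Or.inr ⟨h, hx.2⟩
        · exact Or.inl ⟨hx.1, h⟩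
      · exact measure_union_null ihk
          (volume_image_flatSet_diff_eq_zero ih hE hn hU hf (by omega))
  refine measure_mono_null (t := f '' (flatSet f U 1 \ flatSet f U (m + 1)) ∪
    f '' (flatSet f U (m + 1))) ?_ (measure_union_null (key m) ?_)
  · rw [← image_union]
    refine image_mono fun x hx => ?_
    by_cases h : x ∈ flatSet f U (m + 1)
    · exact Or.inr h
    · exact Or.inl ⟨hx, h⟩
  · rw [← hE]; exact volume_image_flatSet_eq_zero hn hU hf

/-- Some component `f i` has nonzero differential and can be taken as a coordinate. Then `f` maps
slices `f i = t` to slices, and a critical point of `f` is a critical point of the remaining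
components on its slice. Each slice of the image is null by `ih`, and Fubini concludes. -/
theorem volume_image_crit_diff_eq_zero {m : ℕ} (ih : SardInDim m) {E : Type}
    [NormedAddCommGroup E] [NormedSpace ℝ E] [FiniteDimensional ℝ E]
    (hE : Module.finrank ℝ E = m + 1) {n : ℕ} {f : E → Fin (n + 1) → ℝ} {U : Set E}
    (hU : IsOpen U) (hf : ContDiffOn ℝ ∞ f U) :
    volume (f '' (critSet f U \ {x | fderiv ℝ f x = 0})) = 0 := by
  refine measure_image_eq_zero_of_locally fun x hx => ?_
  have hfd : ∀ y ∈ U, DifferentiableAt ℝ f y := fun y hy =>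
    (hf.contDiffAt (hU.mem_nhds hy)).differentiableAt (by simp)
  obtain ⟨v, hv⟩ : ∃ v, fderiv ℝ f x v ≠ 0 := by
    by_contra! H; exact hx.2 (ContinuousLinearMap.ext H)
  obtain ⟨i, hi⟩ : ∃ i, fderiv ℝ f x v i ≠ 0 := by
    by_contra! H; exact hv (funext H)
  let w : E → ℝ := fun y => f y i
  have hw : ContDiffOn ℝ ∞ w U := contDiffOn_pi.1 hf i
  have hdw : fderiv ℝ w x ≠ 0 := by
    intro h0
    have h1 := (hasFDerivAt_pi'.1 (hfd x hx.1.1).hasFDerivAt i).fderiv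
    exact hi (DFunLike.congr_fun (h1.symm.trans h0) v)
  obtain ⟨ψ, W, hWo, hψ, h1, V, hV, h2⟩ := exists_straightening hU hw hx.1.1 hdw
  obtain ⟨K, hKx, hKsub, hK⟩ := local_compact_nhds (Filter.inter_mem hV (hU.mem_nhds hx.1.1))
  refine ⟨K, hKx, ?_⟩
  refine measure_mono_null (t := f '' (critSet f U ∩ K))
    (image_mono (inter_subset_inter_left _ sdiff_subset)) ?_
  -- Fubini needs a measurable set. Localizing to a compact neighbourhood makes the set of critical
  -- values compact.
  have hcrit : IsCompact (critSet f U ∩ K) := by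
    have hcont : ContinuousOn (fderiv ℝ f) K :=
      (hf.continuousOn_fderiv_of_isOpen hU (by simp)).mono fun y hy => (hKsub hy).2
    have hop : IsOpen {A : E →L[ℝ] (Fin (n + 1) → ℝ) | Function.Surjective A} :=
      isOpen_setOf_surjective
    have h3 := hcont.preimage_isClosed_of_isClosed hK.isClosed hop.isClosed_compl
    have h4 : critSet f U ∩ K = K ∩ fderiv ℝ f ⁻¹' {A | Function.Surjective A}ᶜ := by
      ext y
      exact ⟨fun hy => ⟨hy.2, hy.1.2⟩, fun hy => ⟨⟨(hKsub hy.1).2, hy.2⟩, hy.1⟩⟩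
    rw [h4]
    exact hK.of_isClosed_subset h3 inter_subset_left
  have hS : IsCompact (f '' (critSet f U ∩ K)) :=
    hcrit.image_of_continuousOn (hf.continuousOn.mono fun y hy => hy.1.1)
  have mp := volume_preserving_piFinSuccAbove (fun _ : Fin (n + 1) => ℝ) i
  rw [← mp.symm.measure_preimage hS.measurableSet.nullMeasurableSet]
  have hmeas := (MeasurableEquiv.piFinSuccAbove (fun _ : Fin (n + 1) => ℝ) i).symm.measurable
    hS.measurableSet
  refine (Measure.measure_prod_null hmeas).2 (Filter.Eventually.of_forall fun t => ?_)
  let Wt : Set (LinearMap.ker (fderiv ℝ w x).toLinearMap) := {y | (t, y) ∈ W}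
  have hWt : IsOpen Wt := hWo.preimage (by fun_prop)
  let p : (Fin (n + 1) → ℝ) →L[ℝ] (Fin n → ℝ) :=
    ContinuousLinearMap.pi fun j => ContinuousLinearMap.proj (i.succAbove j)
  have hg₀ : ContDiffOn ℝ ∞ (fun y => ψ (t, y)) Wt :=
    hψ.comp (contDiff_const.prodMk contDiff_id).contDiffOn fun y hy => hy
  have hg : ContDiffOn ℝ ∞ (fun y => p (f (ψ (t, y)))) Wt :=
    p.contDiff.comp_contDiffOn (hf.comp hg₀ fun y hy => (h1 _ hy).1)
  refine measure_mono_null ?_ (ih _ (finrank_ker_of_ne_zero hdw hE) n _ Wt hWt hg)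
  rintro z ⟨y, ⟨hyc, hyK⟩, hyz⟩
  obtain ⟨⟨t', u⟩, hu, rfl⟩ := h2 y (hKsub hyK).1
  have hyz' : f (ψ (t', u)) = i.insertNth t z := hyz
  obtain rfl : t' = t := by
    have h3 : f (ψ (t', u)) i = t' := (h1 _ hu).2
    rw [← h3, hyz']; simp
  refine ⟨u, ⟨hu, fun hs => hyc.2 ?_⟩, ?_⟩
  · have hd1 : DifferentiableAt ℝ f (ψ (t', u)) := hfd _ (h1 _ hu).1
    have hd2 : DifferentiableAt ℝ ψ (t', u) :=
      (hψ.contDiffAt (hWo.mem_nhds hu)).differentiableAt (by simp)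
    have hF : HasFDerivAt (fun z => f (ψ z)) ((fderiv ℝ f (ψ (t', u))).comp (fderiv ℝ ψ (t', u)))
      (t', u) := hd1.hasFDerivAt.comp (t', u) hd2.hasFDerivAt
    -- Since `w ∘ ψ` is the first coordinate, the derivative of `f ∘ ψ` is block triangular with an
    -- identity block. Surjectivity on the slice would then force surjectivity of the full
    -- derivative.
    have hFi : ∀ a b, (fderiv ℝ f (ψ (t', u))) (fderiv ℝ ψ (t', u) (a, b)) i = a := by
      have h5 := hasFDerivAt_pi'.1 hF i
      have h6 : HasFDerivAt (fun z => f (ψ z) i) (ContinuousLinearMap.fst ℝ ℝ _) (t', u) := by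
        refine hasFDerivAt_fst.congr_of_eventuallyEq ?_
        filter_upwards [hWo.mem_nhds hu] with z hz using (h1 z hz).2
      intro a b
      exact DFunLike.congr_fun (h5.unique h6) (a, b)
    have hg' : HasFDerivAt (fun y => p (f (ψ (t', y))))
        (p.comp (((fderiv ℝ f (ψ (t', u))).comp (fderiv ℝ ψ (t', u))).comp
          (ContinuousLinearMap.inr ℝ ℝ _))) u :=
      p.hasFDerivAt.comp u (HasFDerivAt.comp u hF (hasFDerivAt_prodMk_right t' u))
    rw [hg'.fderiv] at hs
    intro c
    -- To reach `c`, the direction `(c i, 0)` matches the component `i`; the vector `v'` inside the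
    -- slice corrects the remaining components without changing it.
    set b₀ := fderiv ℝ f (ψ (t', u)) (fderiv ℝ ψ (t', u) (c i, 0)) with hb₀
    obtain ⟨v', hv'⟩ := hs (p (c - b₀))
    refine ⟨fderiv ℝ ψ (t', u) (c i, v'), ?_⟩
    have hsplit : ((c i, v') : ℝ × LinearMap.ker (fderiv ℝ w x).toLinearMap)
      = (c i, 0) + (0, v') := by simp
    funext j
    rcases Fin.eq_self_or_eq_succAbove i j with rfl | ⟨j, rfl⟩
    · rw [hFi]
    · rw [hsplit, map_add, map_add, ← hb₀]
      have := congrFun hv' j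
      simp only [ContinuousLinearMap.comp_apply, ContinuousLinearMap.inr_apply] at this
      simp only [p, ContinuousLinearMap.pi_apply, ContinuousLinearMap.proj_apply,
        Pi.sub_apply] at this
      simp [this]
  · funext j
    simp [p, hyz']

/-- The degenerate cases are separate: for `n = 0` every map is a submersion, and for `m = 0` the
image has at most one point, which is null once `n > 0`. -/
theorem sardInDim (m : ℕ) : SardInDim m := by
  have hzero : ∀ (E : Type) [NormedAddCommGroup E] [NormedSpace ℝ E] (f : E → Fin 0 → ℝ)
      (U : Set E), volume (f '' critSet f U) = 0 := by
    intro E _ _ f U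
    have : critSet f U = ∅ := by
      ext x
      simp only [critSet, mem_ofPred_eq, mem_empty_iff_false, iff_false, not_and, not_not]
      exact fun _ y => ⟨0, Subsingleton.elim _ _⟩
    simp [this]
  induction m with
  | zero =>
    intro E _ _ _ hE n f U hU hf
    rcases n with _ | n
    · exact hzero E f U
    · have : Subsingleton E := Module.finrank_zero_iff.1 hE
      exact (Set.subsingleton_of_subsingleton.image f).measure_zero volume
  | succ m ih =>
    intro E _ _ _ hE n f U hU hf
    rcases n with _ | n
    · exact hzero E f U
    · refine measure_mono_null (t := f '' (critSet f U \ {x | fderiv ℝ f x = 0}) ∪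
        f '' flatSet f U 1) ?_ (measure_union_null (volume_image_crit_diff_eq_zero ih hE hU hf)
          (volume_image_flatSet_one_eq_zero ih hE (by omega) hU hf))
      rw [← image_union]
      refine image_mono fun x hx => ?_
      by_cases h : fderiv ℝ f x = 0
      · refine Or.inr ⟨hx.1, fun i hi hi1 => ?_⟩
        obtain rfl : i = 1 := by omega
        rw [← norm_eq_zero, ← norm_iteratedFDeriv_fderiv (n := 0), norm_iteratedFDeriv_zero, h,
          norm_zero]
      · exact Or.inl ⟨hx, h⟩

/-- **Sard's theorem**: the set of critical values of a smooth map is a null set. -/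
theorem volume_image_critSet_eq_zero {E : Type} [NormedAddCommGroup E] [NormedSpace ℝ E]
    [FiniteDimensional ℝ E] {n : ℕ} {f : E → Fin n → ℝ} {U : Set E} (hU : IsOpen U)
    (hf : ContDiffOn ℝ ∞ f U) : volume (f '' critSet f U) = 0 :=
  sardInDim _ E rfl n f U hU hf

/-- **Parametric transversality**: if the derivative of `G` in the parameter is invertible at all
zeros, then for a dense set of parameters zero is a regular value. -/
theorem dense_setOf_regular {S N F : Type} [NormedAddCommGroup S] [NormedSpace ℝ S]
    [FiniteDimensional ℝ S] [NormedAddCommGroup N] [NormedSpace ℝ N] [FiniteDimensional ℝ N]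
    [NormedAddCommGroup F] [NormedSpace ℝ F] [FiniteDimensional ℝ F] {G : S × N → F}
    {O : Set (S × N)} (hO : IsOpen O) (hG : ContDiffOn ℝ ∞ G O)
    (hs : ∀ z ∈ O, G z = 0 →
      Function.Bijective ((fderiv ℝ G z).comp (ContinuousLinearMap.inl ℝ S N))) :
    Dense {s | ∀ p, (s, p) ∈ O → G (s, p) = 0 →
      Function.Surjective ((fderiv ℝ G (s, p)).comp (ContinuousLinearMap.inr ℝ S N))} := by
  let e : S ≃L[ℝ] (Fin (Module.finrank ℝ S) → ℝ) :=
    ContinuousLinearEquiv.ofFinrankEq (by simp)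
  let Z : Set (S × N) := {z ∈ O | G z = 0 ∧
    ¬ Function.Surjective ((fderiv ℝ G z).comp (ContinuousLinearMap.inr ℝ S N))}
  have hnull : volume ((fun z : S × N => e z.1) '' Z) = 0 := by
    refine measure_image_eq_zero_of_locally fun z hz => ?_
    obtain ⟨hzO, hz0, -⟩ := hz
    have hGd : ∀ z ∈ O, DifferentiableAt ℝ G z := fun z hz =>
      (hG.contDiffAt (hO.mem_nhds hz)).differentiableAt (by simp)
    let A : S ≃L[ℝ] F := ContinuousLinearEquiv.ofBijective
      ((fderiv ℝ G z).comp (ContinuousLinearMap.inl ℝ S N))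
      (LinearMap.ker_eq_bot.2 (hs z hzO hz0).1) (LinearMap.range_eq_top.2 (hs z hzO hz0).2)
    have hA : ∀ u, A u = fderiv ℝ G z (u, 0) := fun u => rfl
    let B : N →L[ℝ] F := (fderiv ℝ G z).comp (ContinuousLinearMap.inr ℝ S N)
    have hB : ∀ u v, fderiv ℝ G z (u, v) = A u + B v := by
      intro u v
      rw [hA]
      simp only [B, ContinuousLinearMap.comp_apply, ContinuousLinearMap.inr_apply, ← map_add]
      simp
    -- Invertibility in the parameter makes `(s, p) ↦ (G (s, p), p)` a local diffeomorphism. Near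
    -- `z` the zero set is therefore a graph over `N`, parametrized by `p`; bad parameters will be
    -- critical values of its projection to `S`.
    let E' : (S × N) ≃L[ℝ] (F × N) := ContinuousLinearEquiv.equivOfInverse
      ((fderiv ℝ G z).prod (ContinuousLinearMap.snd ℝ S N))
      (((A.symm : F →L[ℝ] S).comp (ContinuousLinearMap.fst ℝ F N -
        B.comp (ContinuousLinearMap.snd ℝ F N))).prod (ContinuousLinearMap.snd ℝ F N))
      (fun y => by
        obtain ⟨u, v⟩ := y
        simp [hB])
      (fun y => by simp [hB])
    obtain ⟨ψ, W, hWo, -, hψ, h1, V, hV, h2⟩ := exists_smooth_local_inverse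
      (h := fun y : S × N => (G y, y.2)) hO (hG.prodMk contDiff_snd.contDiffOn) hzO E'
      ((hGd z hzO).hasFDerivAt.prodMk hasFDerivAt_snd).fderiv
    refine ⟨V, hV, ?_⟩
    let W₀ : Set N := {p | ((0 : F), p) ∈ W}
    have hW₀ : IsOpen W₀ := hWo.preimage (by fun_prop)
    have hg₀ : ContDiffOn ℝ ∞ (fun y => ψ ((0 : F), y)) W₀ :=
      hψ.comp (contDiff_const.prodMk contDiff_id).contDiffOn fun y hy => hy
    have hg : ContDiffOn ℝ ∞ (fun y => e (ψ ((0 : F), y)).1) W₀ :=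
      e.contDiff.comp_contDiffOn (contDiff_fst.comp_contDiffOn hg₀)
    refine measure_mono_null ?_ (volume_image_critSet_eq_zero hW₀ hg)
    rintro _ ⟨y, ⟨⟨hyO, hy0, hyc⟩, hyV⟩, rfl⟩
    obtain ⟨s, p⟩ := y
    obtain ⟨hyW, hψy⟩ := h2 _ hyV
    simp only [hy0] at hyW hψy
    refine ⟨p, ⟨hyW, fun hsurj => hyc ?_⟩, by simp [hψy]⟩
    have hd2 : DifferentiableAt ℝ (fun y => ψ ((0 : F), y)) p :=
      (hg₀.contDiffAt (hW₀.mem_nhds hyW)).differentiableAt (by simp)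
    set D := fderiv ℝ (fun y => ψ ((0 : F), y)) p with hD
    have hcomp : HasFDerivAt (fun y => G (ψ ((0 : F), y))) ((fderiv ℝ G (s, p)).comp D) p := by
      have h3 := hGd (s, p) hyO
      rw [← hψy] at h3 ⊢
      exact h3.hasFDerivAt.comp p hd2.hasFDerivAt
    have hzero : (fderiv ℝ G (s, p)).comp D = 0 := by
      refine hcomp.unique ((hasFDerivAt_const (0 : F) p).congr_of_eventuallyEq ?_)
      filter_upwards [hW₀.mem_nhds hyW] with q hq
      exact congrArg Prod.fst (h1 _ hq).2
    have hsnd : (ContinuousLinearMap.snd ℝ S N).comp D = ContinuousLinearMap.id ℝ N := by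
      have h4 : HasFDerivAt (fun y => (ψ ((0 : F), y)).2) ((ContinuousLinearMap.snd ℝ S N).comp D) p :=
        hasFDerivAt_snd.comp p hd2.hasFDerivAt
      refine h4.unique ((hasFDerivAt_id p).congr_of_eventuallyEq ?_)
      filter_upwards [hW₀.mem_nhds hyW] with q hq
      exact congrArg Prod.snd (h1 _ hq).2
    have hfst : HasFDerivAt (fun y => e (ψ ((0 : F), y)).1)
        ((e : S →L[ℝ] _).comp ((ContinuousLinearMap.fst ℝ S N).comp D)) p :=
      e.hasFDerivAt.comp p (hasFDerivAt_fst.comp p hd2.hasFDerivAt)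
    rw [hfst.fderiv] at hsurj
    intro c
    -- Choose `u` with `∂ₛG u = -c`. Regularity of the projection gives a tangent vector `(u, v)` of
    -- the zero set, so that `0 = ∂ₛG u + ∂ₚG v` and hence `∂ₚG v = c`.
    obtain ⟨u, hu⟩ := (hs (s, p) hyO hy0).2 (-c)
    obtain ⟨v, hv⟩ := hsurj (e u)
    refine ⟨v, ?_⟩
    have hv1 : (D v).1 = u := e.injective hv
    have hv2 : (D v).2 = v := DFunLike.congr_fun hsnd v
    have h5 : fderiv ℝ G (s, p) (D v) = 0 := DFunLike.congr_fun hzero v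
    have h6 : D v = (u, 0) + (0, v) := by ext <;> simp [hv1, hv2]
    rw [h6, map_add] at h5
    simp only [ContinuousLinearMap.comp_apply, ContinuousLinearMap.inl_apply] at hu
    simp only [ContinuousLinearMap.comp_apply, ContinuousLinearMap.inr_apply]
    rw [hu] at h5
    exact (neg_add_eq_zero.1 h5).symm
  have hdense : Dense ((fun z : S × N => e z.1) '' Z)ᶜ :=
    Measure.dense_of_ae (μ := volume) (compl_mem_ae_iff.2 hnull)
  have := hdense.preimage e.isOpenMap
  refine this.mono fun s hs' p hpO hp0 => ?_
  by_contra hcon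
  exact hs' ⟨(s, p), ⟨hpO, hp0, hcon⟩, rfl⟩

end Sard

/-! ## Smooth dependence of solutions of ordinary differential equations -/

section ODE

variable {E : Type} [NormedAddCommGroup E] [NormedSpace ℝ E]

/-- `α` solves `α' = X t α` on `[a, b]` and stays in `Ω`. -/
def SolvesODE (X : ℝ → E → E) (Ω : Set E) (a b : ℝ) (α : ℝ → E) : Prop :=
  ∀ t ∈ Icc a b, α t ∈ Ω ∧ HasDerivWithinAt α (X t (α t)) (Icc a b) t

namespace SolvesODE

variable {X : ℝ → E → E} {Ω : Set E} {a b : ℝ} {α : ℝ → E}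

theorem continuousOn (h : SolvesODE X Ω a b α) : ContinuousOn α (Icc a b) :=
  fun t ht => (h t ht).2.continuousWithinAt

theorem hasDerivWithinAt_Ici (h : SolvesODE X Ω a b α) {t : ℝ} (ht : t ∈ Ico a b) :
    HasDerivWithinAt α (X t (α t)) (Ici t) t :=
  (h t (Ico_subset_Icc_self ht)).2.mono_of_mem_nhdsWithin (Icc_mem_nhdsGE_of_mem ht)

theorem congr_field {Y : ℝ → E → E} {Ω' : Set E} (h : SolvesODE X Ω a b α)
    (hY : ∀ t ∈ Icc a b, α t ∈ Ω' ∧ Y t (α t) = X t (α t)) : SolvesODE Y Ω' a b α :=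
  fun t ht => ⟨(hY t ht).1, (hY t ht).2 ▸ (h t ht).2⟩

end SolvesODE

/-- The time interval is closed, so joint derivatives are derivatives within a set. In the space
direction the domain is open, and the derivative of a slice is an honest one. -/
theorem hasFDerivAt_slice {F : Type*} [NormedAddCommGroup F] [NormedSpace ℝ F] {X : ℝ → E → F}
    {Ω : Set E} {a b : ℝ} (hΩ : IsOpen Ω)
    (hX : ContDiffOn ℝ ∞ (Function.uncurry X) (Icc a b ×ˢ Ω)) {t : ℝ} (ht : t ∈ Icc a b) {x : E}
    (hx : x ∈ Ω) :
    HasFDerivAt (X t) ((fderivWithin ℝ (Function.uncurry X) (Icc a b ×ˢ Ω) (t, x)).comp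
      (ContinuousLinearMap.inr ℝ ℝ E)) x := by
  have h1 := (hX.differentiableOn (by simp) (t, x) ⟨ht, hx⟩).hasFDerivWithinAt
  have h2 := HasFDerivWithinAt.comp (s := Ω) x h1 (hasFDerivAt_prodMk_right t x).hasFDerivWithinAt
    (fun y hy => ⟨ht, hy⟩)
  exact h2.hasFDerivAt (hΩ.mem_nhds hx)

theorem uniqueDiffOn_Icc_prod {Ω : Set E} {a b : ℝ} (hab : a < b) (hΩ : IsOpen Ω) :
    UniqueDiffOn ℝ (Icc a b ×ˢ Ω) :=
  (uniqueDiffOn_Icc hab).prod hΩ.uniqueDiffOn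

theorem contDiffOn_fderiv_slice {F : Type*} [NormedAddCommGroup F] [NormedSpace ℝ F]
    {X : ℝ → E → F} {Ω : Set E} {a b : ℝ} (hab : a < b) (hΩ : IsOpen Ω)
    (hX : ContDiffOn ℝ ∞ (Function.uncurry X) (Icc a b ×ˢ Ω)) :
    ContDiffOn ℝ ∞ (fun p : ℝ × E => fderiv ℝ (X p.1) p.2) (Icc a b ×ˢ Ω) := by
  have h1 : ContDiffOn ℝ ∞ (fun p : ℝ × E =>
      (fderivWithin ℝ (Function.uncurry X) (Icc a b ×ˢ Ω) p).comp
        (ContinuousLinearMap.inr ℝ ℝ E)) (Icc a b ×ˢ Ω) :=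
    (hX.fderivWithin (uniqueDiffOn_Icc_prod hab hΩ) (by simp)).clm_comp contDiffOn_const
  exact h1.congr fun p hp => (hasFDerivAt_slice hΩ hX hp.1 hp.2).fderiv

/-- A bounded, uniformly Lipschitz time-dependent vector field has global solutions. -/
theorem exists_global_solution [CompleteSpace E] {Z : ℝ → E → E} {a b : ℝ} (hab : a ≤ b)
    (hlip : ∃ K, ∀ t ∈ Icc a b, LipschitzWith K (Z t)) (hbd : ∃ L : ℝ, ∀ t ∈ Icc a b, ∀ x, ‖Z t x‖ ≤ L)
    (hc : ∀ x, ContinuousOn (fun t => Z t x) (Icc a b)) (x : E) :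
    ∃ α : ℝ → E, α a = x ∧ SolvesODE Z univ a b α := by
  obtain ⟨K, hK⟩ := hlip
  obtain ⟨L, hL⟩ := hbd
  have hL0 : 0 ≤ L := (norm_nonneg _).trans (hL a (left_mem_Icc.2 hab) 0)
  have hba : 0 ≤ b - a := sub_nonneg.2 hab
  -- A curve of speed at most `L` moves by at most `L (b - a)`, so with this radius no shrinking of
  -- the time interval is required.
  have hpl : IsPicardLindelof Z (⟨a, left_mem_Icc.2 hab⟩ : Icc a b) x
      (L.toNNReal * (b - a).toNNReal) 0 L.toNNReal K := by
    refine ⟨fun t ht => (hK t ht).lipschitzOnWith, fun y _ => hc y, fun t ht y _ => ?_, ?_⟩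
    · rw [Real.coe_toNNReal L hL0]; exact hL t ht y
    · simp [hba]
  obtain ⟨α, hα, hα'⟩ := hpl.exists_eq_forall_mem_Icc_hasDerivWithinAt₀
  exact ⟨α, hα, fun t ht => ⟨mem_univ _, hα' t ht⟩⟩

theorem exists_cutoff [FiniteDimensional ℝ E] {C Ω : Set E} (hC : IsCompact C) (hΩ : IsOpen Ω)
    (hCΩ : C ⊆ Ω) : ∃ χ : E → ℝ, ContDiff ℝ ∞ χ ∧ HasCompactSupport χ ∧ tsupport χ ⊆ Ω ∧
      (∀ x ∈ C, χ x = 1) ∧ ∀ x, |χ x| ≤ 1 := by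
  have : ProperSpace E := FiniteDimensional.proper ℝ E
  obtain ⟨L, hL, hCL, hLΩ⟩ := exists_compact_between hC hΩ hCΩ
  obtain ⟨f, hf1, hf0, hf⟩ := exists_contMDiffMap_one_nhds_of_subset_interior (n := (⊤ : ℕ∞)) 𝓘(ℝ, E)
    hC.isClosed hCL
  have hsupp : tsupport f ⊆ L := closure_minimal
    (fun x hx => by_contra fun h => hx (hf0 x h)) hL.isClosed
  refine ⟨f, f.contMDiff.contDiff, HasCompactSupport.of_support_subset_isCompact hL
    (subset_tsupport f |>.trans hsupp), hsupp.trans hLΩ, fun x hx => hf1.self_of_nhdsSet x hx,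
    fun x => abs_le.2 ⟨by linarith [(hf x).1], (hf x).2⟩⟩

/-- Cutting off a smooth vector field gives a bounded and Lipschitz one. -/
theorem cutoff_field_bounds {X : ℝ → E → E} {Ω : Set E} {a b : ℝ}
    (hab : a < b) (hX : ContDiffOn ℝ ∞ (Function.uncurry X) (Icc a b ×ˢ Ω)) (hΩ : IsOpen Ω)
    {χ : E → ℝ} (hχ : ContDiff ℝ ∞ χ) (hχc : HasCompactSupport χ) (hχΩ : tsupport χ ⊆ Ω) :
    (∃ K, ∀ t ∈ Icc a b, LipschitzWith K (fun x => χ x • X t x)) ∧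
    (∃ L : ℝ, ∀ t ∈ Icc a b, ∀ x, ‖χ x • X t x‖ ≤ L) ∧
    ∀ x, ContinuousOn (fun t => χ x • X t x) (Icc a b) := by
  set Z : ℝ → E → E := fun t x => χ x • X t x with hZ
  have hoff : ∀ x ∉ tsupport χ, ∀ᶠ y in 𝓝 x, ∀ t, Z t y = 0 := fun x hx => by
    filter_upwards [(isClosed_tsupport χ).isOpen_compl.mem_nhds hx] with y hy t
    simp [hZ, image_eq_zero_of_notMem_tsupport hy]
  have hZs : ContDiffOn ℝ ∞ (Function.uncurry Z) (Icc a b ×ˢ univ) := by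
    rintro ⟨t, x⟩ ⟨ht, -⟩
    by_cases hx : x ∈ Ω
    · have h1 : ContDiffOn ℝ ∞ (Function.uncurry Z) (Icc a b ×ˢ Ω) :=
        (hχ.comp contDiff_snd).contDiffOn.smul hX
      refine (h1 (t, x) ⟨ht, hx⟩).mono_of_mem_nhdsWithin ?_
      rw [nhdsWithin_prod_eq]
      exact Filter.prod_mem_prod self_mem_nhdsWithin (mem_nhdsWithin_of_mem_nhds (hΩ.mem_nhds hx))
    -- Outside `Ω` nothing is known about `X`, but there the cut-off field vanishes in a whole
    -- neighbourhood.
    · refine (contDiffWithinAt_const (c := (0 : E))).congr_of_eventuallyEq ?_ ?_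
      · have h1 := (hoff x fun h => hx (hχΩ h))
        have h2 : ∀ᶠ p : ℝ × E in 𝓝 (t, x), Function.uncurry Z p = 0 :=
          (continuousAt_snd.eventually h1).mono fun p hp => hp p.1
        exact h2.filter_mono nhdsWithin_le_nhds
      · exact (hoff x fun h => hx (hχΩ h)).self_of_nhds t
  have hcomp : IsCompact (Icc a b ×ˢ tsupport χ) := isCompact_Icc.prod hχc
  refine ⟨?_, ?_, fun x => ?_⟩
  · obtain ⟨C, hC⟩ := hcomp.exists_bound_of_continuousOn
      ((contDiffOn_fderiv_slice hab isOpen_univ hZs).continuousOn.mono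
        (prod_mono_right (subset_univ _)))
    refine ⟨C.toNNReal, fun t ht => lipschitzWith_of_nnnorm_fderiv_le (𝕜 := ℝ) (fun x => ?_)
      fun x => ?_⟩
    · exact (hasFDerivAt_slice isOpen_univ hZs ht (mem_univ x)).differentiableAt
    · by_cases hx : x ∈ tsupport χ
      · have := hC (t, x) ⟨ht, hx⟩
        rw [← norm_toNNReal]; exact Real.toNNReal_le_toNNReal this
      · have h0 : fderiv ℝ (Z t) x = 0 := by
          have : Z t =ᶠ[𝓝 x] fun _ => 0 := (hoff x hx).mono fun y hy => hy t
          rw [this.fderiv_eq]; simp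
        change ‖fderiv ℝ (Z t) x‖₊ ≤ _
        rw [h0]; simp
  · obtain ⟨C, hC⟩ := hcomp.exists_bound_of_continuousOn
      (hZs.continuousOn.mono (prod_mono_right (subset_univ _)))
    refine ⟨max C 0, fun t ht x => ?_⟩
    by_cases hx : x ∈ tsupport χ
    · exact (hC (t, x) ⟨ht, hx⟩).trans (le_max_left _ _)
    · simp [image_eq_zero_of_notMem_tsupport hx]
  · exact hZs.continuousOn.comp (f := fun t => (t, x)) (by fun_prop) fun t ht => ⟨ht, mem_univ _⟩

variable [FiniteDimensional ℝ E]

/-- Uniqueness of solutions of smooth differential equations. -/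
theorem SolvesODE.eqOn {X : ℝ → E → E} {Ω : Set E} {a b : ℝ} (hab : a < b) (hΩ : IsOpen Ω)
    (hX : ContDiffOn ℝ ∞ (Function.uncurry X) (Icc a b ×ˢ Ω)) {α β : ℝ → E}
    (hα : SolvesODE X Ω a b α) (hβ : SolvesODE X Ω a b β) (h : α a = β a) :
    EqOn α β (Icc a b) := by
  -- Both curves run in a compact subset of `Ω`. A cut-off equal to one there makes the field
  -- globally Lipschitz without changing it along the curves.
  obtain ⟨χ, h1, h2, h3, h4, -⟩ := exists_cutoff
    ((isCompact_Icc.image_of_continuousOn hα.continuousOn).union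
      (isCompact_Icc.image_of_continuousOn hβ.continuousOn)) hΩ
    (union_subset (image_subset_iff.2 fun t ht => (hα t ht).1)
      (image_subset_iff.2 fun t ht => (hβ t ht).1))
  obtain ⟨⟨K, hK⟩, -, -⟩ := cutoff_field_bounds hab hX hΩ h1 h2 h3
  have hα' : SolvesODE (fun t x => χ x • X t x) univ a b α :=
    hα.congr_field fun t ht => ⟨mem_univ _, by
      simp [h4 (α t) (Or.inl (mem_image_of_mem α ht))]⟩
  have hβ' : SolvesODE (fun t x => χ x • X t x) univ a b β :=
    hβ.congr_field fun t ht => ⟨mem_univ _, by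
      simp [h4 (β t) (Or.inr (mem_image_of_mem β ht))]⟩
  exact ODE_solution_unique_of_mem_Icc_right (s := fun _ => univ)
    (fun t ht => (hK t (Ico_subset_Icc_self ht)).lipschitzOnWith)
    hα.continuousOn (fun t ht => hα'.hasDerivWithinAt_Ici ht) (fun _ _ => mem_univ _)
    hβ.continuousOn (fun t ht => hβ'.hasDerivWithinAt_Ici ht) (fun _ _ => mem_univ _) h

/-- A crude form of the Gronwall bound, linear in the initial error and in the defect. Assuming `K ≥
1` removes the division by `K`. -/
theorem gronwallBound_le_of_le {K ρ ε x T : ℝ} (hK : 1 ≤ K) (hρ : 0 ≤ ρ) (hε : 0 ≤ ε) (hxT : x ≤ T) :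
    gronwallBound ρ K ε x ≤ (ρ + ε) * Real.exp (K * T) := by
  rw [gronwallBound_of_K_ne_0 (by positivity)]
  have h1 : Real.exp (K * x) ≤ Real.exp (K * T) := by gcongr
  have h2 : ε / K ≤ ε := div_le_self hε hK
  have h3 : 0 ≤ Real.exp (K * T) := (Real.exp_pos _).le
  have h4 : ε / K * (Real.exp (K * x) - 1) ≤ ε * Real.exp (K * T) := by
    have h5 : ε / K * (Real.exp (K * x) - 1) ≤ ε / K * Real.exp (K * T) := by
      have : 0 ≤ ε / K := by positivity
      gcongr; linarith
    exact h5.trans (by gcongr)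
  have h6 : ρ * Real.exp (K * x) ≤ ρ * Real.exp (K * T) := by gcongr
  simp only
  linarith

/-- Existence of solutions near a given one, for nearby initial values and nearby vector fields. -/
theorem exists_solution_near {Λ : Type*} [TopologicalSpace Λ] {l₀ : Λ} {X : Λ → ℝ → E → E}
    {Ω : Set E} {a b : ℝ} (hab : a < b) (hΩ : IsOpen Ω)
    (hX : ∀ l, ContDiffOn ℝ ∞ (Function.uncurry (X l)) (Icc a b ×ˢ Ω))
    (hconv : ∀ C ⊆ Ω, IsCompact C → TendstoUniformlyOn (fun l => Function.uncurry (X l))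
      (Function.uncurry (X l₀)) (𝓝 l₀) (Icc a b ×ˢ C))
    {α₀ : ℝ → E} (hα₀ : SolvesODE (X l₀) Ω a b α₀) {η : ℝ} (hη : 0 < η) :
    ∀ᶠ q : Λ × E in 𝓝 (l₀, α₀ a), ∃ α : ℝ → E, α a = q.2 ∧ SolvesODE (X q.1) Ω a b α ∧
      ∀ t ∈ Icc a b, dist (α t) (α₀ t) < η := by
  have : ProperSpace E := FiniteDimensional.proper ℝ E
  have : CompleteSpace E := FiniteDimensional.complete ℝ E
  have hC : IsCompact (α₀ '' Icc a b) := isCompact_Icc.image_of_continuousOn hα₀.continuousOn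
  obtain ⟨ρ, hρ, hρΩ⟩ := hC.exists_cthickening_subset_open hΩ
    (image_subset_iff.2 fun t ht => (hα₀ t ht).1)
  have hC' : IsCompact (Metric.cthickening ρ (α₀ '' Icc a b)) := hC.cthickening
  obtain ⟨χ, h1, h2, h3, h4, h5⟩ := exists_cutoff hC' hΩ hρΩ
  obtain ⟨⟨K, hK⟩, -, -⟩ := cutoff_field_bounds hab (hX l₀) hΩ h1 h2 h3
  obtain ⟨K', hK', hKK', hK'1⟩ : ∃ K' : NNReal, (∀ t ∈ Icc a b, LipschitzWith K' fun x => χ x • X l₀ t x) ∧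
      K ≤ K' ∧ 1 ≤ K' := ⟨max K 1, fun t ht => (hK t ht).weaken (le_max_left _ _),
        le_max_left _ _, le_max_right _ _⟩
  have hα₀' : SolvesODE (fun t x => χ x • X l₀ t x) univ a b α₀ :=
    hα₀.congr_field fun t ht => ⟨mem_univ _, by
      simp [h4 (α₀ t) (Metric.self_subset_cthickening _ (mem_image_of_mem α₀ ht))]⟩
  -- Staying within `ρ` of `α₀` keeps the new solution where the cut-off is one, so that it solves
  -- the original equation.
  set η' := min η ρ with hη'
  have hη'0 : 0 < η' := lt_min hη hρ
  set B := Real.exp (K' * (b - a)) with hB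
  have hB0 : 0 < B := Real.exp_pos _
  -- Initial error and field error are each at most `ε`, and Gronwall turns them into `2 ε B = η' /
  -- 2`.
  set ε := η' / (4 * B) with hε
  have hε0 : 0 < ε := by positivity
  have hev : ∀ᶠ l in 𝓝 l₀, ∀ p ∈ Icc a b ×ˢ tsupport χ, dist (X l₀ p.1 p.2) (X l p.1 p.2) < ε :=
    Metric.tendstoUniformlyOn_iff.1 (hconv _ h3 h2) ε hε0
  have hev2 : ∀ᶠ x in 𝓝 (α₀ a), dist x (α₀ a) < ε := Metric.ball_mem_nhds _ hε0
  filter_upwards [hev.prod_nhds hev2]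
  rintro ⟨l, x⟩ ⟨hl, hx⟩
  simp only at hl hx
  obtain ⟨hlip, hbd, hct⟩ := cutoff_field_bounds hab (hX l) hΩ h1 h2 h3
  obtain ⟨α, hαa, hα⟩ := exists_global_solution hab.le hlip hbd hct x
  have hclose : ∀ t ∈ Icc a b, ∀ y, dist (χ y • X l t y) (χ y • X l₀ t y) ≤ ε := by
    intro t ht y
    by_cases hy : y ∈ tsupport χ
    · rw [dist_eq_norm, ← smul_sub, norm_smul, ← dist_eq_norm, dist_comm, Real.norm_eq_abs]
      calc _ ≤ 1 * ε := by gcongr; exacts [h5 y, (hl (t, y) ⟨ht, hy⟩).le]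
        _ = ε := one_mul _
    · simp [image_eq_zero_of_notMem_tsupport hy, hε0.le]
  have hgr : ∀ t ∈ Icc a b, dist (α t) (α₀ t) < η' := by
    intro t ht
    have := dist_le_of_approx_trajectories_ODE_of_mem (v := fun t x => χ x • X l₀ t x)
      (s := fun _ => univ) (K := K') (δ := ε) (εf := ε) (εg := 0)
      (fun t ht => (hK' t (Ico_subset_Icc_self ht)).lipschitzOnWith)
      hα.continuousOn (fun t ht => hα.hasDerivWithinAt_Ici ht)
      (fun t ht => hclose t (Ico_subset_Icc_self ht) (α t)) (fun _ _ => mem_univ _)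
      hα₀.continuousOn (fun t ht => hα₀'.hasDerivWithinAt_Ici ht)
      (fun t ht => by simp) (fun _ _ => mem_univ _) (by rw [hαa]; exact hx.le) t ht
    refine this.trans_lt ?_
    refine (gronwallBound_le_of_le (T := b - a) (by exact_mod_cast hK'1) hε0.le (by linarith)
      (by linarith [ht.2])).trans_lt ?_
    have h6 : (ε + (ε + 0)) * B = η' / 2 := by
      rw [hε]; field_simp; ring
    rw [← hB, h6]; linarith
  have hmem : ∀ t ∈ Icc a b, α t ∈ Metric.cthickening ρ (α₀ '' Icc a b) := fun t ht =>
    Metric.mem_cthickening_of_dist_le (α t) (α₀ t) ρ _ (mem_image_of_mem α₀ ht)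
      ((hgr t ht).le.trans (min_le_right _ _))
  refine ⟨α, hαa, hα.congr_field fun t ht => ⟨hρΩ (hmem t ht), ?_⟩,
    fun t ht => (hgr t ht).trans_le (min_le_left _ _)⟩
  simp [h4 (α t) (hmem t ht)]

/-- Existence of solutions of linear differential equations. -/
theorem exists_linear_solution {B : ℝ → E →L[ℝ] E} {a b : ℝ} (hab : a ≤ b)
    (hB : ContinuousOn B (Icc a b)) (w : E) :
    ∃ W : ℝ → E, W a = w ∧ SolvesODE (fun t x => B t x) univ a b W := by
  have : CompleteSpace E := FiniteDimensional.complete ℝ E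
  have : ProperSpace E := FiniteDimensional.proper ℝ E
  obtain ⟨K, hK⟩ := isCompact_Icc.exists_bound_of_continuousOn hB
  have hK0 : 0 ≤ K := (norm_nonneg _).trans (hK a (left_mem_Icc.2 hab))
  -- This is the a priori Gronwall bound. The solution of the cut-off equation obeys it too, so it
  -- never leaves the ball where the cut-off is one.
  set R := ‖w‖ * Real.exp (K * (b - a)) with hR
  obtain ⟨χ, h1, h2, h3, h4, h5⟩ := exists_cutoff (isCompact_closedBall (0 : E) R) isOpen_univ
    (subset_univ _)
  -- the cut-off identity
  obtain ⟨⟨K₁, hK₁⟩, ⟨L₁, hL₁⟩, -⟩ := cutoff_field_bounds (a := 0) (b := 1) (X := fun _ x => x)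
    one_pos contDiff_snd.contDiffOn isOpen_univ h1 h2 h3
  -- By linearity, cutting off the field amounts to composing `B t` with the cut-off identity, which
  -- is bounded and Lipschitz. Mere continuity of `B` in time is then enough.
  have hsub : ∀ t x, χ x • B t x = B t (χ x • x) := fun t x => by simp
  obtain ⟨W, hWa, hW⟩ := exists_global_solution (Z := fun t x => χ x • B t x) hab
    ⟨K.toNNReal * K₁, fun t ht => by
      have h6 : LipschitzWith K.toNNReal (B t) :=
        (B t).lipschitz.weaken (by
          rw [← NNReal.coe_le_coe, Real.coe_toNNReal K hK0]; exact hK t ht)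
      simp only [hsub]
      exact h6.comp (hK₁ 0 (by simp))⟩
    ⟨K * L₁, fun t ht x => by
      rw [hsub]
      refine ((B t).le_opNorm _).trans ?_
      gcongr
      exacts [hK t ht, hL₁ 0 (by simp) x]⟩
    (fun x => (hB.clm_apply continuousOn_const).const_smul _) w
  have hbound : ∀ t ∈ Icc a b, ‖W t‖ ≤ R := by
    intro t ht
    have := norm_le_gronwallBound_of_norm_deriv_right_le (δ := ‖w‖) (K := K) (ε := 0)
      hW.continuousOn (fun t ht => hW.hasDerivWithinAt_Ici ht) (by rw [hWa]) (fun t ht => by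
        rw [add_zero, norm_smul]
        calc ‖χ (W t)‖ * ‖B t (W t)‖ ≤ 1 * (K * ‖W t‖) := by
              gcongr
              · exact h5 _
              · exact ((B t).le_opNorm _).trans (by gcongr; exact hK t (Ico_subset_Icc_self ht))
          _ = _ := one_mul _) t ht
    refine this.trans ?_
    rw [gronwallBound_ε0, hR]
    gcongr
    exact ht.2
  refine ⟨W, hWa, hW.congr_field fun t ht => ⟨mem_univ _, ?_⟩⟩
  simp [h4 (W t) (mem_closedBall_zero_iff.2 (hbound t ht))]

end ODE

/-! ### The linearized equation and smoothness of the end point -/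

section ODE

variable {E : Type} [NormedAddCommGroup E] [NormedSpace ℝ E] [FiniteDimensional ℝ E]

/-- Left multiplication by `B t` is a linear equation on the space of operators; solve it with the
identity as initial value. -/
theorem exists_fundamental_solution {B : ℝ → E →L[ℝ] E} {a b : ℝ} (hab : a ≤ b)
    (hB : ContinuousOn B (Icc a b)) :
    ∃ A : ℝ → E →L[ℝ] E, A a = ContinuousLinearMap.id ℝ E ∧
      ∀ t ∈ Icc a b, HasDerivWithinAt A ((B t).comp (A t)) (Icc a b) t := by
  obtain ⟨A, hAa, hA⟩ := exists_linear_solution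
    (B := fun t => ContinuousLinearMap.compL ℝ E E E (B t)) hab
    ((ContinuousLinearMap.compL ℝ E E E).continuous.comp_continuousOn hB)
    (ContinuousLinearMap.id ℝ E)
  exact ⟨A, hAa, fun t ht => (hA t ht).2⟩

/-- The endpoint of solutions is differentiable in the initial value, its derivative being the
fundamental solution of the linearized equation. -/
theorem hasFDerivAt_endpoint {X : ℝ → E → E} {Ω : Set E} {a b : ℝ} (hab : a < b) (hΩ : IsOpen Ω)
    (hX : ContDiffOn ℝ ∞ (Function.uncurry X) (Icc a b ×ˢ Ω)) {α₀ : ℝ → E}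
    (hα₀ : SolvesODE X Ω a b α₀) {Θ : E → E}
    (hΘ : ∀ᶠ x in 𝓝 (α₀ a), ∃ α : ℝ → E, α a = x ∧ α b = Θ x ∧ SolvesODE X Ω a b α)
    {A : ℝ → E →L[ℝ] E} (hAa : A a = ContinuousLinearMap.id ℝ E)
    (hA : ∀ t ∈ Icc a b, HasDerivWithinAt A ((fderiv ℝ (X t) (α₀ t)).comp (A t)) (Icc a b) t) :
    HasFDerivAt Θ (A b) (α₀ a) := by
  have : ProperSpace E := FiniteDimensional.proper ℝ E
  have hC : IsCompact (α₀ '' Icc a b) := isCompact_Icc.image_of_continuousOn hα₀.continuousOn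
  obtain ⟨ρ, hρ, hρΩ⟩ := hC.exists_cthickening_subset_open hΩ
    (image_subset_iff.2 fun t ht => (hα₀ t ht).1)
  set C' := Metric.cthickening ρ (α₀ '' Icc a b) with hC'def
  have hC' : IsCompact C' := hC.cthickening
  have hmemC' : ∀ t ∈ Icc a b, ∀ y, dist y (α₀ t) ≤ ρ → y ∈ C' := fun t ht y hy =>
    Metric.mem_cthickening_of_dist_le y (α₀ t) ρ _ (mem_image_of_mem α₀ ht) hy
  obtain ⟨χ, h1, h2, h3, h4, h5⟩ := exists_cutoff hC' hΩ hρΩ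
  obtain ⟨⟨K₀, hK₀⟩, -, -⟩ := cutoff_field_bounds hab hX hΩ h1 h2 h3
  obtain ⟨K, hK, hK1⟩ : ∃ K : NNReal, (∀ t ∈ Icc a b, LipschitzWith K fun x => χ x • X t x) ∧ 1 ≤ K :=
    ⟨max K₀ 1, fun t ht => (hK₀ t ht).weaken (le_max_left _ _), le_max_right _ _⟩
  have hAc : ContinuousOn A (Icc a b) := fun t ht => (hA t ht).continuousWithinAt
  obtain ⟨M, hM⟩ := isCompact_Icc.exists_bound_of_continuousOn hAc
  have hM0 : 0 ≤ M := (norm_nonneg _).trans (hM a (left_mem_Icc.2 hab.le))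
  set B := Real.exp (K * (b - a)) with hB
  have hB0 : 0 < B := Real.exp_pos _
  rw [hasFDerivAt_iff_isLittleO, Asymptotics.isLittleO_iff]
  intro c hc
  -- `M` bounds the fundamental solution and `B` is the Gronwall factor, so a linearization error
  -- `ε` produces a final error at most `ε M B ‖v‖ ≤ c ‖v‖`.
  set ε := c / ((M + 1) * B) with hε
  have hε0 : 0 < ε := by positivity
  have huc : UniformContinuousOn (fun p : ℝ × E => fderiv ℝ (X p.1) p.2) (Icc a b ×ˢ C') :=
    (isCompact_Icc.prod hC').uniformContinuousOn_of_continuous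
      ((contDiffOn_fderiv_slice hab hΩ hX).continuousOn.mono (prod_mono_right hρΩ))
  obtain ⟨δ, hδ, hδε⟩ := Metric.uniformContinuousOn_iff.1 huc ε hε0
  set τ := min δ ρ with hτ
  have hτ0 : 0 < τ := lt_min hδ hρ
  have hlin : ∀ t ∈ Icc a b, ∀ h : E, ‖h‖ < τ →
      ‖X t (α₀ t + h) - X t (α₀ t) - fderiv ℝ (X t) (α₀ t) h‖ ≤ ε * ‖h‖ := by
    intro t ht h hh
    have hball : ∀ y ∈ Metric.ball (α₀ t) τ, y ∈ C' := fun y hy =>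
      hmemC' t ht y ((Metric.mem_ball.1 hy).le.trans (min_le_right _ _))
    have := (convex_ball (α₀ t) τ).norm_image_sub_le_of_norm_fderiv_le' (𝕜 := ℝ) (f := X t)
      (φ := fderiv ℝ (X t) (α₀ t)) (C := ε) (x := α₀ t) (y := α₀ t + h)
      (fun y hy => (hasFDerivAt_slice hΩ hX ht (hρΩ (hball y hy))).differentiableAt)
      (fun y hy => by
        rw [← dist_eq_norm]
        refine (hδε (t, y) ⟨ht, hball y hy⟩ (t, α₀ t)
          ⟨ht, hball _ (Metric.mem_ball_self hτ0)⟩ ?_).le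
        rw [Prod.dist_eq, dist_self]
        exact max_lt hδ ((Metric.mem_ball.1 hy).trans_le (min_le_left _ _)))
      (Metric.mem_ball_self hτ0) (by simpa [Metric.mem_ball] using hh)
    simpa using this
  have hnear := exists_solution_near (Λ := Unit) (l₀ := ()) (X := fun _ => X) hab hΩ (fun _ => hX)
    (fun C _ _ => by
      rw [Metric.tendstoUniformlyOn_iff]; intro ε hε; simp [hε]) hα₀ hρ
  have hnear' : ∀ᶠ x in 𝓝 (α₀ a), ∃ α : ℝ → E, α a = x ∧ SolvesODE X Ω a b α ∧
      ∀ t ∈ Icc a b, dist (α t) (α₀ t) < ρ :=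
    ((Continuous.prodMk_right ()).tendsto (α₀ a)).eventually hnear
  have hsmall : ∀ᶠ x in 𝓝 (α₀ a), ‖x - α₀ a‖ < τ / (M + 1) := by
    have : 0 < τ / (M + 1) := by positivity
    filter_upwards [Metric.ball_mem_nhds (α₀ a) this] with x hx
    rwa [← dist_eq_norm]
  obtain ⟨β, hβa, hβb, hβ⟩ := hΘ.self_of_nhds
  have hΘ₀ : Θ (α₀ a) = α₀ b := by
    rw [← hβb]; exact SolvesODE.eqOn hab hΩ hX hβ hα₀ hβa (right_mem_Icc.2 hab.le)
  filter_upwards [hΘ, hnear', hsmall]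
  rintro x ⟨α, hαa, hαb, hα⟩ ⟨γ, hγa, hγ, hγρ⟩ hx
  set v := x - α₀ a with hv
  have hαγ := SolvesODE.eqOn hab hΩ hX hα hγ (hαa.trans hγa.symm)
  have hαC : ∀ t ∈ Icc a b, α t ∈ C' := fun t ht =>
    hmemC' t ht _ (by rw [hαγ ht]; exact (hγρ t ht).le)
  have hAv : ∀ t ∈ Icc a b, ‖A t v‖ ≤ M * ‖v‖ := fun t ht =>
    ((A t).le_opNorm v).trans (by gcongr; exact hM t ht)
  have hAvτ : ∀ t ∈ Icc a b, ‖A t v‖ < τ := fun t ht => by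
    refine (hAv t ht).trans_lt ?_
    have : (M + 1) * ‖v‖ < τ := by rwa [lt_div_iff₀' (by positivity)] at hx
    nlinarith [norm_nonneg v]
  have huC : ∀ t ∈ Icc a b, α₀ t + A t v ∈ C' := fun t ht =>
    hmemC' t ht _ (by simpa using (hAvτ t ht).le.trans (min_le_right _ _))
  -- The curve `α₀ + A v` has the same initial value as the true solution `α` and solves the
  -- equation up to a defect `ε ‖A v‖`. Gronwall compares the two at time `b`.
  have hu : ∀ t ∈ Icc a b, HasDerivWithinAt (fun t => α₀ t + A t v)
      (X t (α₀ t) + fderiv ℝ (X t) (α₀ t) (A t v)) (Icc a b) t := fun t ht => by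
    have := ((hA t ht).clm_apply (hasDerivWithinAt_const t _ v))
    simp only [map_zero, add_zero, ContinuousLinearMap.comp_apply] at this
    exact (hα₀ t ht).2.add this
  have hgr := dist_le_of_approx_trajectories_ODE_of_mem (v := fun t x => χ x • X t x)
      (s := fun _ => univ) (K := K) (δ := 0) (εf := 0) (εg := ε * (M * ‖v‖))
      (fun t ht => (hK t (Ico_subset_Icc_self ht)).lipschitzOnWith)
      hα.continuousOn (fun t ht => hα.hasDerivWithinAt_Ici ht)
      (fun t ht => by simp [h4 _ (hαC t (Ico_subset_Icc_self ht))]) (fun _ _ => mem_univ _)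
      (fun t ht => (hu t ht).continuousWithinAt)
      (fun t ht => (hu t (Ico_subset_Icc_self ht)).mono_of_mem_nhdsWithin
        (Icc_mem_nhdsGE_of_mem ht))
      (fun t ht => by
        have ht' := Ico_subset_Icc_self ht
        rw [h4 _ (huC t ht'), one_smul, dist_comm, dist_eq_norm, ← sub_sub]
        exact (hlin t ht' _ (hAvτ t ht')).trans (by gcongr; exact hAv t ht'))
      (fun _ _ => mem_univ _) (by simp [hAa, hαa, hv]) b (right_mem_Icc.2 hab.le)
  have hfin := hgr.trans (gronwallBound_le_of_le (T := b - a) (by exact_mod_cast hK1) le_rfl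
    (by positivity) le_rfl)
  rw [hαb, dist_eq_norm, ← hΘ₀, ← sub_sub, ← hB] at hfin
  refine hfin.trans ?_
  have h7 : ε * ((M + 1) * B) = c := by rw [hε]; field_simp
  rw [← h7]
  have : 0 ≤ ε * B * ‖v‖ := by positivity
  nlinarith

/-- A vector field together with its linearization. -/
noncomputable def linearizedField (X : ℝ → E → E) (t : ℝ) (p : E × (E →L[ℝ] E)) : E × (E →L[ℝ] E) :=
  (X t p.1, (fderiv ℝ (X t) p.1).comp p.2)

theorem contDiffOn_linearizedField {E : Type} [NormedAddCommGroup E] [NormedSpace ℝ E]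
    {X : ℝ → E → E} {Ω : Set E} {a b : ℝ} (hab : a < b) (hΩ : IsOpen Ω) (hX : ContDiffOn ℝ ∞ (Function.uncurry X) (Icc a b ×ˢ Ω)) :
    ContDiffOn ℝ ∞ (Function.uncurry (linearizedField X)) (Icc a b ×ˢ (Ω ×ˢ univ)) := by
  have h1 : MapsTo (fun q : ℝ × (E × (E →L[ℝ] E)) => (q.1, q.2.1)) (Icc a b ×ˢ (Ω ×ˢ univ))
    (Icc a b ×ˢ Ω) := fun q hq => ⟨hq.1, hq.2.1⟩
  have h2 : ContDiff ℝ ∞ (fun q : ℝ × (E × (E →L[ℝ] E)) => (q.1, q.2.1)) := by fun_prop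
  refine (hX.comp h2.contDiffOn h1).prodMk ?_
  exact ((contDiffOn_fderiv_slice hab hΩ hX).comp h2.contDiffOn h1).clm_comp
    (contDiff_snd.comp contDiff_snd).contDiffOn

theorem SolvesODE.linearizedField {E : Type} [NormedAddCommGroup E] [NormedSpace ℝ E]
    {X : ℝ → E → E} {Ω : Set E} {a b : ℝ} {α : ℝ → E}
    (hα : SolvesODE X Ω a b α) {A : ℝ → E →L[ℝ] E}
    (hA : ∀ t ∈ Icc a b, HasDerivWithinAt A ((fderiv ℝ (X t) (α t)).comp (A t)) (Icc a b) t)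
    (T : E →L[ℝ] E) :
    SolvesODE (linearizedField X) (Ω ×ˢ univ) a b fun t => (α t, (A t).comp T) := by
  intro t ht
  refine ⟨⟨(hα t ht).1, mem_univ _⟩, (hα t ht).2.prodMk ?_⟩
  have := (hA t ht).clm_comp (hasDerivWithinAt_const t _ T)
  simpa [ContinuousLinearMap.comp_assoc] using this

theorem SolvesODE.exists_fundamental_solution {X : ℝ → E → E} {Ω : Set E} {a b : ℝ} (hab : a < b)
    (hΩ : IsOpen Ω) (hX : ContDiffOn ℝ ∞ (Function.uncurry X) (Icc a b ×ˢ Ω)) {α : ℝ → E}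
    (hα : SolvesODE X Ω a b α) : ∃ A : ℝ → E →L[ℝ] E, A a = ContinuousLinearMap.id ℝ E ∧
      ∀ t ∈ Icc a b, HasDerivWithinAt A ((fderiv ℝ (X t) (α t)).comp (A t)) (Icc a b) t :=
  _root_.exists_fundamental_solution hab.le
    ((contDiffOn_fderiv_slice hab hΩ hX).continuousOn.comp
      (continuousOn_id.prodMk hα.continuousOn) fun t ht => ⟨ht, (hα t ht).1⟩)

/-- Bootstrapping: the map `(x, T) ↦ (Θ x, DΘ(x) ∘ T)` is itself the end point map of the linearized
field, hence of class `C^k` by induction, and `T = id` shows that `DΘ` is `C^k`. The phase space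
changes at each step, so the induction quantifies over all spaces and fields. -/
theorem contDiffOn_endpoint_nat {a b : ℝ} (hab : a < b) (k : ℕ) :
    ∀ {E : Type} [NormedAddCommGroup E] [NormedSpace ℝ E] [FiniteDimensional ℝ E] {X : ℝ → E → E}
      {Ω : Set E}, IsOpen Ω → ContDiffOn ℝ ∞ (Function.uncurry X) (Icc a b ×ˢ Ω) →
      ∀ {Θ : E → E} {U : Set E}, IsOpen U →
      (∀ x ∈ U, ∃ α : ℝ → E, α a = x ∧ α b = Θ x ∧ SolvesODE X Ω a b α) → ContDiffOn ℝ k Θ U := by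
  have hder : ∀ {E : Type} [NormedAddCommGroup E] [NormedSpace ℝ E] [FiniteDimensional ℝ E]
      {X : ℝ → E → E} {Ω : Set E}, IsOpen Ω →
      ContDiffOn ℝ ∞ (Function.uncurry X) (Icc a b ×ˢ Ω) → ∀ {Θ : E → E} {U : Set E}, IsOpen U →
      (∀ x ∈ U, ∃ α : ℝ → E, α a = x ∧ α b = Θ x ∧ SolvesODE X Ω a b α) → ∀ x ∈ U,
      DifferentiableAt ℝ Θ x ∧ ∀ T : E →L[ℝ] E, ∃ β : ℝ → E × (E →L[ℝ] E), β a = (x, T) ∧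
        β b = (Θ x, (fderiv ℝ Θ x).comp T) ∧ SolvesODE (linearizedField X) (Ω ×ˢ univ) a b β := by
    intro E _ _ _ X Ω hΩ hX Θ U hU h x hx
    obtain ⟨α, hαa, hαb, hα⟩ := h x hx
    obtain ⟨A, hAa, hA⟩ := hα.exists_fundamental_solution hab hΩ hX
    have hd := hasFDerivAt_endpoint hab hΩ hX hα
      (by rw [hαa]; exact Filter.eventually_of_mem (hU.mem_nhds hx) h) hAa hA
    rw [hαa] at hd
    refine ⟨hd.differentiableAt, fun T => ⟨_, ?_, ?_, hα.linearizedField hA T⟩⟩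
    · simp [hαa, hAa]
    · simp [hαb, hd.fderiv]
  induction k with
  | zero =>
    intro E _ _ _ X Ω hΩ hX Θ U hU h
    simp only [CharP.cast_eq_zero, contDiffOn_zero]
    exact fun x hx => (hder hΩ hX hU h x hx).1.continuousAt.continuousWithinAt
  | succ k ih =>
    intro E _ _ _ X Ω hΩ hX Θ U hU h
    rw [Nat.cast_add, Nat.cast_one, contDiffOn_succ_iff_fderiv_of_isOpen hU]
    refine ⟨fun x hx => (hder hΩ hX hU h x hx).1.differentiableWithinAt, by simp, ?_⟩
    have h1 := ih (hΩ.prod isOpen_univ) (contDiffOn_linearizedField hab hΩ hX)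
      (Θ := fun p => (Θ p.1, (fderiv ℝ Θ p.1).comp p.2)) (hU.prod isOpen_univ)
      (fun p hp => (hder hΩ hX hU h p.1 hp.1).2 p.2)
    have h2 : ContDiffOn ℝ k (fun x : E => (x, ContinuousLinearMap.id ℝ E)) U :=
      contDiffOn_id.prodMk contDiffOn_const
    exact contDiff_snd.comp_contDiffOn (h1.comp h2 fun x hx => ⟨hx, mem_univ _⟩)

/-- The endpoint of solutions depends smoothly on the initial value. -/
theorem contDiffOn_endpoint {X : ℝ → E → E} {Ω : Set E} {a b : ℝ} (hab : a < b) (hΩ : IsOpen Ω)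
    (hX : ContDiffOn ℝ ∞ (Function.uncurry X) (Icc a b ×ˢ Ω)) {Θ : E → E} {U : Set E}
    (hU : IsOpen U) (h : ∀ x ∈ U, ∃ α : ℝ → E, α a = x ∧ α b = Θ x ∧ SolvesODE X Ω a b α) :
    ContDiffOn ℝ ∞ Θ U :=
  contDiffOn_infty.2 fun k => contDiffOn_endpoint_nat hab k hΩ hX hU h

/-- A family of maps, smooth near `x₀` and varying continuously with its first derivatives. -/
structure C1Family {Λ E F : Type*} [TopologicalSpace Λ] [NormedAddCommGroup E] [NormedSpace ℝ E]
    [NormedAddCommGroup F] [NormedSpace ℝ F] (Θ : Λ → E → F) (l₀ : Λ) (x₀ : E) : Prop where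
  continuousAt : ContinuousAt (fun q : Λ × E => Θ q.1 q.2) (l₀, x₀)
  contDiffAt : ∀ᶠ q : Λ × E in 𝓝 (l₀, x₀), ContDiffAt ℝ ∞ (Θ q.1) q.2
  continuousAt_fderiv : ContinuousAt (fun q : Λ × E => fderiv ℝ (Θ q.1) q.2) (l₀, x₀)

open Classical in
/-- The value at time `b` of the solution with value `x` at time `a`, if it exists. -/
noncomputable def odeFlow (X : ℝ → E → E) (Ω : Set E) (a b : ℝ) (x : E) : E :=
  if h : ∃ α : ℝ → E, α a = x ∧ SolvesODE X Ω a b α then h.choose b else x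

theorem odeFlow_eq {X : ℝ → E → E} {Ω : Set E} {a b : ℝ} (hab : a < b) (hΩ : IsOpen Ω)
    (hX : ContDiffOn ℝ ∞ (Function.uncurry X) (Icc a b ×ˢ Ω)) {α : ℝ → E}
    (hα : SolvesODE X Ω a b α) : odeFlow X Ω a b (α a) = α b := by
  have h : ∃ β : ℝ → E, β a = α a ∧ SolvesODE X Ω a b β := ⟨α, rfl, hα⟩
  rw [odeFlow, dif_pos h]
  exact h.choose_spec.2.eqOn hab hΩ hX hα h.choose_spec.1 (right_mem_Icc.2 hab.le)

/-- The second component is linear in the operator, and operators in a compact set are bounded.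
Uniform convergence of the field and its derivative therefore suffices. -/
theorem tendstoUniformlyOn_linearizedField {E : Type} [NormedAddCommGroup E] [NormedSpace ℝ E]
    {Λ : Type*} [TopologicalSpace Λ] {l₀ : Λ} {X : Λ → ℝ → E → E} {Ω : Set E} {a b : ℝ}
    (hconv : ∀ C ⊆ Ω, IsCompact C → TendstoUniformlyOn (fun l => Function.uncurry (X l))
      (Function.uncurry (X l₀)) (𝓝 l₀) (Icc a b ×ˢ C))
    (hconv' : ∀ C ⊆ Ω, IsCompact C → TendstoUniformlyOn (fun l p => fderiv ℝ (X l p.1) p.2)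
      (fun p => fderiv ℝ (X l₀ p.1) p.2) (𝓝 l₀) (Icc a b ×ˢ C))
    {C : Set (E × (E →L[ℝ] E))} (hC : C ⊆ Ω ×ˢ univ) (hCc : IsCompact C) :
    TendstoUniformlyOn (fun l => Function.uncurry (linearizedField (X l)))
      (Function.uncurry (linearizedField (X l₀))) (𝓝 l₀) (Icc a b ×ˢ C) := by
  have hC1 : IsCompact (Prod.fst '' C) := hCc.image continuous_fst
  have hC1Ω : Prod.fst '' C ⊆ Ω := image_subset_iff.2 fun p hp => (hC hp).1
  obtain ⟨R, hR⟩ := hCc.exists_bound_of_continuousOn (f := Prod.snd) continuous_snd.continuousOn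
  rw [Metric.tendstoUniformlyOn_iff]
  intro ε hε
  have hR' : 0 < max R 0 + 1 := by positivity
  filter_upwards [Metric.tendstoUniformlyOn_iff.1 (hconv _ hC1Ω hC1) ε hε,
    Metric.tendstoUniformlyOn_iff.1 (hconv' _ hC1Ω hC1) (ε / (max R 0 + 1)) (by positivity)]
    with l h1 h2
  rintro ⟨t, p⟩ ⟨ht, hp⟩
  have hp' : (t, p.1) ∈ Icc a b ×ˢ (Prod.fst '' C) := ⟨ht, mem_image_of_mem _ hp⟩
  simp only [Function.uncurry, linearizedField]
  rw [Prod.dist_eq]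
  refine max_lt (h1 _ hp') ?_
  have h3 := h2 _ hp'
  simp only [dist_eq_norm] at h3 ⊢
  rw [← ContinuousLinearMap.sub_comp]
  calc _ ≤ ‖fderiv ℝ (X l₀ t) p.1 - fderiv ℝ (X l t) p.1‖ * ‖p.2‖ :=
        ContinuousLinearMap.opNorm_comp_le _ _
    _ ≤ ‖fderiv ℝ (X l₀ t) p.1 - fderiv ℝ (X l t) p.1‖ * (max R 0 + 1) := by
        gcongr
        exact (hR p hp).trans ((le_max_left _ _).trans (by linarith))
    _ < ε := by rwa [← lt_div_iff₀ hR']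

/-- The flow of a continuous family of smooth vector fields is a `C1Family` near any given
trajectory. -/
theorem exists_flow_family {Λ : Type*} [TopologicalSpace Λ] {l₀ : Λ} {X : Λ → ℝ → E → E}
    {Ω : Set E} {a b : ℝ} (hab : a < b) (hΩ : IsOpen Ω)
    (hX : ∀ l, ContDiffOn ℝ ∞ (Function.uncurry (X l)) (Icc a b ×ˢ Ω))
    (hconv : ∀ C ⊆ Ω, IsCompact C → TendstoUniformlyOn (fun l => Function.uncurry (X l))
      (Function.uncurry (X l₀)) (𝓝 l₀) (Icc a b ×ˢ C))
    (hconv' : ∀ C ⊆ Ω, IsCompact C → TendstoUniformlyOn (fun l p => fderiv ℝ (X l p.1) p.2)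
      (fun p => fderiv ℝ (X l₀ p.1) p.2) (𝓝 l₀) (Icc a b ×ˢ C))
    {α₀ : ℝ → E} (hα₀ : SolvesODE (X l₀) Ω a b α₀) :
    ∃ Θ : Λ → E → E, C1Family Θ l₀ (α₀ a) ∧ Θ l₀ (α₀ a) = α₀ b ∧
      (∀ᶠ q : Λ × E in 𝓝 (l₀, α₀ a), ∃ α : ℝ → E, α a = q.2 ∧ α b = Θ q.1 q.2 ∧
        SolvesODE (X q.1) Ω a b α) ∧
      ∀ W : ℝ → E, (∀ t ∈ Icc a b,
        HasDerivWithinAt W (fderiv ℝ (X l₀ t) (α₀ t) (W t)) (Icc a b) t) →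
        fderiv ℝ (Θ l₀) (α₀ a) (W a) = W b := by
  set Θ : Λ → E → E := fun l => odeFlow (X l) Ω a b with hΘdef
  have hΘ : ∀ l α, SolvesODE (X l) Ω a b α → Θ l (α a) = α b := fun l α hα =>
    odeFlow_eq hab hΩ (hX l) hα
  have hex : ∀ᶠ q : Λ × E in 𝓝 (l₀, α₀ a), ∃ α : ℝ → E, α a = q.2 ∧ α b = Θ q.1 q.2 ∧
      SolvesODE (X q.1) Ω a b α := by
    filter_upwards [exists_solution_near hab hΩ hX hconv hα₀ one_pos]
    rintro q ⟨α, hαa, hα, -⟩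
    exact ⟨α, hαa, by rw [← hαa, hΘ _ _ hα], hα⟩
  have hexx : ∀ᶠ q : Λ × E in 𝓝 (l₀, α₀ a), ∀ᶠ x in 𝓝 q.2, ∃ α : ℝ → E, α a = x ∧
      α b = Θ q.1 x ∧ SolvesODE (X q.1) Ω a b α :=
    hex.eventually_nhds.mono fun q hq =>
      ((Continuous.prodMk_right q.1).tendsto q.2).eventually hq
  obtain ⟨A₀, hA₀a, hA₀⟩ := hα₀.exists_fundamental_solution hab hΩ (hX l₀)
  have hd₀ : HasFDerivAt (Θ l₀) (A₀ b) (α₀ a) :=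
    hasFDerivAt_endpoint hab hΩ (hX l₀) hα₀ hexx.self_of_nhds hA₀a hA₀
  refine ⟨Θ, ⟨?_, ?_, ?_⟩, hΘ l₀ α₀ hα₀, hex, ?_⟩
  · rw [Metric.continuousAt_iff']
    intro η hη
    filter_upwards [exists_solution_near hab hΩ hX hconv hα₀ hη]
    rintro q ⟨α, hαa, hα, hαη⟩
    rw [hΘ l₀ α₀ hα₀, ← hαa, hΘ _ _ hα]
    exact hαη b (right_mem_Icc.2 hab.le)
  · filter_upwards [hexx] with q hq
    obtain ⟨U, hU, hUo, hqU⟩ := mem_nhds_iff.1 hq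
    exact (contDiffOn_endpoint hab hΩ (hX q.1) hUo hU).contDiffAt (hUo.mem_nhds hqU)
  · rw [Metric.continuousAt_iff']
    intro η hη
    -- The derivative of the flow is the operator component of the linearized system at time `b`.
    -- Its continuity is thus closeness of solutions for that system, started at `(x, id)`.
    have h1 := exists_solution_near hab (hΩ.prod isOpen_univ)
      (fun l => contDiffOn_linearizedField hab hΩ (hX l))
      (fun C hC hCc => tendstoUniformlyOn_linearizedField hconv hconv' hC hCc)
      (hα₀.linearizedField hA₀ (ContinuousLinearMap.id ℝ E)) hη
    have hcont : Continuous (fun q : Λ × E => (q.1, (q.2, ContinuousLinearMap.id ℝ E))) := by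
      fun_prop
    have h2 := (hcont.tendsto (l₀, α₀ a)).eventually (by
      simpa only [hA₀a, ContinuousLinearMap.comp_id] using h1)
    filter_upwards [h2, hexx] with q hq hqex
    obtain ⟨β, hβa, hβ, hβη⟩ := hq
    obtain ⟨α, hαa, hαb, hα⟩ := hqex.self_of_nhds
    obtain ⟨A, hAa, hA⟩ := hα.exists_fundamental_solution hab hΩ (hX q.1)
    have hd := hasFDerivAt_endpoint hab hΩ (hX q.1) hα (by rw [hαa]; exact hqex) hAa hA
    have hb := right_mem_Icc.2 hab.le
    have heq := hβ.eqOn hab (hΩ.prod isOpen_univ) (contDiffOn_linearizedField hab hΩ (hX q.1))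
      (hα.linearizedField hA (ContinuousLinearMap.id ℝ E)) (by rw [hβa, hαa, hAa]; rfl) hb
    rw [hd₀.fderiv]
    rw [hαa] at hd
    rw [hd.fderiv]
    have h3 := hβη b hb
    rw [heq, Prod.dist_eq] at h3
    exact (le_max_right _ _).trans_lt h3
  · intro W hW
    rw [hd₀.fderiv]
    -- both sides solve the same linear equation
    have h1 : ∀ t ∈ Icc a b, HasDerivWithinAt (fun t => A₀ t (W a))
        (fderiv ℝ (X l₀ t) (α₀ t) (A₀ t (W a))) (Icc a b) t := fun t ht => by
      have := (hA₀ t ht).clm_apply (hasDerivWithinAt_const t _ (W a))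
      simpa using this
    have hcont : ContinuousOn (fun t => fderiv ℝ (X l₀ t) (α₀ t)) (Icc a b) :=
      (contDiffOn_fderiv_slice hab hΩ (hX l₀)).continuousOn.comp
        (continuousOn_id.prodMk hα₀.continuousOn) fun t ht => ⟨ht, (hα₀ t ht).1⟩
    obtain ⟨K, hK⟩ := isCompact_Icc.exists_bound_of_continuousOn hcont
    have hIci : ∀ {f : ℝ → E} {f' : E} {t : ℝ}, t ∈ Ico a b → HasDerivWithinAt f f' (Icc a b) t →
        HasDerivWithinAt f f' (Ici t) t := fun ht h =>
      h.mono_of_mem_nhdsWithin (Icc_mem_nhdsGE_of_mem ht)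
    exact ODE_solution_unique_of_mem_Icc_right (s := fun _ => univ) (K := K.toNNReal)
      (v := fun t x => fderiv ℝ (X l₀ t) (α₀ t) x)
      (fun t ht => ((fderiv ℝ (X l₀ t) (α₀ t)).lipschitz.weaken (by
        rw [← norm_toNNReal]
        exact Real.toNNReal_le_toNNReal (hK t (Ico_subset_Icc_self ht)))).lipschitzOnWith)
      (fun t ht => (h1 t ht).continuousWithinAt)
      (fun t ht => hIci ht (h1 t (Ico_subset_Icc_self ht))) (fun _ _ => mem_univ _)
      (fun t ht => (hW t ht).continuousWithinAt)
      (fun t ht => hIci ht (hW t (Ico_subset_Icc_self ht))) (fun _ _ => mem_univ _)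
      (by simp [hA₀a]) (right_mem_Icc.2 hab.le)

end ODE

/-! ## Hamiltonian vector fields in charts -/

section HamiltonianField

/-- The map `v ↦ A (v, ·)` of an alternating `2`-form `A`. -/
noncomputable def flatMap (E : Type) [NormedAddCommGroup E] [NormedSpace ℝ E]
    (A : E [⋀^Fin 2]→L[ℝ] ℝ) : E →L[ℝ] E →L[ℝ] ℝ :=
  ContinuousLinearMap.compL ℝ E _ _
    ((ContinuousAlternatingMap.ofSubsingletonLIE (𝕜 := ℝ) (E := E) (F := ℝ)
      (0 : Fin 1)).symm.toContinuousLinearEquiv : (E [⋀^Fin 1]→L[ℝ] ℝ) →L[ℝ] (E →L[ℝ] ℝ))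
    (ContinuousAlternatingMap.curryLeftLI (𝕜 := ℝ) (E := E) (F := ℝ) (n := 1) A)

theorem contDiff_flatMap (E : Type) [NormedAddCommGroup E] [NormedSpace ℝ E] :
    ContDiff ℝ ∞ (flatMap E) := by
  have h1 : ContDiff ℝ ∞
      (ContinuousAlternatingMap.curryLeftLI (𝕜 := ℝ) (E := E) (F := ℝ) (n := 1)) :=
    LinearIsometry.contDiff _
  exact contDiff_const.clm_comp h1

theorem flatMap_apply {E : Type} [NormedAddCommGroup E] [NormedSpace ℝ E]
    (A : E [⋀^Fin 2]→L[ℝ] ℝ) (v w : E) : flatMap E A v w = A ![v, w] := by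
  have : (Function.const (Fin 1) w) = ![w] := by ext i; simp
  change A (Matrix.vecCons v (fun _ => w)) = _
  congr 1
  ext i
  fin_cases i <;> rfl

variable {d : ℕ} {M : Type*} [TopologicalSpace M] [ChartedSpace (EuclideanSpace ℝ (Fin d)) M]
  {δ : ℝ}

theorem isOpen_target (x₀ : M) : IsOpen (extChartAt (𝓡 d) x₀).target :=
  isOpen_extChartAt_target x₀

/-- The value of a symplectic form at a point, as a form on the model space. -/
def SymplecticForm.formAt (σ : SymplecticForm d M) (x : M) : EuclideanSpace ℝ (Fin d) [⋀^Fin 2]→L[ℝ] ℝ :=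
  σ.form x

/-- The differential of a function at a point, as a functional on the model space. -/
noncomputable def differentialAt (f : M → ℝ) (x : M) : EuclideanSpace ℝ (Fin d) →L[ℝ] ℝ :=
  mfderiv (𝓡 d) 𝓘(ℝ, ℝ) f x

/-- The derivative of a chart. -/
noncomputable def chartD (x₀ x : M) : EuclideanSpace ℝ (Fin d) →L[ℝ] EuclideanSpace ℝ (Fin d) :=
  mfderiv (𝓡 d) 𝓘(ℝ, EuclideanSpace ℝ (Fin d)) (extChartAt (𝓡 d) x₀) x

/-- The derivative of the inverse of a chart. -/
noncomputable def chartSymmD (x₀ : M) (y : EuclideanSpace ℝ (Fin d)) :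
    EuclideanSpace ℝ (Fin d) →L[ℝ] EuclideanSpace ℝ (Fin d) :=
  mfderiv 𝓘(ℝ, EuclideanSpace ℝ (Fin d)) (𝓡 d) (extChartAt (𝓡 d) x₀).symm y

theorem SymplecticForm.flatMap_formAt_injective (σ : SymplecticForm d M) (x : M) :
    Function.Injective (flatMap _ (σ.formAt x)) := by
  refine (injective_iff_map_eq_zero _).2 fun v hv => σ.nondegenerate x v fun w => ?_
  exact (flatMap_apply (σ.formAt x) v w).symm.trans (DFunLike.congr_fun hv w)

theorem flatMap_chartForm_apply (σ : SymplecticForm d M) (x₀ : M) (y v w : EuclideanSpace ℝ (Fin d)) :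
    flatMap _ (chartForm σ.form x₀ y) v w =
      flatMap _ (σ.formAt ((extChartAt (𝓡 d) x₀).symm y)) (chartSymmD x₀ y v) (chartSymmD x₀ y w) := by
  rw [flatMap_apply, flatMap_apply]
  change σ.formAt ((extChartAt (𝓡 d) x₀).symm y) (fun i => chartSymmD x₀ y (![v, w] i)) = _
  congr 1
  ext i : 1
  fin_cases i <;> rfl

theorem mdifferentiableAt_slice {F : Type*} [NormedAddCommGroup F] [NormedSpace ℝ F] {h : ℝ → M → F}
    (hh : ContMDiffOn (𝓘(ℝ, ℝ).prod (𝓡 d)) 𝓘(ℝ, F) ∞ (fun p : ℝ × M => h p.1 p.2)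
      (Icc 0 δ ×ˢ univ)) {t : ℝ} (ht : t ∈ Icc 0 δ) (x : M) :
    MDifferentiableAt (𝓡 d) 𝓘(ℝ, F) (h t) x := by
  have h1 : ContMDiff (𝓡 d) (𝓘(ℝ, ℝ).prod (𝓡 d)) ∞ (fun x : M => (t, x)) :=
    contMDiff_const.prodMk contMDiff_id
  have h2 := hh.comp_contMDiff h1 fun x => ⟨ht, mem_univ _⟩
  exact h2.mdifferentiableAt (by simp)

section
variable [IsManifold (𝓡 d) ∞ M]

theorem hasMFDerivAt_chart_symm (x₀ : M) {y : EuclideanSpace ℝ (Fin d)}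
    (hy : y ∈ (extChartAt (𝓡 d) x₀).target) :
    HasMFDerivAt 𝓘(ℝ, EuclideanSpace ℝ (Fin d)) (𝓡 d) (extChartAt (𝓡 d) x₀).symm y
      (chartSymmD x₀ y) :=
  ((((contMDiffOn_extChartAt_symm (n := ∞) x₀).contMDiffAt
    ((isOpen_target x₀).mem_nhds hy)).mdifferentiableAt (by simp))).hasMFDerivAt

theorem hasMFDerivAt_chart (x₀ : M) {x : M} (hx : x ∈ (extChartAt (𝓡 d) x₀).source) :
    HasMFDerivAt (𝓡 d) 𝓘(ℝ, EuclideanSpace ℝ (Fin d)) (extChartAt (𝓡 d) x₀) x (chartD x₀ x) :=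
  ((contMDiffAt_extChartAt' (n := ∞) (by simpa using hx)).mdifferentiableAt
    (by simp)).hasMFDerivAt

theorem chartD_chartSymmD (x₀ : M) {y : EuclideanSpace ℝ (Fin d)}
    (hy : y ∈ (extChartAt (𝓡 d) x₀).target) (v : EuclideanSpace ℝ (Fin d)) :
    chartD x₀ ((extChartAt (𝓡 d) x₀).symm y) (chartSymmD x₀ y v) = v := by
  have : IsManifold (𝓡 d) 1 M := IsManifold.of_le (n := ∞) (by simp)
  have h := mfderiv_extChartAt_comp_mfderivWithin_extChartAt_symm (I := 𝓡 d) hy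
  rw [ModelWithCorners.range_eq_univ, mfderivWithin_univ] at h
  exact DFunLike.congr_fun h v

theorem chartSymmD_chartD (x₀ : M) {y : EuclideanSpace ℝ (Fin d)}
    (hy : y ∈ (extChartAt (𝓡 d) x₀).target) (v : EuclideanSpace ℝ (Fin d)) :
    chartSymmD x₀ y (chartD x₀ ((extChartAt (𝓡 d) x₀).symm y) v) = v := by
  have : IsManifold (𝓡 d) 1 M := IsManifold.of_le (n := ∞) (by simp)
  have h := mfderivWithin_extChartAt_symm_comp_mfderiv_extChartAt (I := 𝓡 d) hy
  rw [ModelWithCorners.range_eq_univ, mfderivWithin_univ] at h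
  exact DFunLike.congr_fun h v

/-- A function on `[0, δ] × M` in the chart around `x₀`. -/
noncomputable def inChart {F : Type*} (h : ℝ → M → F) (x₀ : M) (t : ℝ) (y : EuclideanSpace ℝ (Fin d)) : F :=
  h t ((extChartAt (𝓡 d) x₀).symm y)

theorem contDiffOn_inChart {F : Type*} [NormedAddCommGroup F] [NormedSpace ℝ F] {h : ℝ → M → F}
    (hh : ContMDiffOn (𝓘(ℝ, ℝ).prod (𝓡 d)) 𝓘(ℝ, F) ∞ (fun p : ℝ × M => h p.1 p.2)
      (Icc 0 δ ×ˢ univ)) (x₀ : M) :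
    ContDiffOn ℝ ∞ (Function.uncurry (inChart (d := d) h x₀)) (chartDomain d δ x₀) := by
  rw [← contMDiffOn_iff_contDiffOn]
  have h1 : ContMDiffOn 𝓘(ℝ, ℝ × EuclideanSpace ℝ (Fin d)) (𝓘(ℝ, ℝ).prod (𝓡 d)) ∞
      (fun p : ℝ × EuclideanSpace ℝ (Fin d) => (p.1, (extChartAt (𝓡 d) x₀).symm p.2))
      (chartDomain d δ x₀) := by
    refine ContMDiffOn.prodMk ?_ ?_
    · exact contMDiff_iff_contDiff.2 contDiff_fst |>.contMDiffOn
    · exact (contMDiffOn_extChartAt_symm (n := ∞) x₀).comp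
        (contMDiff_iff_contDiff.2 contDiff_snd).contMDiffOn fun p hp => hp.2
  exact hh.comp h1 fun p hp => ⟨hp.1, mem_univ _⟩

/-- Chart derivatives are invertible, so nondegeneracy passes to the form in the chart; injectivity
then gives bijectivity by equality of dimensions. -/
theorem flatMap_chartForm_bijective (σ : SymplecticForm d M) (x₀ : M)
    {y : EuclideanSpace ℝ (Fin d)} (hy : y ∈ (extChartAt (𝓡 d) x₀).target) :
    ∃ e : EuclideanSpace ℝ (Fin d) ≃L[ℝ] (EuclideanSpace ℝ (Fin d) →L[ℝ] ℝ),
      (e : EuclideanSpace ℝ (Fin d) →L[ℝ] _) = flatMap _ (chartForm σ.form x₀ y) := by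
  have hinj : Function.Injective (flatMap _ (chartForm σ.form x₀ y)) := by
    refine (injective_iff_map_eq_zero _).2 fun v hv => ?_
    have h1 : chartSymmD x₀ y v = 0 := by
      refine (injective_iff_map_eq_zero _).1
        (σ.flatMap_formAt_injective ((extChartAt (𝓡 d) x₀).symm y)) _ ?_
      ext1 w
      have h2 := DFunLike.congr_fun hv (chartD x₀ ((extChartAt (𝓡 d) x₀).symm y) w)
      rwa [flatMap_chartForm_apply, chartSymmD_chartD x₀ hy] at h2
    rw [← chartD_chartSymmD x₀ hy v, h1, map_zero]
  have hdim : Module.finrank ℝ (EuclideanSpace ℝ (Fin d)) =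
      Module.finrank ℝ (EuclideanSpace ℝ (Fin d) →L[ℝ] ℝ) := by
    rw [← (LinearMap.toContinuousLinearMap (𝕜 := ℝ) (E := EuclideanSpace ℝ (Fin d))
      (F' := ℝ)).finrank_eq, Module.finrank_linearMap_self]
  exact ⟨ContinuousLinearEquiv.ofBijective _ (LinearMap.ker_eq_bot.2 hinj)
    (LinearMap.range_eq_top.2 ((LinearMap.injective_iff_surjective_of_finrank_eq_finrank hdim).1
      hinj)), ContinuousLinearMap.ext fun _ => rfl⟩

/-- The inverse of the symplectic form in a chart, as a map from covectors to vectors. -/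
noncomputable def sharp (σ : SymplecticForm d M) (x₀ : M) (y : EuclideanSpace ℝ (Fin d)) :
    (EuclideanSpace ℝ (Fin d) →L[ℝ] ℝ) →L[ℝ] EuclideanSpace ℝ (Fin d) :=
  (flatMap _ (chartForm σ.form x₀ y)).inverse

theorem eq_sharp_iff (σ : SymplecticForm d M) (x₀ : M) {y : EuclideanSpace ℝ (Fin d)}
    (hy : y ∈ (extChartAt (𝓡 d) x₀).target) (v : EuclideanSpace ℝ (Fin d))
    (ℓ : EuclideanSpace ℝ (Fin d) →L[ℝ] ℝ) :
    v = sharp σ x₀ y ℓ ↔ flatMap _ (chartForm σ.form x₀ y) v = ℓ := by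
  obtain ⟨e, he⟩ := flatMap_chartForm_bijective σ x₀ hy
  rw [sharp, ← he, ContinuousLinearMap.inverse_equiv]
  constructor
  · rintro rfl; simp
  · rintro rfl; simp

/-- Inversion of operators is smooth at invertible ones. -/
theorem contDiffOn_sharp (σ : SymplecticForm d M) (x₀ : M) :
    ContDiffOn ℝ ∞ (sharp σ x₀) (extChartAt (𝓡 d) x₀).target := by
  intro y hy
  obtain ⟨e, he⟩ := flatMap_chartForm_bijective σ x₀ hy
  have h1 : ContDiffWithinAt ℝ ∞ (fun y => flatMap _ (chartForm σ.form x₀ y))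
      (extChartAt (𝓡 d) x₀).target y :=
    (contDiff_flatMap (EuclideanSpace ℝ (Fin d))).contDiffAt.comp_contDiffWithinAt y
      (σ.smooth x₀ y hy)
  have h2 := contDiffAt_map_inverse (n := ∞) e
  rw [he] at h2
  exact h2.comp_contDiffWithinAt y h1

/-- The Hamiltonian vector field of `h` in the chart around `x₀`. -/
noncomputable def chartField (σ : SymplecticForm d M) (h : ℝ → M → ℝ) (x₀ : M) (t : ℝ)
    (y : EuclideanSpace ℝ (Fin d)) : EuclideanSpace ℝ (Fin d) :=
  sharp σ x₀ y (fderiv ℝ (inChart h x₀ t) y)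

theorem contDiffOn_chartField (hδ : 0 < δ) (σ : SymplecticForm d M) {h : ℝ → M → ℝ}
    (hh : ContMDiffOn (𝓘(ℝ, ℝ).prod (𝓡 d)) 𝓘(ℝ, ℝ) ∞ (fun p : ℝ × M => h p.1 p.2)
      (Icc 0 δ ×ˢ univ)) (x₀ : M) :
    ContDiffOn ℝ ∞ (Function.uncurry (chartField σ h x₀)) (chartDomain d δ x₀) := by
  refine ContDiffOn.clm_apply ?_ (contDiffOn_fderiv_slice hδ (isOpen_target x₀)
    (contDiffOn_inChart hh x₀))
  exact (contDiffOn_sharp σ x₀).comp contDiffOn_snd fun p hp => hp.2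

/-- The pointwise comparison of the Hamiltonian vector field with its chart representation. -/
theorem hamiltonian_vector_iff (σ : SymplecticForm d M) {h : ℝ → M → ℝ} (x₀ : M) {t : ℝ} {x : M}
    (hd : MDifferentiableAt (𝓡 d) 𝓘(ℝ, ℝ) (h t) x) (hx : x ∈ (extChartAt (𝓡 d) x₀).source)
    (X : EuclideanSpace ℝ (Fin d)) :
    flatMap _ (σ.formAt x) X = differentialAt (h t) x ↔
      chartD x₀ x X = chartField σ h x₀ t (extChartAt (𝓡 d) x₀ x) := by
  obtain ⟨y, hy, rfl⟩ : ∃ y ∈ (extChartAt (𝓡 d) x₀).target, x = (extChartAt (𝓡 d) x₀).symm y :=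
    ⟨_, (extChartAt (𝓡 d) x₀).map_source hx, ((extChartAt (𝓡 d) x₀).left_inv hx).symm⟩
  rw [(extChartAt (𝓡 d) x₀).right_inv hy, chartField, eq_sharp_iff σ x₀ hy]
  have hder : ∀ w, fderiv ℝ (inChart h x₀ t) y w =
      differentialAt (h t) ((extChartAt (𝓡 d) x₀).symm y) (chartSymmD x₀ y w) := by
    intro w
    have h1 : HasFDerivAt (inChart h x₀ t)
        ((differentialAt (h t) ((extChartAt (𝓡 d) x₀).symm y)).comp (chartSymmD x₀ y)) y :=
      (hd.hasMFDerivAt.comp y (hasMFDerivAt_chart_symm x₀ hy)).hasFDerivAt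
    rw [h1.fderiv]
    rfl
  constructor
  · intro H
    ext1 w
    rw [flatMap_chartForm_apply, hder, chartSymmD_chartD x₀ hy, H]
  · intro H
    ext1 w
    have := DFunLike.congr_fun H (chartD x₀ ((extChartAt (𝓡 d) x₀).symm y) w)
    rwa [flatMap_chartForm_apply, hder, chartSymmD_chartD x₀ hy, chartSymmD_chartD x₀ hy] at this

end

/-- A Hamiltonian trajectory on the time interval `[a, b]`. -/
def IsTrajectoryOn (σ : SymplecticForm d M) (h : ℝ → M → ℝ) (a b : ℝ) (γ : ℝ → M) : Prop :=
  ∀ t ∈ Icc a b, ∃ X : EuclideanSpace ℝ (Fin d),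
    flatMap _ (σ.formAt (γ t)) X = differentialAt (h t) (γ t) ∧
    HasMFDerivWithinAt 𝓘(ℝ, ℝ) (𝓡 d) γ (Icc a b) t (ContinuousLinearMap.toSpanSingleton ℝ X)

/-- Passes from tangent spaces to the fixed model space, where one continuous linear map equation
replaces the family of identities indexed by `w`. -/
theorem isHamiltonianTrajectory_iff (σ : SymplecticForm d M) (h : HamiltonianSpace d M δ)
    (γ : ℝ → M) : IsHamiltonianTrajectory σ h γ ↔ IsTrajectoryOn σ (zeroExtend h.1) 0 δ γ := by
  refine forall₂_congr fun t _ => exists_congr fun X => and_congr ?_ ?_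
  · refine Iff.trans (forall_congr' fun w => ?_) (ContinuousLinearMap.ext_iff (f :=
      flatMap _ (σ.formAt (γ t)) X) (g := differentialAt (zeroExtend h.1 t) (γ t))).symm
    have h := flatMap_apply (σ.formAt (γ t)) X w
    exact ⟨fun H => h.trans H, fun H => h.symm.trans H⟩
  · have : ContinuousLinearMap.toSpanSingleton ℝ (X : EuclideanSpace ℝ (Fin d)) =
        (1 : ℝ →L[ℝ] ℝ).smulRight (X : EuclideanSpace ℝ (Fin d)) := by
      ext1; simp
    exact this ▸ Iff.rfl

theorem IsTrajectoryOn.continuousOn {σ : SymplecticForm d M} {h : ℝ → M → ℝ} {a b : ℝ} {γ : ℝ → M}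
    (hγ : IsTrajectoryOn σ h a b γ) : ContinuousOn γ (Icc a b) := fun t ht => by
  obtain ⟨X, -, hX⟩ := hγ t ht
  exact hX.continuousWithinAt

theorem IsTrajectoryOn.mono {σ : SymplecticForm d M} {h : ℝ → M → ℝ} {a b a' b' : ℝ} {γ : ℝ → M}
    (hγ : IsTrajectoryOn σ h a b γ) (hsub : Icc a' b' ⊆ Icc a b) : IsTrajectoryOn σ h a' b' γ :=
  fun t ht => by
    obtain ⟨X, h1, hX⟩ := hγ t (hsub ht)
    exact ⟨X, h1, hX.mono hsub⟩

/-- The property of trajectories depends only on the values of the curve and of the Hamiltonian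
at the times considered. -/
theorem IsTrajectoryOn.congr {σ : SymplecticForm d M} {h h' : ℝ → M → ℝ} {a b : ℝ} {γ γ' : ℝ → M}
    (hγ : IsTrajectoryOn σ h a b γ) (heq : EqOn γ' γ (Icc a b)) (hh : ∀ t ∈ Icc a b, h' t = h t) :
    IsTrajectoryOn σ h' a b γ' := fun t ht => by
  obtain ⟨X, h1, hX⟩ := hγ t ht
  have ht' := heq ht
  have h2 := hX.congr_of_eventuallyEq (heq.eventuallyEq_of_mem self_mem_nhdsWithin) ht'
  rw [hh t ht]
  rw [ht']
  exact ⟨X, h1, h2⟩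

/-- At the junction both one-sided velocities solve the same equation `σ (X, ·) = dh`. Nondegeneracy
makes them equal, so the concatenation is differentiable there. -/
theorem IsTrajectoryOn.trans {σ : SymplecticForm d M} {h : ℝ → M → ℝ} {a b c : ℝ} (hab : a ≤ b)
    (hbc : b ≤ c) {γ γ' : ℝ → M} (hγ : IsTrajectoryOn σ h a b γ) (hγ' : IsTrajectoryOn σ h b c γ')
    (hb : γ b = γ' b) :
    IsTrajectoryOn σ h a c fun t => if t ≤ b then γ t else γ' t := by
  set β : ℝ → M := fun t => if t ≤ b then γ t else γ' t with hβ
  have h1 : IsTrajectoryOn σ h a b β := hγ.congr (fun t ht => if_pos ht.2) fun _ _ => rfl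
  have h2 : IsTrajectoryOn σ h b c β := hγ'.congr (fun t ht => by
    rcases ht.1.eq_or_lt with rfl | hlt
    · simp [hβ, hb]
    · exact if_neg (not_le.2 hlt)) fun _ _ => rfl
  intro t ht
  have hunion : Icc a c = Icc a b ∪ Icc b c := (Icc_union_Icc_eq_Icc hab hbc).symm
  have hout : ∀ {s : Set ℝ}, IsClosed s → t ∉ s → ∀ X : EuclideanSpace ℝ (Fin d),
      HasMFDerivWithinAt 𝓘(ℝ, ℝ) (𝓡 d) β (Icc a c) t (ContinuousLinearMap.toSpanSingleton ℝ X) ↔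
      HasMFDerivWithinAt 𝓘(ℝ, ℝ) (𝓡 d) β (Icc a c \ s) t (ContinuousLinearMap.toSpanSingleton ℝ X) := by
    intro s hs hts X
    rw [sdiff_eq]
    exact (hasMFDerivWithinAt_inter (hs.isOpen_compl.mem_nhds hts)).symm
  rcases lt_trichotomy t b with hlt | rfl | hgt
  · obtain ⟨X, h3, hX⟩ := h1 t ⟨ht.1, hlt.le⟩
    refine ⟨X, h3, (hout isClosed_Icc (s := Icc b c) (fun h => absurd h.1 (not_le.2 hlt)) X).2
      (hX.mono ?_)⟩
    rw [hunion, union_sdiff_right]; exact sdiff_subset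
  · obtain ⟨X, h3, hX⟩ := h1 t ⟨ht.1, le_rfl⟩
    obtain ⟨X', h3', hX'⟩ := h2 t ⟨le_rfl, ht.2⟩
    have hXX : X = X' := σ.flatMap_formAt_injective _ (h3.trans h3'.symm)
    refine ⟨X, h3, ?_⟩
    rw [hunion]
    exact hX.union (hXX ▸ hX')
  · obtain ⟨X, h3, hX⟩ := h2 t ⟨hgt.le, ht.2⟩
    refine ⟨X, h3, (hout isClosed_Icc (s := Icc a b) (fun h => absurd h.2 (not_le.2 hgt)) X).2
      (hX.mono ?_)⟩
    rw [hunion, union_sdiff_left]; exact sdiff_subset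

variable [IsManifold (𝓡 d) ∞ M]

theorem IsTrajectoryOn.solvesODE {σ : SymplecticForm d M} {h : ℝ → M → ℝ}
    (hh : ContMDiffOn (𝓘(ℝ, ℝ).prod (𝓡 d)) 𝓘(ℝ, ℝ) ∞ (fun p : ℝ × M => h p.1 p.2)
      (Icc 0 δ ×ˢ univ)) {a b : ℝ} (hab : Icc a b ⊆ Icc 0 δ) {γ : ℝ → M}
    (hγ : IsTrajectoryOn σ h a b γ) {x₀ : M}
    (hmem : ∀ t ∈ Icc a b, γ t ∈ (extChartAt (𝓡 d) x₀).source) :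
    SolvesODE (chartField σ h x₀) (extChartAt (𝓡 d) x₀).target a b
      fun t => extChartAt (𝓡 d) x₀ (γ t) := by
  intro t ht
  refine ⟨(extChartAt (𝓡 d) x₀).map_source (hmem t ht), ?_⟩
  obtain ⟨X, h1, hX⟩ := hγ t ht
  rw [hamiltonian_vector_iff σ x₀ (mdifferentiableAt_slice hh (hab ht) _) (hmem t ht)] at h1
  have h2 := ((hasMFDerivAt_chart x₀ (hmem t ht)).comp_hasMFDerivWithinAt t hX).hasFDerivWithinAt
  rw [← h1]
  have h3 : HasDerivWithinAt (extChartAt (𝓡 d) x₀ ∘ γ)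
    (((chartD x₀ (γ t)).comp (ContinuousLinearMap.toSpanSingleton ℝ X)) 1) (Icc a b) t :=
    HasFDerivWithinAt.hasDerivWithinAt h2
  simpa using! h3

theorem SolvesODE.isTrajectoryOn {σ : SymplecticForm d M} {h : ℝ → M → ℝ}
    (hh : ContMDiffOn (𝓘(ℝ, ℝ).prod (𝓡 d)) 𝓘(ℝ, ℝ) ∞ (fun p : ℝ × M => h p.1 p.2)
      (Icc 0 δ ×ˢ univ)) {a b : ℝ} (hab : Icc a b ⊆ Icc 0 δ)
    {α : ℝ → EuclideanSpace ℝ (Fin d)} {x₀ : M}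
    (hα : SolvesODE (chartField σ h x₀) (extChartAt (𝓡 d) x₀).target a b α) :
    IsTrajectoryOn σ h a b fun t => (extChartAt (𝓡 d) x₀).symm (α t) := by
  intro t ht
  obtain ⟨hy, hd⟩ := hα t ht
  have hsrc := (extChartAt (𝓡 d) x₀).map_target hy
  refine ⟨chartSymmD x₀ (α t) (chartField σ h x₀ t (α t)), ?_, ?_⟩
  · rw [hamiltonian_vector_iff σ x₀ (mdifferentiableAt_slice hh (hab ht) _) hsrc,
      chartD_chartSymmD x₀ hy, (extChartAt (𝓡 d) x₀).right_inv hy]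
  · have h2 := (hasMFDerivAt_chart_symm x₀ hy).comp_hasMFDerivWithinAt t
      hd.hasFDerivWithinAt.hasMFDerivWithinAt
    have h3 : ContinuousLinearMap.toSpanSingleton ℝ (chartSymmD x₀ (α t) (chartField σ h x₀ t (α t)))
        = (chartSymmD x₀ (α t)).comp
          (ContinuousLinearMap.toSpanSingleton ℝ (chartField σ h x₀ t (α t))) := by
      ext1; simp
    exact h3.symm ▸ h2

end HamiltonianField

/-! ## The topology on Hamiltonians and convergence of Hamiltonian vector fields -/

section FieldConvergence

theorem norm_fderiv_slice_le {E F : Type} [NormedAddCommGroup E] [NormedSpace ℝ E]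
    [NormedAddCommGroup F] [NormedSpace ℝ F] {X : ℝ → E → F} {Ω : Set E} {a b : ℝ} (hab : a < b)
    (hΩ : IsOpen Ω) (hX : ContDiffOn ℝ ∞ (Function.uncurry X) (Icc a b ×ˢ Ω)) {p : ℝ × E}
    (hp : p ∈ Icc a b ×ˢ Ω) :
    ‖fderiv ℝ (X p.1) p.2‖ ≤
      ‖iteratedFDerivWithin ℝ 1 (Function.uncurry X) (Icc a b ×ˢ Ω) p‖ := by
  rw [(hasFDerivAt_slice hΩ hX hp.1 hp.2).fderiv, norm_iteratedFDerivWithin_one _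
    (uniqueDiffOn_Icc_prod hab hΩ p hp)]
  refine (ContinuousLinearMap.opNorm_comp_le _ _).trans ?_
  exact mul_le_of_le_one_right (norm_nonneg _) (ContinuousLinearMap.norm_inr_le_one ℝ ℝ E)

/-- Spatial derivatives are total derivatives composed with the inclusion `E → ℝ × E`, which has
norm at most one. This brings the seminorms of the `C^∞` topology into play. -/
theorem norm_fderiv_fderiv_slice_le {E F : Type} [NormedAddCommGroup E] [NormedSpace ℝ E]
    [NormedAddCommGroup F] [NormedSpace ℝ F] {X : ℝ → E → F} {Ω : Set E} {a b : ℝ} (hab : a < b)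
    (hΩ : IsOpen Ω) (hX : ContDiffOn ℝ ∞ (Function.uncurry X) (Icc a b ×ˢ Ω)) {p : ℝ × E}
    (hp : p ∈ Icc a b ×ˢ Ω) :
    ‖fderiv ℝ (fun y => fderiv ℝ (X p.1) y) p.2‖ ≤
      ‖iteratedFDerivWithin ℝ 2 (Function.uncurry X) (Icc a b ×ˢ Ω) p‖ := by
  have hu := uniqueDiffOn_Icc_prod hab hΩ
  set Φ : ℝ → E → (ℝ × E →L[ℝ] F) := fun t y =>
    fderivWithin ℝ (Function.uncurry X) (Icc a b ×ˢ Ω) (t, y) with hΦ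
  have hΦs : ContDiffOn ℝ ∞ (Function.uncurry Φ) (Icc a b ×ˢ Ω) := hX.fderivWithin hu (by simp)
  have h1 := hasFDerivAt_slice hΩ hΦs hp.1 hp.2
  have h2 : HasFDerivAt (fun y => fderiv ℝ (X p.1) y)
      ((ContinuousLinearMap.compL ℝ E (ℝ × E) F).flip (ContinuousLinearMap.inr ℝ ℝ E) ∘L
        fderiv ℝ (Φ p.1) p.2) p.2 := by
    refine (((ContinuousLinearMap.compL ℝ E (ℝ × E) F).flip
      (ContinuousLinearMap.inr ℝ ℝ E)).hasFDerivAt.comp p.2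
        h1.differentiableAt.hasFDerivAt).congr_of_eventuallyEq ?_
    filter_upwards [hΩ.mem_nhds hp.2] with y hy
    exact (hasFDerivAt_slice hΩ hX hp.1 hy).fderiv
  rw [h2.fderiv]
  have h3 : ‖(ContinuousLinearMap.compL ℝ E (ℝ × E) F).flip (ContinuousLinearMap.inr ℝ ℝ E)‖ ≤ 1 := by
    refine ContinuousLinearMap.opNorm_le_bound _ zero_le_one fun A => ?_
    rw [one_mul]
    exact (ContinuousLinearMap.opNorm_comp_le _ _).trans
      (mul_le_of_le_one_right (norm_nonneg _) (ContinuousLinearMap.norm_inr_le_one ℝ ℝ E))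
  refine (ContinuousLinearMap.opNorm_comp_le _ _).trans ?_
  refine (mul_le_of_le_one_left (norm_nonneg _) h3).trans ?_
  refine (norm_fderiv_slice_le hab hΩ hΦs hp).trans ?_
  exact (norm_iteratedFDerivWithin_fderivWithin (n := 1) (f := Function.uncurry X) hu hp).le

-- A field of the form `S · dX` costs one derivative of `X`, and its own derivative costs two by the
-- product rule. The constant bounds `S` and its derivative on `C`, uniformly in `X`.
set_option maxSynthPendingDepth 3 in
theorem exists_gradient_field_bound {E : Type} [NormedAddCommGroup E] [NormedSpace ℝ E]
    {S : E → (E →L[ℝ] ℝ) →L[ℝ] E} {Ω : Set E} {δ : ℝ} (hδ : 0 < δ) (hΩ : IsOpen Ω)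
    (hs : ContDiffOn ℝ ∞ S Ω) {C : Set E} (hC : IsCompact C) (hCt : C ⊆ Ω) :
    ∃ K : ℝ, 0 < K ∧ ∀ X : ℝ → E → ℝ, ContDiffOn ℝ ∞ (Function.uncurry X) (Icc 0 δ ×ˢ Ω) →
      ∀ p ∈ Icc 0 δ ×ˢ C,
        ‖S p.2 (fderiv ℝ (X p.1) p.2)‖ ≤ K * ‖iteratedFDerivWithin ℝ 1
          (Function.uncurry X) (Icc 0 δ ×ˢ Ω) p‖ ∧
        ‖fderiv ℝ (fun y => S y (fderiv ℝ (X p.1) y)) p.2‖ ≤ K * (‖iteratedFDerivWithin ℝ 1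
          (Function.uncurry X) (Icc 0 δ ×ˢ Ω) p‖ + ‖iteratedFDerivWithin ℝ 2
          (Function.uncurry X) (Icc 0 δ ×ˢ Ω) p‖) := by
  obtain ⟨K₁, hK₁⟩ := hC.exists_bound_of_continuousOn (f := S)
    (hs.continuousOn.mono hCt)
  obtain ⟨K₂, hK₂⟩ : ∃ K₂, ∀ y ∈ C, ‖fderiv ℝ S y‖ ≤ K₂ := by
    obtain ⟨K₂, h⟩ := hC.bddAbove_image (f := fun y => ‖fderiv ℝ S y‖)
      ((hs.continuousOn_fderiv_of_isOpen hΩ (by simp)).mono hCt).norm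
    exact ⟨K₂, fun y hy => h (mem_image_of_mem _ hy)⟩
  refine ⟨max (max K₁ K₂) 1, by positivity, fun X hG p hp => ?_⟩
  set K := max (max K₁ K₂) 1
  have hpS : p ∈ Icc 0 δ ×ˢ Ω := ⟨hp.1, hCt hp.2⟩
  have h1 := norm_fderiv_slice_le hδ hΩ hG hpS
  have h2 := norm_fderiv_fderiv_slice_le hδ hΩ hG hpS
  have k1 : ‖S p.2‖ ≤ K := (hK₁ _ hp.2).trans ((le_max_left _ _).trans (le_max_left _ _))
  have k2 : ‖fderiv ℝ S p.2‖ ≤ K :=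
    (hK₂ _ hp.2).trans ((le_max_right _ _).trans (le_max_left _ _))
  have hK0 : 0 ≤ K := (norm_nonneg _).trans k1
  refine ⟨(ContinuousLinearMap.le_opNorm _ _).trans (mul_le_mul k1 h1 (norm_nonneg _) hK0), ?_⟩
  have d1 : HasFDerivAt (S) (fderiv ℝ S p.2) p.2 :=
    ((hs.contDiffAt (hΩ.mem_nhds hpS.2)).differentiableAt (by simp)).hasFDerivAt
  have d2 : HasFDerivAt (fun y => fderiv ℝ (X p.1) y)
      (fderiv ℝ (fun y => fderiv ℝ (X p.1) y) p.2) p.2 :=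
    (hasFDerivAt_slice (X := fun t y => fderiv ℝ (X t) y) hΩ
      (contDiffOn_fderiv_slice hδ hΩ hG) hpS.1 hpS.2).differentiableAt.hasFDerivAt
  have d3 : fderiv ℝ (fun y => S y (fderiv ℝ (X p.1) y)) p.2 = _ := (d1.clm_apply d2).fderiv
  rw [d3, mul_add, add_comm]
  refine (norm_add_le _ _).trans (add_le_add ?_ ?_)
  · refine ContinuousLinearMap.opNorm_le_bound _ (by positivity) fun v => ?_
    simp only [ContinuousLinearMap.flip_apply]
    refine (ContinuousLinearMap.le_opNorm₂ _ _ _).trans ?_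
    refine (mul_le_mul (mul_le_mul_of_nonneg_right k2 (norm_nonneg v)) h1 (norm_nonneg _)
      (by positivity)).trans_eq ?_
    ring
  · exact (ContinuousLinearMap.opNorm_comp_le _ _).trans (mul_le_mul k1 h2 (norm_nonneg _) hK0)


variable {d : ℕ} {M : Type*} [TopologicalSpace M] [ChartedSpace (EuclideanSpace ℝ (Fin d)) M]
  {δ : ℝ}

/-- A smooth function on `ℝ × M` defines a Hamiltonian on `[0, δ] × M`. -/
def HamiltonianSpace.ofFun (f : ℝ → M → ℝ)
    (hf : ContMDiffOn (𝓘(ℝ, ℝ).prod (𝓡 d)) 𝓘(ℝ, ℝ) ∞ (fun p : ℝ × M => f p.1 p.2)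
      (Icc 0 δ ×ˢ univ)) : HamiltonianSpace d M δ :=
  ⟨fun t x => f t x, hf.congr fun p hp => by simp [zeroExtend, hp.1.1, hp.1.2]⟩

theorem HamiltonianSpace.zeroExtend_ofFun {f : ℝ → M → ℝ}
    (hf : ContMDiffOn (𝓘(ℝ, ℝ).prod (𝓡 d)) 𝓘(ℝ, ℝ) ∞ (fun p : ℝ × M => f p.1 p.2)
      (Icc 0 δ ×ˢ univ)) {t : ℝ} (ht : t ∈ Icc 0 δ) :
    zeroExtend (HamiltonianSpace.ofFun f hf).1 t = f t := by
  ext x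
  simp [zeroExtend, HamiltonianSpace.ofFun, ht.1, ht.2]

theorem HamiltonianSpace.tendsto_nhds_iff {Λ : Type*} {l : Filter Λ}
    {H : Λ → HamiltonianSpace d M δ} {h₀ : HamiltonianSpace d M δ} :
    Filter.Tendsto H l (𝓝 h₀) ↔ ∀ (k : ℕ) (x₀ : M) (K : Set (ℝ × EuclideanSpace ℝ (Fin d))),
      IsCompact K → K ⊆ chartDomain d δ x₀ →
      TendstoUniformlyOn (fun a => (H a).chartDeriv k x₀) (h₀.chartDeriv k x₀) l K := by
  unfold instTopologicalSpace
  rw [nhds_iInf, Filter.tendsto_iInf]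
  refine forall_congr' fun k => ?_
  rw [nhds_iInf, Filter.tendsto_iInf]
  refine forall_congr' fun x₀ => ?_
  rw [nhds_induced, Filter.tendsto_comap_iff, UniformOnFun.tendsto_iff_tendstoUniformlyOn]
  exact ⟨fun h K h1 h2 => h K ⟨h1, h2⟩, fun h K hK => h K hK.1 hK.2⟩

theorem chartField_sub (σ : SymplecticForm d M) {h h' : ℝ → M → ℝ} {x₀ : M} {t : ℝ}
    {y : EuclideanSpace ℝ (Fin d)}
    (hd : DifferentiableAt ℝ (inChart h x₀ t) y) (hd' : DifferentiableAt ℝ (inChart h' x₀ t) y) :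
    chartField σ (fun t x => h t x - h' t x) x₀ t y =
      chartField σ h x₀ t y - chartField σ h' x₀ t y := by
  have : fderiv ℝ (inChart (fun t x => h t x - h' t x) x₀ t) y =
      fderiv ℝ (inChart h x₀ t) y - fderiv ℝ (inChart h' x₀ t) y := fderiv_sub hd hd'
  rw [chartField, this, map_sub]
  rfl

variable [IsManifold (𝓡 d) ∞ M]

theorem exists_chartField_bound (hδ : 0 < δ) (σ : SymplecticForm d M) (x₀ : M)
    {C : Set (EuclideanSpace ℝ (Fin d))} (hC : IsCompact C)
    (hCt : C ⊆ (extChartAt (𝓡 d) x₀).target) :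
    ∃ K : ℝ, 0 < K ∧ ∀ h : ℝ → M → ℝ,
      ContMDiffOn (𝓘(ℝ, ℝ).prod (𝓡 d)) 𝓘(ℝ, ℝ) ∞ (fun p : ℝ × M => h p.1 p.2) (Icc 0 δ ×ˢ univ) →
      ∀ p ∈ Icc 0 δ ×ˢ C,
        ‖chartField σ h x₀ p.1 p.2‖ ≤ K * ‖iteratedFDerivWithin ℝ 1
          (Function.uncurry (inChart h x₀)) (chartDomain d δ x₀) p‖ ∧
        ‖fderiv ℝ (chartField σ h x₀ p.1) p.2‖ ≤ K * (‖iteratedFDerivWithin ℝ 1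
          (Function.uncurry (inChart h x₀)) (chartDomain d δ x₀) p‖ + ‖iteratedFDerivWithin ℝ 2
          (Function.uncurry (inChart h x₀)) (chartDomain d δ x₀) p‖) := by
  obtain ⟨K, hK, h1⟩ := exists_gradient_field_bound hδ (isOpen_target x₀) (contDiffOn_sharp σ x₀)
    hC hCt
  exact ⟨K, hK, fun h hh p hp => h1 (inChart h x₀) (contDiffOn_inChart hh x₀) p hp⟩

/-- The Hamiltonian field is linear in the Hamiltonian, so the bound can be applied to the
difference. Only the derivatives of orders one and two in the `C^∞` topology enter. -/
theorem tendstoUniformlyOn_chartField_aux (hδ : 0 < δ) (σ : SymplecticForm d M) (x₀ : M)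
    (h₀ : HamiltonianSpace d M δ) {C : Set (EuclideanSpace ℝ (Fin d))} (hC : IsCompact C)
    (hCt : C ⊆ (extChartAt (𝓡 d) x₀).target) {ε : ℝ} (hε : 0 < ε) :
    ∀ᶠ h : HamiltonianSpace d M δ in 𝓝 h₀, ∀ p ∈ Icc 0 δ ×ˢ C,
      ‖chartField σ (zeroExtend h.1) x₀ p.1 p.2 - chartField σ (zeroExtend h₀.1) x₀ p.1 p.2‖ < ε ∧
      ‖fderiv ℝ (chartField σ (zeroExtend h.1) x₀ p.1) p.2 -
        fderiv ℝ (chartField σ (zeroExtend h₀.1) x₀ p.1) p.2‖ < ε := by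
  obtain ⟨K, hK, hbound⟩ := exists_chartField_bound hδ σ x₀ hC hCt
  have hT := HamiltonianSpace.tendsto_nhds_iff.1 (Filter.tendsto_id (x := 𝓝 h₀))
  have hcomp : IsCompact (Icc 0 δ ×ˢ C) := isCompact_Icc.prod hC
  have hsub : Icc 0 δ ×ˢ C ⊆ chartDomain d δ x₀ := prod_mono_right hCt
  -- The bound for the derivative of the field has two terms, each contributing less than `ε / 2`.
  have hε' : 0 < ε / (2 * K) := by positivity
  filter_upwards [Metric.tendstoUniformlyOn_iff.1 (hT 1 x₀ _ hcomp hsub) _ hε',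
    Metric.tendstoUniformlyOn_iff.1 (hT 2 x₀ _ hcomp hsub) _ hε'] with h e1 e2 p hp
  have hu := uniqueDiffOn_Icc_prod hδ (isOpen_target (d := d) x₀)
  have hpS := hsub hp
  have s1 := contDiffOn_inChart h.2 x₀
  have s0 := contDiffOn_inChart h₀.2 x₀
  have hdiff : ∀ y ∈ (extChartAt (𝓡 d) x₀).target,
      chartField σ (fun t x => zeroExtend h.1 t x - zeroExtend h₀.1 t x) x₀ p.1 y =
      chartField σ (zeroExtend h.1) x₀ p.1 y - chartField σ (zeroExtend h₀.1) x₀ p.1 y :=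
    fun y hy => chartField_sub σ
      (hasFDerivAt_slice (isOpen_target x₀) s1 hp.1 hy).differentiableAt
      (hasFDerivAt_slice (isOpen_target x₀) s0 hp.1 hy).differentiableAt
  have hit : ∀ k : ℕ, ‖iteratedFDerivWithin ℝ k (Function.uncurry
      (inChart (fun t x => zeroExtend h.1 t x - zeroExtend h₀.1 t x) x₀)) (chartDomain d δ x₀) p‖ =
      dist (h₀.chartDeriv k x₀ p) (h.chartDeriv k x₀ p) := by
    intro k
    rw [dist_comm, dist_eq_norm]
    congr 1
    exact iteratedFDerivWithin_sub_apply ((s1 p hpS).of_le (by exact_mod_cast le_top))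
      ((s0 p hpS).of_le (by exact_mod_cast le_top)) hu hpS
  obtain ⟨b1, b2⟩ := hbound
    (fun t x => zeroExtend h.1 t x - zeroExtend h₀.1 t x) (h.2.sub h₀.2) p hp
  have e1' := e1 p hp
  have e2' := e2 p hp
  simp only [id] at e1' e2'
  rw [hit 1] at b1
  rw [hit 1, hit 2] at b2
  rw [lt_div_iff₀ (by positivity)] at e1' e2'
  have hn1 : 0 ≤ dist (h₀.chartDeriv 1 x₀ p) (h.chartDeriv 1 x₀ p) := dist_nonneg
  constructor
  · rw [← hdiff _ (hCt hp.2)]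
    refine b1.trans_lt ?_
    nlinarith
  · have f1 := (hasFDerivAt_slice (isOpen_target x₀) (contDiffOn_chartField hδ σ h.2 x₀)
      hp.1 (hCt hp.2)).differentiableAt
    have f0 := (hasFDerivAt_slice (isOpen_target x₀) (contDiffOn_chartField hδ σ h₀.2 x₀)
      hp.1 (hCt hp.2)).differentiableAt
    have e3 : fderiv ℝ (chartField σ (fun t x => zeroExtend h.1 t x - zeroExtend h₀.1 t x) x₀ p.1)
        p.2 = fderiv ℝ (chartField σ (zeroExtend h.1) x₀ p.1) p.2 -
        fderiv ℝ (chartField σ (zeroExtend h₀.1) x₀ p.1) p.2 := by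
      rw [← fderiv_sub f1 f0]
      refine Filter.EventuallyEq.fderiv_eq ?_
      filter_upwards [(isOpen_target x₀).mem_nhds (hCt hp.2)] with y hy
      exact hdiff y hy
    rw [← e3]
    refine b2.trans_lt ?_
    linarith

theorem tendstoUniformlyOn_chartField (hδ : 0 < δ) (σ : SymplecticForm d M) (x₀ : M)
    (h₀ : HamiltonianSpace d M δ) {C : Set (EuclideanSpace ℝ (Fin d))} (hC : IsCompact C)
    (hCt : C ⊆ (extChartAt (𝓡 d) x₀).target) :
    TendstoUniformlyOn
      (fun h : HamiltonianSpace d M δ => Function.uncurry (chartField σ (zeroExtend h.1) x₀))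
      (Function.uncurry (chartField σ (zeroExtend h₀.1) x₀)) (𝓝 h₀) (Icc 0 δ ×ˢ C) := by
  refine Metric.tendstoUniformlyOn_iff.2 fun ε hε => ?_
  filter_upwards [tendstoUniformlyOn_chartField_aux hδ σ x₀ h₀ hC hCt hε] with h hh p hp
  rw [dist_comm, dist_eq_norm]
  exact (hh p hp).1

theorem tendstoUniformlyOn_fderiv_chartField (hδ : 0 < δ) (σ : SymplecticForm d M) (x₀ : M)
    (h₀ : HamiltonianSpace d M δ) {C : Set (EuclideanSpace ℝ (Fin d))} (hC : IsCompact C)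
    (hCt : C ⊆ (extChartAt (𝓡 d) x₀).target) :
    TendstoUniformlyOn (fun (h : HamiltonianSpace d M δ) (p : ℝ × EuclideanSpace ℝ (Fin d)) =>
        fderiv ℝ (chartField σ (zeroExtend h.1) x₀ p.1) p.2)
      (fun p => fderiv ℝ (chartField σ (zeroExtend h₀.1) x₀ p.1) p.2) (𝓝 h₀)
      (Icc 0 δ ×ˢ C) := by
  refine Metric.tendstoUniformlyOn_iff.2 fun ε hε => ?_
  filter_upwards [tendstoUniformlyOn_chartField_aux hδ σ x₀ h₀ hC hCt hε] with h hh p hp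
  rw [dist_comm, dist_eq_norm]
  exact (hh p hp).2

end FieldConvergence

/-! ## Hamiltonian flows near a given trajectory -/

/-! ### Composition and reparametrization of families with continuous first derivatives -/

section C1FamilyLemmas

variable {Λ E F G : Type*} [TopologicalSpace Λ] [NormedAddCommGroup E] [NormedSpace ℝ E]
  [NormedAddCommGroup F] [NormedSpace ℝ F] [NormedAddCommGroup G] [NormedSpace ℝ G] {l₀ : Λ}

theorem C1Family.const {g : E → F} {U : Set E} (hU : IsOpen U) (hg : ContDiffOn ℝ ∞ g U) {x₀ : E}
    (hx₀ : x₀ ∈ U) : C1Family (fun _ : Λ => g) l₀ x₀ where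
  continuousAt := (hg.continuousOn.continuousAt (hU.mem_nhds hx₀)).comp continuousAt_snd
  contDiffAt := by
    filter_upwards [continuousAt_snd.eventually (hU.mem_nhds hx₀)] with q hq
    exact hg.contDiffAt (hU.mem_nhds hq)
  continuousAt_fderiv := ((hg.continuousOn_fderiv_of_isOpen hU (by simp)).continuousAt
    (hU.mem_nhds hx₀)).comp continuousAt_snd

theorem C1Family.comp {Ψ : Λ → F → G} {Θ : Λ → E → F} {x₀ : E} (hΨ : C1Family Ψ l₀ (Θ l₀ x₀))
    (hΘ : C1Family Θ l₀ x₀) : C1Family (fun l x => Ψ l (Θ l x)) l₀ x₀ := by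
  have hc : ContinuousAt (fun q : Λ × E => (q.1, Θ q.1 q.2)) (l₀, x₀) :=
    continuousAt_fst.prodMk hΘ.continuousAt
  have he := hc.eventually hΨ.contDiffAt
  refine ⟨hΨ.continuousAt.tendsto.comp hc, ?_, ?_⟩
  · filter_upwards [he, hΘ.contDiffAt] with q h1 h2
    exact ContDiffAt.comp q.2 h1 h2
  · have h3 : ContinuousAt (fun q : Λ × E => (fderiv ℝ (Ψ q.1) (Θ q.1 q.2)).comp
        (fderiv ℝ (Θ q.1) q.2)) (l₀, x₀) :=
      (ContinuousAt.comp_of_eq (g := fun q : Λ × F => fderiv ℝ (Ψ q.1) q.2)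
        hΨ.continuousAt_fderiv hc rfl).clm_comp hΘ.continuousAt_fderiv
    refine h3.congr ?_
    filter_upwards [he, hΘ.contDiffAt] with q h1 h2
    exact (fderiv_comp q.2 (h1.differentiableAt (by simp)) (h2.differentiableAt (by simp))).symm

theorem C1Family.comp_of_eq {Ψ : Λ → F → G} {Θ : Λ → E → F} {x₀ : E} {y₀ : F}
    (hΨ : C1Family Ψ l₀ y₀) (hΘ : C1Family Θ l₀ x₀) (h : Θ l₀ x₀ = y₀) :
    C1Family (fun l x => Ψ l (Θ l x)) l₀ x₀ := by
  subst h
  exact hΨ.comp hΘ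

/-- Pulling a family back along a map of parameter spaces. -/
theorem C1Family.comp_param {Λ' : Type*} [TopologicalSpace Λ'] {Θ : Λ → E → F} {x₀ : E} {l₁ : Λ'}
    {g : Λ' → Λ} (hΘ : C1Family Θ (g l₁) x₀) (hg : ContinuousAt g l₁) :
    C1Family (fun l => Θ (g l)) l₁ x₀ := by
  have hc : ContinuousAt (fun q : Λ' × E => (g q.1, q.2)) (l₁, x₀) :=
    (ContinuousAt.comp (x := (l₁, x₀)) (g := g) hg continuousAt_fst).prodMk continuousAt_snd
  exact ⟨hΘ.continuousAt.tendsto.comp hc,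
    hc.eventually hΘ.contDiffAt,
    hΘ.continuousAt_fderiv.tendsto.comp hc⟩

end C1FamilyLemmas

/-! ### Chart representation, uniqueness and openness of the domain of Hamiltonian flows -/

section FlowNear

variable {d : ℕ} {M : Type*} [TopologicalSpace M] [ChartedSpace (EuclideanSpace ℝ (Fin d)) M]
  {δ : ℝ}

/-- Near the curve `γ₀`, the flow from time `a` to time `b` of all Hamiltonians close to `H₀` is
represented, in the preferred charts at the end points, by a `C1Family`. -/
def FlowNear (σ : SymplecticForm d M) (H₀ : HamiltonianSpace d M δ) (a b : ℝ) (γ₀ : ℝ → M) : Prop :=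
  ∃ F : HamiltonianSpace d M δ → EuclideanSpace ℝ (Fin d) → EuclideanSpace ℝ (Fin d),
    C1Family F H₀ (extChartAt (𝓡 d) (γ₀ a) (γ₀ a)) ∧
    F H₀ (extChartAt (𝓡 d) (γ₀ a) (γ₀ a)) = extChartAt (𝓡 d) (γ₀ b) (γ₀ b) ∧
    ∀ᶠ q : HamiltonianSpace d M δ × EuclideanSpace ℝ (Fin d) in
      𝓝 (H₀, extChartAt (𝓡 d) (γ₀ a) (γ₀ a)), ∃ γ : ℝ → M,
        γ a = (extChartAt (𝓡 d) (γ₀ a)).symm q.2 ∧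
        γ b = (extChartAt (𝓡 d) (γ₀ b)).symm (F q.1 q.2) ∧
        IsTrajectoryOn σ (zeroExtend q.1.1) a b γ

/-- Both pieces use the preferred chart at `γ₀ b`, so their chart representations compose directly
and the trajectories concatenate. -/
theorem FlowNear.trans {σ : SymplecticForm d M} {H₀ : HamiltonianSpace d M δ} {a b c : ℝ}
    {γ₀ : ℝ → M} (hab : a ≤ b) (hbc : b ≤ c) (h₁ : FlowNear σ H₀ a b γ₀)
    (h₂ : FlowNear σ H₀ b c γ₀) : FlowNear σ H₀ a c γ₀ := by
  obtain ⟨F₁, c₁, e₁, t₁⟩ := h₁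
  obtain ⟨F₂, c₂, e₂, t₂⟩ := h₂
  rw [← e₁] at c₂ t₂ e₂
  refine ⟨fun H x => F₂ H (F₁ H x), c₂.comp c₁, e₂, ?_⟩
  have hc : ContinuousAt (fun q : HamiltonianSpace d M δ × EuclideanSpace ℝ (Fin d) =>
      (q.1, F₁ q.1 q.2)) (H₀, extChartAt (𝓡 d) (γ₀ a) (γ₀ a)) :=
    continuousAt_fst.prodMk c₁.continuousAt
  filter_upwards [t₁, hc.eventually t₂]
  rintro q ⟨γ, ga, gb, hγ⟩ ⟨γ', ga', gb', hγ'⟩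
  refine ⟨_, ?_, ?_, hγ.trans hab hbc hγ' (gb.trans ga'.symm)⟩
  · simp [hab, ga]
  · rcases hbc.eq_or_lt with rfl | hlt
    · simp only [le_refl, if_true]
      rw [gb, ← ga', gb']
    · simp [not_le.2 hlt, gb']

theorem mem_flowDomain_iff {σ : SymplecticForm d M} {H : HamiltonianSpace d M δ} {m : M} :
    m ∈ flowDomain σ H ↔ ∃ γ : ℝ → M, γ 0 = m ∧ IsTrajectoryOn σ (zeroExtend H.1) 0 δ γ :=
  exists_congr fun γ => and_congr_right fun _ => isHamiltonianTrajectory_iff σ H γ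

/-- Smoothness of the transition maps between preferred charts. -/
theorem contDiffOn_transition [IsManifold (𝓡 d) ∞ M] (x x' : M) :
    IsOpen ((extChartAt (𝓡 d) x').symm ≫ extChartAt (𝓡 d) x).source ∧
    ContDiffOn ℝ ∞ (fun y => extChartAt (𝓡 d) x ((extChartAt (𝓡 d) x').symm y))
      ((extChartAt (𝓡 d) x').symm ≫ extChartAt (𝓡 d) x).source := by
  refine ⟨?_, contDiffOn_ext_coord_change x x'⟩
  rw [PartialEquiv.trans_source]
  exact (continuousOn_extChartAt_symm x').isOpen_inter_preimage (isOpen_target x')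
    (isOpen_extChartAt_source x)

variable [IsManifold (𝓡 d) ∞ M]

theorem C1Family.transition {Λ : Type*} [TopologicalSpace Λ] {l₀ : Λ} (x x' : M) {m : M}
    (h : m ∈ (extChartAt (𝓡 d) x).source) (h' : m ∈ (extChartAt (𝓡 d) x').source) :
    C1Family (fun (_ : Λ) y => extChartAt (𝓡 d) x ((extChartAt (𝓡 d) x').symm y)) l₀
      (extChartAt (𝓡 d) x' m) := by
  refine C1Family.const (contDiffOn_transition x x').1 (contDiffOn_transition x x').2 ?_
  rw [PartialEquiv.trans_source]
  exact ⟨(extChartAt (𝓡 d) x').map_source h', by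
    rwa [mem_preimage, (extChartAt (𝓡 d) x').left_inv h']⟩

/-- Inside a single chart the ODE result applies; smooth transition maps on both sides replace that
chart by the preferred ones at the end points. -/
theorem FlowNear.of_chart (hδ : 0 < δ) {σ : SymplecticForm d M} {H₀ : HamiltonianSpace d M δ}
    {a b : ℝ} (hab : a < b) (hsub : Icc a b ⊆ Icc 0 δ) {γ₀ : ℝ → M}
    (hγ₀ : IsTrajectoryOn σ (zeroExtend H₀.1) a b γ₀) {x₀ : M}
    (hmem : ∀ t ∈ Icc a b, γ₀ t ∈ (extChartAt (𝓡 d) x₀).source) : FlowNear σ H₀ a b γ₀ := by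
  set φ := extChartAt (𝓡 d) x₀ with hφ
  have ha := hmem a (left_mem_Icc.2 hab.le)
  have hb := hmem b (right_mem_Icc.2 hab.le)
  obtain ⟨Θ, c, e, t, -⟩ := exists_flow_family (Λ := HamiltonianSpace d M δ) (l₀ := H₀)
    (X := fun H => chartField σ (zeroExtend H.1) x₀) hab (isOpen_target x₀)
    (fun H => (contDiffOn_chartField hδ σ H.2 x₀).mono (prod_mono_left hsub))
    (fun C hC hCc => (tendstoUniformlyOn_chartField hδ σ x₀ H₀ hCc hC).mono (prod_mono_left hsub))
    (fun C hC hCc => (tendstoUniformlyOn_fderiv_chartField hδ σ x₀ H₀ hCc hC).mono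
      (prod_mono_left hsub)) (hγ₀.solvesODE H₀.2 hsub hmem)
  set ψa := extChartAt (𝓡 d) (γ₀ a) with hψa
  set ψb := extChartAt (𝓡 d) (γ₀ b) with hψb
  have sa : γ₀ a ∈ ψa.source := mem_extChartAt_source _
  have sb : γ₀ b ∈ ψb.source := mem_extChartAt_source _
  have c₀ : C1Family (fun (_ : HamiltonianSpace d M δ) y => φ (ψa.symm y)) H₀ (ψa (γ₀ a)) :=
    C1Family.transition x₀ (γ₀ a) ha sa
  have c₂ : C1Family (fun (_ : HamiltonianSpace d M δ) y => ψb (φ.symm y)) H₀ (φ (γ₀ b)) :=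
    C1Family.transition (γ₀ b) x₀ sb hb
  have ea : φ (ψa.symm (ψa (γ₀ a))) = φ (γ₀ a) := by rw [ψa.left_inv sa]
  have c₁ : C1Family (fun H y => Θ H (φ (ψa.symm y))) H₀ (ψa (γ₀ a)) := c.comp_of_eq c₀ ea
  have e₁ : Θ H₀ (φ (ψa.symm (ψa (γ₀ a)))) = φ (γ₀ b) := by rw [ea, e]
  have c₃ : C1Family (fun H y => ψb (φ.symm (Θ H (φ (ψa.symm y))))) H₀ (ψa (γ₀ a)) :=
    c₂.comp_of_eq c₁ e₁
  refine ⟨fun H y => ψb (φ.symm (Θ H (φ (ψa.symm y)))), c₃, ?_, ?_⟩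
  · change ψb (φ.symm (Θ H₀ (φ (ψa.symm (ψa (γ₀ a)))))) = ψb (γ₀ b)
    rw [e₁, φ.left_inv hb]
  · have hcφ : ContinuousAt (fun q : HamiltonianSpace d M δ × EuclideanSpace ℝ (Fin d) =>
        (q.1, φ (ψa.symm q.2))) (H₀, ψa (γ₀ a)) := continuousAt_fst.prodMk c₀.continuousAt
    rw [← ea] at t
    have h1 : ∀ᶠ q : HamiltonianSpace d M δ × EuclideanSpace ℝ (Fin d) in 𝓝 (H₀, ψa (γ₀ a)),
        q.2 ∈ ψa.target ∧ ψa.symm q.2 ∈ φ.source := by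
      have h2 : ContinuousAt ψa.symm (ψa (γ₀ a)) := continuousAt_extChartAt_symm _
      have h3 : φ.source ∈ 𝓝 (ψa.symm (ψa (γ₀ a))) := by
        rw [ψa.left_inv sa]; exact (isOpen_extChartAt_source x₀).mem_nhds ha
      have h7 : ∀ᶠ y in 𝓝 (ψa (γ₀ a)), y ∈ ψa.target :=
        (isOpen_target (γ₀ a)).mem_nhds (ψa.map_source sa)
      have h8 : ∀ᶠ y in 𝓝 (ψa (γ₀ a)), ψa.symm y ∈ φ.source := h2.eventually h3
      exact (continuousAt_snd (p := (H₀, ψa (γ₀ a)))).eventually (h7.and h8)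
    have h4 : ∀ᶠ q : HamiltonianSpace d M δ × EuclideanSpace ℝ (Fin d) in 𝓝 (H₀, ψa (γ₀ a)),
        φ.symm (Θ q.1 (φ (ψa.symm q.2))) ∈ ψb.source := by
      have h5 : ContinuousAt φ.symm (Θ H₀ (φ (ψa.symm (ψa (γ₀ a))))) := by
        rw [e₁]; exact continuousAt_extChartAt_symm'' (φ.map_source hb)
      have h6 : ψb.source ∈ 𝓝 (φ.symm (Θ H₀ (φ (ψa.symm (ψa (γ₀ a)))))) := by
        rw [e₁, φ.left_inv hb]; exact (isOpen_extChartAt_source _).mem_nhds sb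
      exact c₁.continuousAt.eventually (h5.eventually h6)
    filter_upwards [hcφ.eventually t, h1, h4]
    rintro q ⟨α, αa, αb, hα⟩ ⟨q1, q2⟩ q3
    refine ⟨fun t => φ.symm (α t), ?_, ?_, hα.isTrajectoryOn q.1.2 hsub⟩
    · simp only [αa]
      exact φ.left_inv q2
    · simp only [αb]
      exact (ψb.left_inv q3).symm

/-- The flow of Hamiltonians close to `H₀`, near a trajectory of `H₀`. -/
theorem IsTrajectoryOn.flowNear (hδ : 0 < δ) {σ : SymplecticForm d M}
    {H₀ : HamiltonianSpace d M δ} {a b : ℝ} (hab : a < b) (hsub : Icc a b ⊆ Icc 0 δ) {γ₀ : ℝ → M}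
    (hγ₀ : IsTrajectoryOn σ (zeroExtend H₀.1) a b γ₀) : FlowNear σ H₀ a b γ₀ := by
  have hres : Continuous ((Icc a b).domRestrict γ₀) :=
    continuousOn_iff_continuous_domRestrict.1 hγ₀.continuousOn
  obtain ⟨t, t0, tm, ⟨m, hm⟩, ht⟩ := exists_monotone_Icc_subset_open_cover_Icc hab.le
    (c := fun x : M => (Icc a b).domRestrict γ₀ ⁻¹' (extChartAt (𝓡 d) x).source)
    (fun x => (isOpen_extChartAt_source x).preimage hres)
    (fun s _ => mem_iUnion.2 ⟨γ₀ s, mem_extChartAt_source _⟩)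
  -- The subdivision is only weakly monotone while the one-chart case needs an interval of positive
  -- length, hence the alternative `t n = a`.
  have key : ∀ n, (t n : ℝ) = a ∨ FlowNear σ H₀ a (t n) γ₀ := by
    intro n
    induction n with
    | zero => exact Or.inl t0
    | succ n ih =>
      have hle : (t n : ℝ) ≤ t (n + 1) := tm n.le_succ
      rcases hle.eq_or_lt with heq | hlt
      · rwa [← heq]
      · obtain ⟨x, hx⟩ := ht n
        have hsub' : Icc (t n : ℝ) (t (n + 1)) ⊆ Icc a b :=
          Icc_subset_Icc (t n).2.1 (t (n + 1)).2.2
        have h1 : FlowNear σ H₀ (t n) (t (n + 1)) γ₀ :=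
          FlowNear.of_chart hδ hlt (hsub'.trans hsub) (hγ₀.mono hsub') (x₀ := x) fun s hs =>
            hx (show (⟨s, hsub' hs⟩ : Icc a b) ∈ Icc (t n) (t (n + 1)) from hs)
        right
        rcases ih with h | h
        · rwa [h] at h1
        · exact h.trans (t n).2.1 hle h1
  rcases key m with h | h
  · rw [hm m le_rfl] at h; exact absurd h hab.ne'
  · rwa [hm m le_rfl] at h

/-- The set of agreement is closed since `M` is Hausdorff, and it extends to the right of each of
its points by uniqueness in a chart. -/
theorem IsTrajectoryOn.eqOn [T2Space M] (hδ : 0 < δ) {σ : SymplecticForm d M}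
    {H : HamiltonianSpace d M δ} {a b : ℝ} (hsub : Icc a b ⊆ Icc 0 δ) {γ γ' : ℝ → M}
    (hγ : IsTrajectoryOn σ (zeroExtend H.1) a b γ)
    (hγ' : IsTrajectoryOn σ (zeroExtend H.1) a b γ') (h : γ a = γ' a) : EqOn γ γ' (Icc a b) := by
  refine IsClosed.Icc_subset_of_forall_mem_nhdsWithin (s := {t | γ t = γ' t}) ?_ h ?_
  · have := (hγ.continuousOn.prodMk hγ'.continuousOn).preimage_isClosed_of_isClosed isClosed_Icc
      isClosed_diagonal
    rwa [inter_comm] at this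
  · rintro t ⟨htt, ht⟩
    have htt : γ t = γ' t := htt
    have hc : ∀ β : ℝ → M, IsTrajectoryOn σ (zeroExtend H.1) a b β → β t = γ t →
        ∀ᶠ s in 𝓝[Icc t b] t, β s ∈ (extChartAt (𝓡 d) (γ t)).source := fun β hβ hβt =>
      ((hβ.continuousOn t ⟨ht.1, ht.2.le⟩).mono (Icc_subset_Icc_left ht.1)).eventually
        ((isOpen_extChartAt_source _).mem_nhds (by rw [hβt]; exact mem_extChartAt_source _))
    have hev := (hc γ hγ rfl).and (hc γ' hγ' htt.symm)
    rw [nhdsWithin_Icc_eq_nhdsGE ht.2] at hev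
    obtain ⟨u, hu, hut⟩ := mem_nhdsGE_iff_exists_Icc_subset.1 hev
    set b' := min u b with hb'
    have htb' : t < b' := lt_min hu ht.2
    have hsub1 : Icc t b' ⊆ Icc a b := Icc_subset_Icc ht.1 (min_le_right _ _)
    have hin : ∀ s ∈ Icc t b', γ s ∈ (extChartAt (𝓡 d) (γ t)).source ∧
        γ' s ∈ (extChartAt (𝓡 d) (γ t)).source := fun s hs =>
      hut ⟨hs.1, hs.2.trans (min_le_left _ _)⟩
    have heq := SolvesODE.eqOn htb' (isOpen_target (γ t))
      ((contDiffOn_chartField hδ σ H.2 (γ t)).mono (prod_mono_left (hsub1.trans hsub)))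
      ((hγ.mono hsub1).solvesODE H.2 (hsub1.trans hsub) fun s hs => (hin s hs).1)
      ((hγ'.mono hsub1).solvesODE H.2 (hsub1.trans hsub) fun s hs => (hin s hs).2)
      (by simp only [htt])
    filter_upwards [Icc_mem_nhdsGT htb'] with s hs
    exact (extChartAt (𝓡 d) (γ t)).injOn (hin s hs).1 (hin s hs).2 (heq hs)

theorem hamiltonianFlow_eq [T2Space M] (hδ : 0 < δ) {σ : SymplecticForm d M}
    {H : HamiltonianSpace d M δ} {γ : ℝ → M} (hγ : IsTrajectoryOn σ (zeroExtend H.1) 0 δ γ) :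
    γ 0 ∈ flowDomain σ H ∧ hamiltonianFlow σ H (γ 0) = γ δ := by
  have h : γ 0 ∈ flowDomain σ H := ⟨γ, rfl, (isHamiltonianTrajectory_iff σ H γ).2 hγ⟩
  refine ⟨h, ?_⟩
  rw [hamiltonianFlow, dif_pos h]
  exact ((isHamiltonianTrajectory_iff σ H _).1 h.choose_spec.2).eqOn hδ subset_rfl hγ
    h.choose_spec.1 (right_mem_Icc.2 hδ.le)

/-- The domain of the flow is open, jointly in the Hamiltonian and in the initial point. -/
theorem eventually_mem_flowDomain (hδ : 0 < δ) {σ : SymplecticForm d M}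
    {H₀ : HamiltonianSpace d M δ} {m₀ : M} (hm₀ : m₀ ∈ flowDomain σ H₀) :
    ∀ᶠ q : HamiltonianSpace d M δ × M in 𝓝 (H₀, m₀), q.2 ∈ flowDomain σ q.1 := by
  obtain ⟨γ₀, rfl, hγ₀⟩ := mem_flowDomain_iff.1 hm₀
  obtain ⟨F, -, -, ht⟩ := hγ₀.flowNear hδ hδ subset_rfl
  have hc : ContinuousAt (fun q : HamiltonianSpace d M δ × M => (q.1, extChartAt (𝓡 d) (γ₀ 0) q.2))
      (H₀, γ₀ 0) := continuousAt_fst.prodMk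
        (ContinuousAt.comp (x := (H₀, γ₀ 0)) (continuousAt_extChartAt (γ₀ 0)) continuousAt_snd)
  filter_upwards [hc.eventually ht, continuousAt_snd.eventually
    ((isOpen_extChartAt_source (I := 𝓡 d) (γ₀ 0)).mem_nhds (mem_extChartAt_source _))]
  rintro q ⟨γ, ga, -, hγ⟩ hq
  refine mem_flowDomain_iff.2 ⟨γ, ?_, hγ⟩
  rw [ga]
  exact (extChartAt (𝓡 d) (γ₀ 0)).left_inv hq

end FlowNear

/-! ## Families of vector fields with a linear control -/

section ControlledODE

theorem C1Family.prodMk {Λ E F G : Type*} [TopologicalSpace Λ] [NormedAddCommGroup E]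
    [NormedSpace ℝ E] [NormedAddCommGroup F] [NormedSpace ℝ F] [NormedAddCommGroup G]
    [NormedSpace ℝ G] {l₀ : Λ} {Θ : Λ → E → F} {Ψ : Λ → E → G} {x₀ : E} (hΘ : C1Family Θ l₀ x₀)
    (hΨ : C1Family Ψ l₀ x₀) : C1Family (fun l x => (Θ l x, Ψ l x)) l₀ x₀ := by
  refine ⟨hΘ.continuousAt.prodMk hΨ.continuousAt, ?_, ?_⟩
  · filter_upwards [hΘ.contDiffAt, hΨ.contDiffAt] with q h1 h2
    exact h1.prodMk h2
  · have h3 : ContinuousAt (fun q : Λ × E => ContinuousLinearMap.prodₗᵢ ℝ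
        (fderiv ℝ (Θ q.1) q.2, fderiv ℝ (Ψ q.1) q.2)) (l₀, x₀) :=
      (ContinuousLinearMap.prodₗᵢ ℝ).continuous.continuousAt.comp
        (hΘ.continuousAt_fderiv.prodMk hΨ.continuousAt_fderiv)
    refine h3.congr ?_
    filter_upwards [hΘ.contDiffAt, hΨ.contDiffAt] with q h1 h2
    exact (DifferentiableAt.fderiv_prodMk (h1.differentiableAt (by simp))
      (h2.differentiableAt (by simp))).symm

variable {E S : Type} [NormedAddCommGroup E] [NormedSpace ℝ E] [NormedAddCommGroup S]
  [NormedSpace ℝ S]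

/-- The vector field `X + B s` on the phase space `E × S`, in which the control `s` is constant. -/
def controlledField (X : ℝ → E → E) (B : ℝ → E → S →L[ℝ] E) (t : ℝ) (p : E × S) : E × S :=
  (X t p.1 + B t p.1 p.2, 0)

theorem contDiffOn_controlledField {X : ℝ → E → E} {B : ℝ → E → S →L[ℝ] E} {Ω : Set E} {a b : ℝ}
    (hX : ContDiffOn ℝ ∞ (Function.uncurry X) (Icc a b ×ˢ Ω))
    (hB : ContDiffOn ℝ ∞ (Function.uncurry B) (Icc a b ×ˢ Ω)) :
    ContDiffOn ℝ ∞ (Function.uncurry (controlledField X B)) (Icc a b ×ˢ (Ω ×ˢ univ)) := by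
  have hp : ContDiffOn ℝ ∞ (fun p : ℝ × (E × S) => (p.1, p.2.1)) (Icc a b ×ˢ (Ω ×ˢ univ)) :=
    (contDiff_fst.prodMk (contDiff_fst.comp contDiff_snd)).contDiffOn
  have hm : MapsTo (fun p : ℝ × (E × S) => (p.1, p.2.1)) (Icc a b ×ˢ (Ω ×ˢ univ))
      (Icc a b ×ˢ Ω) := fun p hp => ⟨hp.1, hp.2.1⟩
  exact ((hX.comp hp hm).add ((hB.comp hp hm).clm_apply
    (contDiff_snd.comp contDiff_snd).contDiffOn)).prodMk contDiffOn_const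

theorem hasFDerivAt_controlledField {X : ℝ → E → E} {B : ℝ → E → S →L[ℝ] E} {Ω : Set E} {a b : ℝ}
    (hΩ : IsOpen Ω) (hX : ContDiffOn ℝ ∞ (Function.uncurry X) (Icc a b ×ˢ Ω))
    (hB : ContDiffOn ℝ ∞ (Function.uncurry B) (Icc a b ×ˢ Ω)) {t : ℝ} (ht : t ∈ Icc a b)
    {p : E × S} (hp : p.1 ∈ Ω) :
    HasFDerivAt (controlledField X B t)
      (((fderiv ℝ (X t) p.1).comp (ContinuousLinearMap.fst ℝ E S) +
        ((B t p.1).comp (ContinuousLinearMap.snd ℝ E S) +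
          ((fderiv ℝ (B t) p.1).comp (ContinuousLinearMap.fst ℝ E S)).flip p.2)).prod 0) p := by
  have h1 := (hasFDerivAt_slice hΩ hX ht hp).differentiableAt.hasFDerivAt
  have h2 := (hasFDerivAt_slice hΩ hB ht hp).differentiableAt.hasFDerivAt
  have h1' := HasFDerivAt.comp p h1 (hasFDerivAt_fst (𝕜 := ℝ) (p := p))
  have h2' := HasFDerivAt.comp p h2 (hasFDerivAt_fst (𝕜 := ℝ) (p := p))
  exact (h1'.add (h2'.clm_apply (hasFDerivAt_snd (𝕜 := ℝ) (p := p)))).prodMk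
    (hasFDerivAt_const 0 p)

/-- A version of `exists_flow_family` with an additional control parameter `s`. -/
theorem exists_controlled_flow_family [FiniteDimensional ℝ E] [FiniteDimensional ℝ S] {Λ : Type*} [TopologicalSpace Λ] {l₀ : Λ} {X : Λ → ℝ → E → E}
    {B : ℝ → E → S →L[ℝ] E} {Ω : Set E} {a b : ℝ} (hab : a < b) (hΩ : IsOpen Ω)
    (hX : ∀ l, ContDiffOn ℝ ∞ (Function.uncurry (X l)) (Icc a b ×ˢ Ω))
    (hB : ContDiffOn ℝ ∞ (Function.uncurry B) (Icc a b ×ˢ Ω))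
    (hconv : ∀ C ⊆ Ω, IsCompact C → TendstoUniformlyOn (fun l => Function.uncurry (X l))
      (Function.uncurry (X l₀)) (𝓝 l₀) (Icc a b ×ˢ C))
    (hconv' : ∀ C ⊆ Ω, IsCompact C → TendstoUniformlyOn (fun l p => fderiv ℝ (X l p.1) p.2)
      (fun p => fderiv ℝ (X l₀ p.1) p.2) (𝓝 l₀) (Icc a b ×ˢ C))
    {α₀ : ℝ → E} (hα₀ : SolvesODE (X l₀) Ω a b α₀) :
    ∃ Θ : Λ → E × S → E, C1Family Θ l₀ (α₀ a, 0) ∧ Θ l₀ (α₀ a, 0) = α₀ b ∧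
      (∀ᶠ q : Λ × (E × S) in 𝓝 (l₀, (α₀ a, 0)), ∃ α : ℝ → E, α a = q.2.1 ∧ α b = Θ q.1 q.2 ∧
        SolvesODE (fun t y => X q.1 t y + B t y q.2.2) Ω a b α) ∧
      ∀ (s : S) (W : ℝ → E), W a = 0 → (∀ t ∈ Icc a b,
        HasDerivWithinAt W (fderiv ℝ (X l₀ t) (α₀ t) (W t) + B t (α₀ t) s) (Icc a b) t) →
        fderiv ℝ (Θ l₀) (α₀ a, 0) (0, s) = W b := by
  have hC1 : ∀ C ⊆ Ω ×ˢ (univ : Set S), IsCompact C → IsCompact (Prod.fst '' C) ∧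
      Prod.fst '' C ⊆ Ω := fun C hC hCc =>
    ⟨hCc.image continuous_fst, image_subset_iff.2 fun p hp => (hC hp).1⟩
  have hsol₀ : SolvesODE (controlledField (X l₀) B) (Ω ×ˢ univ) a b fun t => (α₀ t, (0 : S)) := by
    intro t ht
    refine ⟨⟨(hα₀ t ht).1, mem_univ _⟩, ?_⟩
    have h1 := (hα₀ t ht).2.prodMk (hasDerivWithinAt_const t (Icc a b) (0 : S))
    simpa [controlledField] using h1
  obtain ⟨Θ, c, e, h, hW⟩ := exists_flow_family (X := fun l => controlledField (X l) B) hab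
    (hΩ.prod isOpen_univ) (fun l => contDiffOn_controlledField (hX l) hB)
    (fun C hC hCc => by
      rw [Metric.tendstoUniformlyOn_iff]
      intro ε hε
      filter_upwards [Metric.tendstoUniformlyOn_iff.1 (hconv _ (hC1 C hC hCc).2 (hC1 C hC hCc).1)
        ε hε] with l hl
      rintro ⟨t, p⟩ ⟨ht, hp⟩
      have := hl (t, p.1) ⟨ht, mem_image_of_mem _ hp⟩
      simp only [Function.uncurry, controlledField, Prod.dist_eq, dist_self, dist_add_right] at this ⊢
      exact max_lt this hε)
    (fun C hC hCc => by
      rw [Metric.tendstoUniformlyOn_iff]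
      intro ε hε
      filter_upwards [Metric.tendstoUniformlyOn_iff.1 (hconv' _ (hC1 C hC hCc).2 (hC1 C hC hCc).1)
        (ε / 2) (half_pos hε)] with l hl
      rintro ⟨t, p⟩ ⟨ht, hp⟩
      have h1 := hl (t, p.1) ⟨ht, mem_image_of_mem _ hp⟩
      have hpΩ := (hC hp).1
      dsimp only at h1 ⊢
      rw [(hasFDerivAt_controlledField hΩ (hX l) hB ht hpΩ).fderiv,
        (hasFDerivAt_controlledField hΩ (hX l₀) hB ht hpΩ).fderiv, dist_eq_norm]
      rw [dist_eq_norm] at h1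
      refine (ContinuousLinearMap.opNorm_le_bound _ (half_pos hε).le fun v => ?_).trans_lt
        (half_lt_self hε)
      have h2 : ‖(fderiv ℝ (X l₀ t) p.1 - fderiv ℝ (X l t) p.1) v.1‖ ≤ ε / 2 * ‖v‖ :=
        (ContinuousLinearMap.le_opNorm _ _).trans
          (mul_le_mul h1.le (norm_fst_le v) (norm_nonneg _) (half_pos hε).le)
      simpa [Prod.norm_def] using! h2) hsol₀
  have cfst : C1Family (fun (_ : Λ) (p : E × S) => p.1) l₀ (Θ l₀ (α₀ a, 0)) :=
    C1Family.const isOpen_univ contDiff_fst.contDiffOn (mem_univ _)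
  refine ⟨fun l p => (Θ l p).1, cfst.comp c, congrArg Prod.fst e, ?_, ?_⟩
  · filter_upwards [h]
    rintro q ⟨α, αa, αb, hα⟩
    -- The control component has zero velocity, so the control is a genuine constant parameter along
    -- each solution.
    have hsnd : ∀ t ∈ Icc a b, (α t).2 = q.2.2 := by
      intro t ht
      have h1 : ∀ t ∈ Icc a b, HasDerivWithinAt (fun t => (α t).2) 0 (Icc a b) t := fun t ht =>
        (ContinuousLinearMap.snd ℝ E S).hasFDerivAt.comp_hasDerivWithinAt t (hα t ht).2
      rw [constant_of_has_deriv_right_zero (f := fun t => (α t).2)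
        (fun t ht => (h1 t ht).continuousWithinAt)
        (fun t ht => (h1 t ⟨ht.1, ht.2.le⟩).mono_of_mem_nhdsWithin
          (Icc_mem_nhdsGE_of_mem ht)) t ht, αa]
    refine ⟨fun t => (α t).1, by simp [αa], by simp [αb], fun t ht => ⟨(hα t ht).1.1, ?_⟩⟩
    have h2 : HasDerivWithinAt (fun t => (α t).1) _ (Icc a b) t :=
      (ContinuousLinearMap.fst ℝ E S).hasFDerivAt.comp_hasDerivWithinAt t (hα t ht).2
    rw [← hsnd t ht]
    exact h2
  · intro s W hWa hWd
    -- The derivative is taken at zero control, where the space derivative of `B` drops out. The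
    -- linearization is just `W' = DX W + B s`.
    have h1 := hW (fun t => (W t, s)) fun t ht => by
      rw [(hasFDerivAt_controlledField hΩ (hX l₀) hB ht (p := (α₀ t, 0)) (hα₀ t ht).1).fderiv]
      have h2 := (hWd t ht).prodMk (hasDerivWithinAt_const t (Icc a b) s)
      simpa using! h2
    have h3 : fderiv ℝ (fun p => (Θ l₀ p).1) (α₀ a, 0) =
        (ContinuousLinearMap.fst ℝ E S).comp (fderiv ℝ (Θ l₀) (α₀ a, 0)) :=
      ((ContinuousLinearMap.fst ℝ E S).hasFDerivAt.comp _
        (c.contDiffAt.self_of_nhds.differentiableAt (by simp)).hasFDerivAt).fderiv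
    rw [h3, ← hWa]
    simp [h1]

end ControlledODE

/-! ## Perturbations of Hamiltonians moving the end point of a trajectory -/

section Perturbation

variable {d : ℕ} {M : Type*} [TopologicalSpace M] [ChartedSpace (EuclideanSpace ℝ (Fin d)) M]
  {δ : ℝ} {S : Type} [NormedAddCommGroup S] [NormedSpace ℝ S]

/-- The Hamiltonian `H + Φ s`, for a family `Φ s` depending linearly on `s`. -/
noncomputable def HamiltonianSpace.perturb (H : HamiltonianSpace d M δ) {Φ : ℝ → M → S →L[ℝ] ℝ}
    (hΦ : ContMDiffOn (𝓘(ℝ, ℝ).prod (𝓡 d)) 𝓘(ℝ, S →L[ℝ] ℝ) ∞ (fun p : ℝ × M => Φ p.1 p.2)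
      (Icc 0 δ ×ˢ univ)) (s : S) : HamiltonianSpace d M δ :=
  HamiltonianSpace.ofFun (fun t x => zeroExtend H.1 t x + Φ t x s)
    (H.2.add (hΦ.clm_apply contMDiffOn_const))

theorem HamiltonianSpace.zeroExtend_perturb (H : HamiltonianSpace d M δ) {Φ : ℝ → M → S →L[ℝ] ℝ}
    (hΦ : ContMDiffOn (𝓘(ℝ, ℝ).prod (𝓡 d)) 𝓘(ℝ, S →L[ℝ] ℝ) ∞ (fun p : ℝ × M => Φ p.1 p.2)
      (Icc 0 δ ×ˢ univ)) (s : S) {t : ℝ} (ht : t ∈ Icc 0 δ) :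
    zeroExtend (H.perturb hΦ s).1 t = fun x => zeroExtend H.1 t x + Φ t x s :=
  HamiltonianSpace.zeroExtend_ofFun _ ht

theorem HamiltonianSpace.chartDeriv_ofFun {f : ℝ → M → ℝ}
    (hf : ContMDiffOn (𝓘(ℝ, ℝ).prod (𝓡 d)) 𝓘(ℝ, ℝ) ∞ (fun p : ℝ × M => f p.1 p.2)
      (Icc 0 δ ×ˢ univ)) (k : ℕ) (x₀ : M) {p : ℝ × EuclideanSpace ℝ (Fin d)}
    (hp : p ∈ chartDomain d δ x₀) :
    (HamiltonianSpace.ofFun f hf).chartDeriv k x₀ p =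
      iteratedFDerivWithin ℝ k (Function.uncurry (inChart f x₀)) (chartDomain d δ x₀) p := by
  refine iteratedFDerivWithin_congr (fun q hq => ?_) hp k
  rw [zeroExtend_ofFun hf hq.1]
  rfl

/-- The linear functionals whose Hamiltonian vector field along the curve `α` moves it in the
direction `β s`. -/
noncomputable def controlCoefficient (σ : SymplecticForm d M) (x₀ : M)
    (X : ℝ → EuclideanSpace ℝ (Fin d) → EuclideanSpace ℝ (Fin d))
    (α : ℝ → EuclideanSpace ℝ (Fin d)) (β : ℝ → ℝ) (t : ℝ) :
    EuclideanSpace ℝ (Fin d) →L[ℝ] EuclideanSpace ℝ (Fin d) →L[ℝ] ℝ :=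
  (flatMap _ (chartForm σ.form x₀ (α t))).comp
    (deriv β t • ContinuousLinearMap.id ℝ _ - β t • fderiv ℝ (X t) (α t))

/-- Past `a` the coefficient is smooth because solutions of smooth equations are smooth. Before `c`
it vanishes with `β`, and since `a < c` the two regions overlap. -/
theorem contDiffOn_controlCoefficient {a b c δ : ℝ} (ha : a < c) (hab : a < b) (hbδ : b = δ)
    (σ : SymplecticForm d M) (x₀ : M)
    {X : ℝ → EuclideanSpace ℝ (Fin d) → EuclideanSpace ℝ (Fin d)}
    (hX : ContDiffOn ℝ ∞ (Function.uncurry X) (Icc a b ×ˢ (extChartAt (𝓡 d) x₀).target))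
    {α : ℝ → EuclideanSpace ℝ (Fin d)} (hα : SolvesODE X (extChartAt (𝓡 d) x₀).target a b α)
    {β : ℝ → ℝ} (hβ : ContDiff ℝ ∞ β) (hβ0 : ∀ t ≤ c, β t = 0) :
    ContDiffOn ℝ ∞ (controlCoefficient σ x₀ X α β) (Icc 0 δ) := by
  subst hbδ
  have hα' : ContDiffOn ℝ ∞ α (Icc a b) := ODE.contDiffOn_enat_Icc_of_hasDerivWithinAt
    (n := (⊤ : ℕ∞)) hX (fun t ht => (hα t ht).2) fun t ht => (hα t ht).1
  have hβ' : ContDiff ℝ ∞ (deriv β) := (contDiff_infty_iff_deriv.1 hβ).2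
  have h1 : ContDiffOn ℝ ∞ (controlCoefficient σ x₀ X α β) (Icc a b) := by
    refine ContDiffOn.clm_comp ((contDiff_flatMap _).comp_contDiffOn
      ((σ.smooth x₀).comp hα' fun t ht => (hα t ht).1)) ?_
    refine (hβ'.contDiffOn.smul contDiffOn_const).sub (hβ.contDiffOn.smul ?_)
    exact (contDiffOn_fderiv_slice hab (isOpen_target x₀) hX).comp (contDiffOn_id.prodMk hα')
      fun t ht => ⟨ht, (hα t ht).1⟩
  intro t ht
  rcases lt_or_ge t c with htc | htc
  · have h2 : controlCoefficient σ x₀ X α β =ᶠ[𝓝 t] fun _ => 0 := by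
      filter_upwards [Iio_mem_nhds htc] with u hu
      have h3 : β =ᶠ[𝓝 u] fun _ => 0 := by
        filter_upwards [Iio_mem_nhds hu] with v hv using hβ0 v (le_of_lt hv)
      have h4 : β u = 0 := h3.self_of_nhds
      have h5 : deriv β u = 0 := by rw [h3.deriv_eq, deriv_const]
      refine ContinuousLinearMap.ext fun s => ?_
      change flatMap _ (chartForm σ.form x₀ (α u)) (deriv β u • s - β u • fderiv ℝ (X u) (α u) s) = 0
      rw [h4, h5, zero_smul, zero_smul, sub_zero, map_zero]
    exact (contDiffAt_const.congr_of_eventuallyEq h2).contDiffWithinAt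
  · refine (h1 t ⟨(ha.trans_le htc).le, ht.2⟩).mono_of_mem_nhdsWithin ?_
    filter_upwards [self_mem_nhdsWithin, mem_nhdsWithin_of_mem_nhds (Ioi_mem_nhds
      (ha.trans_le htc))] with u hu hu'
    exact ⟨le_of_lt hu', hu.2⟩

variable [IsManifold (𝓡 d) ∞ M]

/-- On a compact set each chart derivative of the perturbation is linear in `s`, hence bounded by a
constant times `‖s‖`. -/
theorem HamiltonianSpace.tendsto_perturb (hδ : 0 < δ) (H : HamiltonianSpace d M δ)
    {Φ : ℝ → M → S →L[ℝ] ℝ}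
    (hΦ : ContMDiffOn (𝓘(ℝ, ℝ).prod (𝓡 d)) 𝓘(ℝ, S →L[ℝ] ℝ) ∞ (fun p : ℝ × M => Φ p.1 p.2)
      (Icc 0 δ ×ˢ univ)) :
    Filter.Tendsto (fun s => H.perturb hΦ s) (𝓝 0) (𝓝 H) := by
  refine tendsto_nhds_iff.2 fun k x₀ K hK hKs => ?_
  have hu : UniqueDiffOn ℝ (chartDomain d δ x₀) := uniqueDiffOn_Icc_prod hδ (isOpen_target x₀)
  have hΦc := contDiffOn_inChart hΦ x₀
  obtain ⟨C, hC⟩ := hK.exists_bound_of_continuousOn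
    ((hΦc.continuousOn_iteratedFDerivWithin (m := k) (by exact_mod_cast le_top) hu).mono hKs)
  rw [Metric.tendstoUniformlyOn_iff]
  intro ε hε
  have hC' : 0 < max C 0 + 1 := by positivity
  filter_upwards [Metric.ball_mem_nhds (0 : S) (div_pos hε hC')] with s hs p hp
  rw [perturb, chartDeriv_ofFun _ k x₀ (hKs hp)]
  have hL : Function.uncurry (inChart (d := d) (fun t x => Φ t x s) x₀) =
      ContinuousLinearMap.apply ℝ ℝ s ∘ Function.uncurry (inChart Φ x₀) := rfl
  have hΦp : ContDiffWithinAt ℝ k (Function.uncurry (inChart Φ x₀)) (chartDomain d δ x₀) p :=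
    (hΦc p (hKs hp)).of_le (by exact_mod_cast le_top)
  have h1 : iteratedFDerivWithin ℝ k
      (Function.uncurry (inChart (fun t x => zeroExtend H.1 t x + Φ t x s) x₀))
      (chartDomain d δ x₀) p = H.chartDeriv k x₀ p +
      (ContinuousLinearMap.apply ℝ ℝ s).compContinuousMultilinearMap
        (iteratedFDerivWithin ℝ k (Function.uncurry (inChart Φ x₀)) (chartDomain d δ x₀) p) := by
    rw [← ContinuousLinearMap.iteratedFDerivWithin_comp_left (n := k)
      (ContinuousLinearMap.apply ℝ ℝ s)
      hΦp hu (hKs hp) le_rfl, ← hL]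
    refine iteratedFDerivWithin_add_apply
      (((contDiffOn_inChart H.2 x₀) p (hKs hp)).of_le (by exact_mod_cast le_top)) ?_ hu (hKs hp)
    exact (ContinuousLinearMap.apply ℝ ℝ s).contDiff.contDiffAt.comp_contDiffWithinAt p hΦp
  rw [h1, dist_self_add_right]
  refine (ContinuousLinearMap.norm_compContinuousMultilinearMap_le _ _).trans_lt ?_
  have h2 : ‖ContinuousLinearMap.apply ℝ ℝ s‖ ≤ ‖s‖ := by
    refine ContinuousLinearMap.opNorm_le_bound _ (norm_nonneg _) fun f => ?_
    rw [mul_comm]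
    exact f.le_opNorm s
  rw [mem_ball_zero_iff, lt_div_iff₀ hC'] at hs
  refine lt_of_le_of_lt ?_ hs
  gcongr
  exact (hC p hp).trans ((le_max_left _ _).trans (by linarith))

theorem chartField_perturb (σ : SymplecticForm d M) (H : HamiltonianSpace d M δ)
    {Φ : ℝ → M → S →L[ℝ] ℝ}
    (hΦ : ContMDiffOn (𝓘(ℝ, ℝ).prod (𝓡 d)) 𝓘(ℝ, S →L[ℝ] ℝ) ∞ (fun p : ℝ × M => Φ p.1 p.2)
      (Icc 0 δ ×ˢ univ)) (s : S) (x₀ : M) {t : ℝ} (ht : t ∈ Icc 0 δ)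
    {y : EuclideanSpace ℝ (Fin d)} (hy : y ∈ (extChartAt (𝓡 d) x₀).target)
    {ℓ : EuclideanSpace ℝ (Fin d) →L[ℝ] ℝ}
    (hℓ : (fun z => Φ t ((extChartAt (𝓡 d) x₀).symm z) s) =ᶠ[𝓝 y] ℓ) :
    chartField σ (zeroExtend (H.perturb hΦ s).1) x₀ t y =
      chartField σ (zeroExtend H.1) x₀ t y + sharp σ x₀ y ℓ := by
  have h1 : HasFDerivAt (fun z => Φ t ((extChartAt (𝓡 d) x₀).symm z) s) ℓ y :=
    ℓ.hasFDerivAt.congr_of_eventuallyEq hℓ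
  have h2 := (hasFDerivAt_slice (isOpen_target x₀) (contDiffOn_inChart H.2 x₀) ht
    hy).differentiableAt.hasFDerivAt
  have h3 : inChart (zeroExtend (H.perturb hΦ s).1) x₀ t = fun z =>
      inChart (zeroExtend H.1) x₀ t z + Φ t ((extChartAt (𝓡 d) x₀).symm z) s := by
    ext z
    simp only [inChart]
    rw [H.zeroExtend_perturb hΦ s ht]
  have h4 : fderiv ℝ (fun z => inChart (zeroExtend H.1) x₀ t z +
      Φ t ((extChartAt (𝓡 d) x₀).symm z) s) y =
      fderiv ℝ (inChart (zeroExtend H.1) x₀ t) y + ℓ := (h2.add h1).fderiv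
  rw [chartField, h3, h4, map_add]
  rfl

/-- The coefficient is the variational equation `W' = DX W + sharp (A s)` solved for `A`, with `W =
β s` prescribed. -/
theorem sharp_controlCoefficient (σ : SymplecticForm d M) (x₀ : M)
    (X : ℝ → EuclideanSpace ℝ (Fin d) → EuclideanSpace ℝ (Fin d))
    (α : ℝ → EuclideanSpace ℝ (Fin d)) (β : ℝ → ℝ) {t : ℝ}
    (ht : α t ∈ (extChartAt (𝓡 d) x₀).target) (s : EuclideanSpace ℝ (Fin d)) :
    sharp σ x₀ (α t) (controlCoefficient σ x₀ X α β t s) =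
      deriv β t • s - fderiv ℝ (X t) (α t) (β t • s) := by
  symm
  rw [eq_sharp_iff σ x₀ ht, map_smul]
  rfl

/-- Near a trajectory of `H₀` there is a linear family of perturbations, supported in time near `δ`,
which moves the end point of the trajectory in all directions. -/
theorem exists_control [T2Space M] (hδ : 0 < δ) {σ : SymplecticForm d M}
    {H₀ : HamiltonianSpace d M δ} {γ₀ : ℝ → M} (hγ₀ : IsTrajectoryOn σ (zeroExtend H₀.1) 0 δ γ₀) :
    ∃ (Φ : ℝ → M → EuclideanSpace ℝ (Fin d) →L[ℝ] ℝ)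
      (hΦ : ContMDiffOn (𝓘(ℝ, ℝ).prod (𝓡 d)) 𝓘(ℝ, EuclideanSpace ℝ (Fin d) →L[ℝ] ℝ) ∞
        (fun p : ℝ × M => Φ p.1 p.2) (Icc 0 δ ×ˢ univ))
      (F : HamiltonianSpace d M δ → EuclideanSpace ℝ (Fin d) × EuclideanSpace ℝ (Fin d) →
        EuclideanSpace ℝ (Fin d)),
      C1Family F H₀ (extChartAt (𝓡 d) (γ₀ 0) (γ₀ 0), 0) ∧
      F H₀ (extChartAt (𝓡 d) (γ₀ 0) (γ₀ 0), 0) = extChartAt (𝓡 d) (γ₀ δ) (γ₀ δ) ∧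
      (∀ᶠ q : HamiltonianSpace d M δ × (EuclideanSpace ℝ (Fin d) × EuclideanSpace ℝ (Fin d)) in
        𝓝 (H₀, (extChartAt (𝓡 d) (γ₀ 0) (γ₀ 0), 0)), ∃ γ : ℝ → M,
          γ 0 = (extChartAt (𝓡 d) (γ₀ 0)).symm q.2.1 ∧
          γ δ = (extChartAt (𝓡 d) (γ₀ δ)).symm (F q.1 q.2) ∧
          IsTrajectoryOn σ (zeroExtend (q.1.perturb hΦ q.2.2).1) 0 δ γ) ∧
      ∀ s, fderiv ℝ (F H₀) (extChartAt (𝓡 d) (γ₀ 0) (γ₀ 0), 0) (0, s) = s := by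
  set V := EuclideanSpace ℝ (Fin d) with hV
  set x₀ := γ₀ δ with hx₀
  set φ := extChartAt (𝓡 d) x₀ with hφ
  have hχ : Nonempty (SmoothBumpFunction (𝓡 d) x₀) := inferInstance
  obtain ⟨χ⟩ := hχ
  -- a neighbourhood of the end point on which the cutoff is constant
  obtain ⟨U, hUsub, hUo, hxU⟩ : ∃ U ⊆ {x | x ∈ φ.source ∧ χ x = 1}, IsOpen U ∧ x₀ ∈ U :=
    mem_nhds_iff.1 (Filter.inter_mem (extChartAt_source_mem_nhds x₀) χ.eventuallyEq_one)
  obtain ⟨a, ha0, haδ, haU⟩ : ∃ a, 0 < a ∧ a < δ ∧ ∀ t ∈ Icc a δ, γ₀ t ∈ U := by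
    have h1 : ∀ᶠ t in 𝓝[Icc 0 δ] δ, γ₀ t ∈ U :=
      (hγ₀.continuousOn δ (right_mem_Icc.2 hδ.le)).eventually (hUo.mem_nhds hxU)
    rw [nhdsWithin_Icc_eq_nhdsLE hδ] at h1
    obtain ⟨l, hl, hlt⟩ := mem_nhdsLE_iff_exists_Icc_subset.1 h1
    exact ⟨max l (δ / 2), lt_max_of_lt_right (half_pos hδ), max_lt hl (half_lt_self hδ),
      fun t ht => hlt ⟨(le_max_left _ _).trans ht.1, ht.2⟩⟩
  have hsub : Icc a δ ⊆ Icc 0 δ := Icc_subset_Icc_left ha0.le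
  have hsub' : Icc 0 a ⊆ Icc 0 δ := Icc_subset_Icc_right haδ.le
  set Ω : Set V := φ.target ∩ φ.symm ⁻¹' U with hΩ
  have hΩo : IsOpen Ω :=
    (continuousOn_extChartAt_symm x₀).isOpen_inter_preimage (isOpen_target x₀) hUo
  set X : HamiltonianSpace d M δ → ℝ → V → V := fun H => chartField σ (zeroExtend H.1) x₀ with hX
  set α₀ : ℝ → V := fun t => φ (γ₀ t) with hα₀
  have hsolφ : SolvesODE (X H₀) φ.target a δ α₀ :=
    (hγ₀.mono hsub).solvesODE H₀.2 hsub fun t ht => (hUsub (haU t ht)).1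
  have hsol : SolvesODE (X H₀) Ω a δ α₀ := hsolφ.congr_field fun t ht =>
    ⟨⟨(hsolφ t ht).1, by
      rw [mem_preimage, φ.left_inv (hUsub (haU t ht)).1]; exact haU t ht⟩, rfl⟩
  -- the control
  set c := (a + δ) / 2 with hc
  have hac : a < c := by rw [hc]; linarith
  have hcδ : c < δ := by rw [hc]; linarith
  -- `β` vanishes up to `c > a`, which leaves the flow before time `a` unperturbed, and equals one
  -- at `δ`, so the variation `β s` ends at `s`.
  set β : ℝ → ℝ := fun t => Real.smoothTransition ((t - c) / (δ - c)) with hβdef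
  have hβ : ContDiff ℝ ∞ β := Real.smoothTransition.contDiff.comp
    ((contDiff_id.sub contDiff_const).div_const _)
  have hβ0 : ∀ t ≤ c, β t = 0 := fun t ht => Real.smoothTransition.zero_of_nonpos
    (div_nonpos_of_nonpos_of_nonneg (by linarith) (by linarith))
  have hβ1 : β δ = 1 := by
    simp only [hβdef]
    rw [div_self (by linarith)]
    exact Real.smoothTransition.one
  have hXa : ∀ H, ContDiffOn ℝ ∞ (Function.uncurry (X H)) (Icc a δ ×ˢ φ.target) := fun H =>
    (contDiffOn_chartField hδ σ H.2 x₀).mono (prod_mono_left hsub)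
  set A : ℝ → V →L[ℝ] V →L[ℝ] ℝ := controlCoefficient σ x₀ (X H₀) α₀ β with hAdef
  have hA : ContDiffOn ℝ ∞ A (Icc 0 δ) :=
    contDiffOn_controlCoefficient hac haδ rfl σ x₀ (hXa H₀) hsolφ hβ hβ0
  have hA0 : ∀ t < c, A t = 0 := by
    intro t ht
    have h1 : β t = 0 := hβ0 t ht.le
    have h2 : deriv β t = 0 := by
      have h3 : β =ᶠ[𝓝 t] fun _ => 0 := by
        filter_upwards [Iio_mem_nhds ht] with v hv using hβ0 v (le_of_lt hv)
      rw [h3.deriv_eq, deriv_const]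
    refine ContinuousLinearMap.ext fun s => ?_
    change flatMap _ (chartForm σ.form x₀ (α₀ t))
      (deriv β t • s - β t • fderiv ℝ (X H₀ t) (α₀ t) s) = 0
    rw [h1, h2, zero_smul, zero_smul, sub_zero, map_zero]
  -- The chart coordinates, cut off to a global smooth map. On `U`, where `χ = 1`, the perturbation
  -- `A t s (g x)` is linear in the chart with differential `A t s`.
  set g : M → V := fun x => χ x • φ x with hg
  have hgs : ContMDiff (𝓡 d) 𝓘(ℝ, V) ∞ g := by
    refine χ.contMDiff_smul fun x hx => ?_
    exact (contMDiffAt_extChartAt' hx).contMDiffWithinAt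
  set Φ : ℝ → M → V →L[ℝ] ℝ := fun t x =>
    (ContinuousLinearMap.apply ℝ ℝ (g x)).comp (A t) with hΦdef
  have hΦ : ContMDiffOn (𝓘(ℝ, ℝ).prod (𝓡 d)) 𝓘(ℝ, V →L[ℝ] ℝ) ∞
      (fun p : ℝ × M => Φ p.1 p.2) (Icc 0 δ ×ˢ univ) := by
    have h1 : ContMDiffOn (𝓘(ℝ, ℝ).prod (𝓡 d)) 𝓘(ℝ, V →L[ℝ] V →L[ℝ] ℝ) ∞
        (fun p : ℝ × M => A p.1) (Icc 0 δ ×ˢ univ) :=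
      (contMDiffOn_iff_contDiffOn.2 hA).comp contMDiff_fst.contMDiffOn fun p hp => hp.1
    have h2 : ContDiff ℝ ∞ fun v : V =>
        (ContinuousLinearMap.apply ℝ ℝ v : (V →L[ℝ] ℝ) →L[ℝ] ℝ) :=
      contDiff_clm_apply_iff.2 fun f => f.contDiff
    exact ((contMDiff_iff_contDiff.2 h2).comp (hgs.comp contMDiff_snd)).contMDiffOn.clm_comp h1
  have hΦ0 : ∀ t < c, ∀ x, Φ t x = 0 := fun t ht x => by
    refine ContinuousLinearMap.ext fun s => ?_
    change A t s (g x) = 0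
    rw [hA0 t ht]
    rfl
  set B : ℝ → V → V →L[ℝ] V := fun t y => (sharp σ x₀ y).comp (A t) with hBdef
  have hB : ContDiffOn ℝ ∞ (Function.uncurry B) (Icc a δ ×ˢ Ω) :=
    ((contDiffOn_sharp σ x₀).comp contDiffOn_snd fun p hp => hp.2.1).clm_comp
      (hA.comp contDiffOn_fst fun p hp => hsub hp.1)
  have hpert : ∀ (H : HamiltonianSpace d M δ) (s : V), ∀ t ∈ Icc 0 δ, ∀ y ∈ Ω,
      chartField σ (zeroExtend (H.perturb hΦ s).1) x₀ t y = X H t y + B t y s := by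
    intro H s t ht y hy
    refine chartField_perturb σ H hΦ s x₀ ht hy.1 (ℓ := A t s) ?_
    filter_upwards [hΩo.mem_nhds hy] with z hz
    change A t s (χ (φ.symm z) • φ (φ.symm z)) = A t s z
    rw [(hUsub hz.2).2, one_smul, φ.right_inv hz.1]
  obtain ⟨Θ, cΘ, eΘ, hΘ, hW⟩ := exists_controlled_flow_family (X := X) (l₀ := H₀) (S := V) (B := B)
    haδ hΩo (fun H => (hXa H).mono (prod_mono_right inter_subset_left)) hB
    (fun C hC hCc => (tendstoUniformlyOn_chartField hδ σ x₀ H₀ hCc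
      (hC.trans inter_subset_left)).mono (prod_mono_left hsub))
    (fun C hC hCc => (tendstoUniformlyOn_fderiv_chartField hδ σ x₀ H₀ hCc
      (hC.trans inter_subset_left)).mono (prod_mono_left hsub)) hsol
  -- The end point map is the unperturbed flow up to time `a`, which may cross many charts, followed
  -- by the controlled flow in the chart around the end point.
  obtain ⟨F₁, c₁, e₁, h₁⟩ := (hγ₀.mono hsub').flowNear hδ ha0 hsub'
  set ψ := extChartAt (𝓡 d) (γ₀ a) with hψ
  set y₀ : V := extChartAt (𝓡 d) (γ₀ 0) (γ₀ 0) with hy₀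
  have sa : γ₀ a ∈ ψ.source := mem_extChartAt_source _
  have saφ : γ₀ a ∈ φ.source := (hUsub (haU a (left_mem_Icc.2 haδ.le))).1
  have cT : C1Family (fun (_ : HamiltonianSpace d M δ) y => φ (ψ.symm y)) H₀ (ψ (γ₀ a)) :=
    C1Family.transition x₀ (γ₀ a) saφ sa
  have cfst : C1Family (fun (_ : HamiltonianSpace d M δ) (p : V × V) => p.1) H₀ (y₀, (0 : V)) :=
    C1Family.const isOpen_univ contDiff_fst.contDiffOn (mem_univ _)
  have csnd : C1Family (fun (_ : HamiltonianSpace d M δ) (p : V × V) => p.2) H₀ (y₀, (0 : V)) :=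
    C1Family.const isOpen_univ contDiff_snd.contDiffOn (mem_univ _)
  have c₁' : C1Family (fun H (p : V × V) => F₁ H p.1) H₀ (y₀, 0) := c₁.comp_of_eq cfst rfl
  have c₂ : C1Family (fun H (p : V × V) => φ (ψ.symm (F₁ H p.1))) H₀ (y₀, 0) :=
    cT.comp_of_eq c₁' e₁
  have cG : C1Family (fun H (p : V × V) => (φ (ψ.symm (F₁ H p.1)), p.2)) H₀ (y₀, 0) :=
    c₂.prodMk csnd
  have eG : (φ (ψ.symm (F₁ H₀ y₀)), (0 : V)) = (α₀ a, 0) := by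
    rw [e₁, ψ.left_inv sa]
  have cF := cΘ.comp_of_eq cG eG
  refine ⟨Φ, hΦ, _, cF, ?_, ?_, ?_⟩
  · change Θ H₀ (φ (ψ.symm (F₁ H₀ y₀)), 0) = _
    rw [eG, eΘ]
  · have hc1 : ContinuousAt (fun q : HamiltonianSpace d M δ × (V × V) => (q.1, q.2.1))
        (H₀, (y₀, 0)) := continuousAt_fst.prodMk (continuousAt_snd.fst)
    have hc2 : Filter.Tendsto (fun q : HamiltonianSpace d M δ × (V × V) =>
        (q.1, (φ (ψ.symm (F₁ q.1 q.2.1)), q.2.2))) (𝓝 (H₀, (y₀, 0))) (𝓝 (H₀, (α₀ a, 0))) := by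
      rw [← eG]
      exact continuousAt_fst.prodMk cG.continuousAt
    have hc3 : ∀ᶠ q : HamiltonianSpace d M δ × (V × V) in 𝓝 (H₀, (y₀, 0)),
        ψ.symm (F₁ q.1 q.2.1) ∈ φ.source := by
      have h5 : Filter.Tendsto ψ.symm (𝓝 (F₁ H₀ y₀)) (𝓝 (γ₀ a)) := by
        have := continuousAt_extChartAt_symm (I := 𝓡 d) (γ₀ a)
        rw [ContinuousAt, extChartAt_to_inv] at this
        rwa [e₁]
      exact (h5.comp c₁'.continuousAt).eventually
        ((isOpen_extChartAt_source x₀).mem_nhds saφ)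
    filter_upwards [hc1.eventually h₁, hc2.eventually hΘ, hc3]
    rintro ⟨H, y, s⟩ ⟨γ, γ0, γa, hγ⟩ ⟨α, αa, αb, hα⟩ hq
    dsimp only at *
    have hγ' : IsTrajectoryOn σ (zeroExtend (H.perturb hΦ s).1) 0 a γ :=
      hγ.congr (fun _ _ => rfl) fun t ht => by
        rw [H.zeroExtend_perturb hΦ s (hsub' ht)]
        ext x
        rw [hΦ0 t (ht.2.trans_lt hac)]
        exact add_zero _
    have hα' : SolvesODE (chartField σ (zeroExtend (H.perturb hΦ s).1) x₀) φ.target a δ α :=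
      hα.congr_field fun t ht => ⟨(hα t ht).1.1, hpert H s t (hsub ht) _ (hα t ht).1⟩
    have hγ'' := hα'.isTrajectoryOn (H.perturb hΦ s).2 hsub
    refine ⟨_, ?_, ?_, hγ'.trans ha0.le haδ.le hγ'' ?_⟩
    · simp only [ha0.le, if_true, γ0]
    · simp only [not_le.2 haδ, if_false, αb]
      rfl
    · rw [γa, αa]
      exact (φ.left_inv hq).symm
  · intro s
    have dG : HasFDerivAt (fun p : V × V => (φ (ψ.symm (F₁ H₀ p.1)), p.2))
        (fderiv ℝ (fun p : V × V => (φ (ψ.symm (F₁ H₀ p.1)), p.2)) (y₀, 0)) (y₀, 0) :=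
      (cG.contDiffAt.self_of_nhds.differentiableAt (by simp)).hasFDerivAt
    have dΘ := (cΘ.contDiffAt.self_of_nhds.differentiableAt (by simp)).hasFDerivAt
    dsimp only at dΘ
    have dc : fderiv ℝ (fun p : V × V => φ (ψ.symm (F₁ H₀ p.1))) (y₀, 0) (0, s) = 0 := by
      have hd : HasFDerivAt (fun y : V => φ (ψ.symm (F₁ H₀ y)))
          (fderiv ℝ (fun y : V => φ (ψ.symm (F₁ H₀ y))) y₀) y₀ :=
        ((cT.comp_of_eq c₁ e₁).contDiffAt.self_of_nhds.differentiableAt (by simp)).hasFDerivAt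
      have := (HasFDerivAt.comp (f := Prod.fst) (y₀, (0 : V)) hd
        (hasFDerivAt_fst (𝕜 := ℝ) (E := V) (F := V))).fderiv
      exact (DFunLike.congr_fun this (0, s)).trans
        (map_zero (fderiv ℝ (fun y : V => φ (ψ.symm (F₁ H₀ y))) y₀))
    have dGs : fderiv ℝ (fun p : V × V => (φ (ψ.symm (F₁ H₀ p.1)), p.2)) (y₀, 0) (0, s) =
        (0, s) := by
      rw [DifferentiableAt.fderiv_prodMk (c₂.contDiffAt.self_of_nhds.differentiableAt (by simp))
        differentiableAt_snd]
      simp [dc, fderiv_snd]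
    rw [← eG] at dΘ
    have h3 := (HasFDerivAt.comp (y₀, (0 : V)) dΘ dG).fderiv
    refine (DFunLike.congr_fun h3 (0, s)).trans ?_
    rw [ContinuousLinearMap.comp_apply, dGs, eG]
    -- The prescribed variation vanishes at `a`, solves the variational equation by the choice of
    -- `A`, and equals `s` at `δ`.
    refine (hW s (fun t => β t • s) ?_ fun t ht => ?_).trans ?_
    · simp only [hβ0 a hac.le, zero_smul]
    · have h4 : HasDerivAt (fun t => β t • s) (deriv β t • s) t :=
        (hβ.differentiable (by simp) t).hasDerivAt.smul_const s
      refine h4.hasDerivWithinAt.congr_deriv ?_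
      have h5 : B t (α₀ t) s = deriv β t • s - fderiv ℝ (X H₀ t) (α₀ t) (β t • s) :=
        sharp_controlCoefficient σ x₀ (X H₀) α₀ β (hsolφ t ht).1 s
      rw [h5]
      abel
    · simp only [hβ1, one_smul]

end Perturbation

/-! ## Density of the Hamiltonians with complete flow -/

section Completeness

variable {d : ℕ} {M : Type*} [TopologicalSpace M] [ChartedSpace (EuclideanSpace ℝ (Fin d)) M]
  {δ : ℝ}

theorem isTrajectoryOn_const {σ : SymplecticForm d M} {h : ℝ → M → ℝ} {a b : ℝ} {x : M}
    (hx : ∀ t ∈ Icc a b, h t =ᶠ[𝓝 x] fun _ => 0) : IsTrajectoryOn σ h a b fun _ => x := by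
  intro t ht
  refine ⟨0, ?_, ?_⟩
  · rw [map_zero]
    have h1 : HasMFDerivAt (𝓡 d) 𝓘(ℝ, ℝ) (h t) x
        (0 : EuclideanSpace ℝ (Fin d) →L[ℝ] ℝ) :=
      (hasMFDerivAt_const (0 : ℝ) x).congr_of_eventuallyEq (hx t ht)
    exact h1.mfderiv.symm
  · have h2 : ContinuousLinearMap.toSpanSingleton ℝ (0 : EuclideanSpace ℝ (Fin d)) = 0 := by
      ext1; simp
    have h3 : HasMFDerivWithinAt 𝓘(ℝ, ℝ) (𝓡 d) (fun _ : ℝ => x) (Icc a b) t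
        (0 : ℝ →L[ℝ] EuclideanSpace ℝ (Fin d)) := (hasMFDerivAt_const x t).hasMFDerivWithinAt
    exact h2.symm ▸ h3

variable [IsManifold (𝓡 d) ∞ M]

/-- Local existence of trajectories, uniformly in the initial time. -/
theorem exists_local_trajectory (hδ : 0 < δ) (σ : SymplecticForm d M) (H : HamiltonianSpace d M δ)
    (x₀ : M) : ∃ ε > 0, ∀ᶠ x in 𝓝 x₀, ∀ t ∈ Ico 0 δ, ∃ γ : ℝ → M, γ t = x ∧
      IsTrajectoryOn σ (zeroExtend H.1) t (min (t + ε) δ) γ := by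
  set φ := extChartAt (𝓡 d) x₀ with hφ
  have hX := contDiffOn_chartField hδ σ H.2 x₀
  obtain ⟨r, hr, hrt⟩ := Metric.nhds_basis_closedBall.mem_iff.1
    ((isOpen_target x₀).mem_nhds (mem_extChartAt_target (I := 𝓡 d) x₀))
  obtain ⟨χ, c1, c2, c3, c4, -⟩ := exists_cutoff (isCompact_closedBall _ r) (isOpen_target x₀) hrt
  obtain ⟨⟨K, hK⟩, ⟨L, hL⟩, hc⟩ := cutoff_field_bounds hδ hX (isOpen_target x₀) c1 c2 c3
  have hL0 : 0 ≤ L := (norm_nonneg _).trans (hL 0 (left_mem_Icc.2 hδ.le) 0)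
  have hLε : L * (r / (2 * (L + 1))) ≤ r / 2 := by
    rw [mul_div_assoc', div_le_div_iff₀ (by positivity) (by positivity)]
    nlinarith
  -- At speed at most `L` the displacement in this time is at most `r / 2`. Starting within `r / 2`
  -- of the centre, the curve stays in the ball where the cut-off is one; `L + 1` avoids dividing by
  -- zero.
  refine ⟨r / (2 * (L + 1)), by positivity, ?_⟩
  set ε := r / (2 * (L + 1)) with hε
  have hε0 : 0 < ε := by positivity
  filter_upwards [extChartAt_source_mem_nhds (I := 𝓡 d) x₀,
    (continuousAt_extChartAt (I := 𝓡 d) x₀).eventually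
      (Metric.ball_mem_nhds (φ x₀) (half_pos hr))] with x hxs hxr t ht
  set b := min (t + ε) δ with hb
  have htb : t < b := lt_min (by linarith) ht.2
  have hsub : Icc t b ⊆ Icc 0 δ := Icc_subset_Icc ht.1 (min_le_right _ _)
  obtain ⟨α, αt, hα⟩ := exists_global_solution htb.le ⟨K, fun s hs => hK s (hsub hs)⟩
    ⟨L, fun s hs => hL s (hsub hs)⟩ (fun y => (hc y).mono hsub) (φ x)
  have hball : ∀ s ∈ Icc t b, α s ∈ Metric.closedBall (φ x₀) r := by
    intro s hs
    have h1 := norm_image_sub_le_of_norm_deriv_le_segment' (fun u hu => (hα u hu).2)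
      (fun u hu => hL u (hsub (Ico_subset_Icc_self hu)) _) s hs
    have h2 : L * (s - t) ≤ r / 2 := by
      refine le_trans (mul_le_mul_of_nonneg_left ?_ hL0) hLε
      have := hs.2.trans (min_le_left _ _)
      linarith
    have h3 : dist (φ x) (φ x₀) < r / 2 := hxr
    rw [Metric.mem_closedBall]
    have h4 : dist (α s) (φ x) ≤ r / 2 := by
      rw [dist_eq_norm, ← αt]; exact h1.trans h2
    linarith [dist_triangle (α s) (φ x) (φ x₀)]
  have hα' : SolvesODE (chartField σ (zeroExtend H.1) x₀) φ.target t b α :=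
    hα.congr_field fun s hs => ⟨hrt (hball s hs), by rw [c4 _ (hball s hs), one_smul]⟩
  refine ⟨_, ?_, hα'.isTrajectoryOn H.2 hsub⟩
  simp only [αt]
  exact φ.left_inv hxs

/-- The flow of a compactly supported Hamiltonian is complete. -/
theorem flowDomain_eq_univ_of_compact_support [T2Space M] (hδ : 0 < δ) (σ : SymplecticForm d M)
    (H : HamiltonianSpace d M δ) {K : Set M} (hK : IsCompact K)
    (hH : ∀ t ∈ Icc 0 δ, ∀ x ∉ K, zeroExtend H.1 t x = 0) : flowDomain σ H = univ := by
  have hunif : ∃ ε > 0, ∀ x ∈ K, ∀ t ∈ Ico 0 δ, ∃ γ : ℝ → M, γ t = x ∧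
      IsTrajectoryOn σ (zeroExtend H.1) t (min (t + ε) δ) γ := by
    choose ε hε hεx using exists_local_trajectory hδ σ H
    obtain ⟨F, -, hF⟩ := hK.elim_nhds_subcover _ fun x _ => hεx x
    obtain ⟨ε₀, hε₀, hle⟩ : ∃ ε₀ > 0, ∀ x ∈ F, ε₀ ≤ ε x := by
      rcases F.eq_empty_or_nonempty with rfl | hne
      · exact ⟨1, one_pos, by simp⟩
      · obtain ⟨x, hx, hmin⟩ := F.exists_min_image ε hne
        exact ⟨ε x, hε x, hmin⟩
    refine ⟨ε₀, hε₀, fun x hx t ht => ?_⟩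
    obtain ⟨y, hy, hxy⟩ := mem_iUnion₂.1 (hF hx)
    obtain ⟨γ, h1, h2⟩ := hxy t ht
    exact ⟨γ, h1, h2.mono (Icc_subset_Icc_right (min_le_min_right _ (by linarith [hle y hy])))⟩
  obtain ⟨ε, hε, hloc⟩ := hunif
  -- Off `K` the Hamiltonian vanishes near the point, so the constant curve is a trajectory. The
  -- step length `ε` is now uniform on all of `M`, and finitely many steps cover `[0, δ]`.
  have hstep : ∀ x : M, ∀ t ∈ Ico 0 δ, ∃ γ : ℝ → M, γ t = x ∧
      IsTrajectoryOn σ (zeroExtend H.1) t (min (t + ε) δ) γ := by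
    intro x t ht
    by_cases hx : x ∈ K
    · exact hloc x hx t ht
    · refine ⟨fun _ => x, rfl, isTrajectoryOn_const fun s hs => ?_⟩
      filter_upwards [hK.isClosed.isOpen_compl.mem_nhds hx] with y hy
      exact hH s ⟨ht.1.trans hs.1, hs.2.trans (min_le_right _ _)⟩ y hy
  refine eq_univ_of_forall fun x => mem_flowDomain_iff.2 ?_
  have key : ∀ n : ℕ, ∃ γ : ℝ → M, γ 0 = x ∧
      IsTrajectoryOn σ (zeroExtend H.1) 0 (min ((n + 1) * ε) δ) γ := by
    intro n
    induction n with
    | zero => simpa using hstep x 0 ⟨le_rfl, hδ⟩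
    | succ n ih =>
      obtain ⟨γ, h0, hγ⟩ := ih
      rcases le_or_gt δ ((n + 1) * ε) with hle | hlt
      · rw [min_eq_right hle] at hγ
        refine ⟨γ, h0, ?_⟩
        rw [min_eq_right]
        · exact hγ
        · push_cast; nlinarith
      · rw [min_eq_left hlt.le] at hγ
        obtain ⟨γ', h0', hγ'⟩ := hstep (γ ((n + 1) * ε)) ((n + 1) * ε) ⟨by positivity, hlt⟩
        have heq : ((n + 1 : ℕ) + 1 : ℝ) * ε = (n + 1) * ε + ε := by push_cast; ring
        rw [heq]
        have hn : (0 : ℝ) ≤ (n + 1) * ε := by positivity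
        refine ⟨_, ?_, hγ.trans hn (le_min (by linarith) hlt.le) hγ' h0'.symm⟩
        simp only [hn, if_true, h0]
  obtain ⟨n, hn⟩ := exists_nat_gt (δ / ε)
  obtain ⟨γ, h0, hγ⟩ := key n
  rw [div_lt_iff₀ hε] at hn
  rw [min_eq_right (by nlinarith)] at hγ
  exact ⟨γ, h0, hγ⟩

/-- Multiply by cut-offs that are one near the members of a compact exhaustion. On a compact set of
chart points all derivatives eventually agree with those of `H`, so the products converge to `H`. -/
theorem dense_complete_hamiltonians [T2Space M] [SecondCountableTopology M] (hδ : 0 < δ)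
    (σ : SymplecticForm d M) : Dense {H : HamiltonianSpace d M δ | flowDomain σ H = univ} := by
  have : LocallyCompactSpace M := ChartedSpace.locallyCompactSpace (EuclideanSpace ℝ (Fin d)) M
  intro H
  set K := CompactExhaustion.choice M
  have hex : ∀ n, ∃ f : C^((⊤ : ℕ∞) : WithTop ℕ∞)⟮𝓡 d, M; 𝓘(ℝ, ℝ), ℝ⟯,
      (∀ᶠ x in 𝓝ˢ (K n), f x = 1) ∧ (∀ x ∉ K (n + 1), f x = 0) ∧ ∀ x, f x ∈ Icc 0 1 := fun n =>
    exists_contMDiffMap_one_nhds_of_subset_interior (n := (⊤ : ℕ∞)) (𝓡 d) (K.isCompact n).isClosed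
      (K.subset_interior_succ n)
  choose χ h1 h0 _ using hex
  have hs : ∀ n, ContMDiffOn (𝓘(ℝ, ℝ).prod (𝓡 d)) 𝓘(ℝ, ℝ) ∞
      (fun p : ℝ × M => χ n p.2 * zeroExtend H.1 p.1 p.2) (Icc 0 δ ×ˢ univ) := fun n =>
    ((χ n).contMDiff.comp contMDiff_snd).contMDiffOn.mul H.2
  refine mem_closure_of_tendsto (b := Filter.atTop)
    (f := fun n => HamiltonianSpace.ofFun (fun t x => χ n x * zeroExtend H.1 t x) (hs n)) ?_ ?_
  · refine HamiltonianSpace.tendsto_nhds_iff.2 fun k x₀ C hC hCs => ?_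
    have hu : UniqueDiffOn ℝ (chartDomain d δ x₀) := uniqueDiffOn_Icc_prod hδ (isOpen_target x₀)
    have hC' : IsCompact ((fun p : ℝ × EuclideanSpace ℝ (Fin d) =>
        (extChartAt (𝓡 d) x₀).symm p.2) '' C) :=
      hC.image_of_continuousOn ((continuousOn_extChartAt_symm x₀).comp continuousOn_snd
        fun p hp => (hCs hp).2)
    obtain ⟨N, hN⟩ := K.exists_superset_of_isCompact hC'
    rw [Metric.tendstoUniformlyOn_iff]
    intro ε hε
    filter_upwards [Filter.eventually_ge_atTop N] with n hn p hp
    have hpn : (extChartAt (𝓡 d) x₀).symm p.2 ∈ K n := K.subset hn (hN (mem_image_of_mem _ hp))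
    rw [HamiltonianSpace.chartDeriv_ofFun _ k x₀ (hCs hp)]
    have heq : Function.uncurry (inChart (fun t x => χ n x * zeroExtend H.1 t x) x₀)
        =ᶠ[𝓝[chartDomain d δ x₀] p] fun p : ℝ × EuclideanSpace ℝ (Fin d) =>
          zeroExtend H.1 p.1 ((extChartAt (𝓡 d) x₀).symm p.2) := by
      have hcont : ContinuousWithinAt (fun p : ℝ × EuclideanSpace ℝ (Fin d) =>
          (extChartAt (𝓡 d) x₀).symm p.2) (chartDomain d δ x₀) p :=
        ((continuousOn_extChartAt_symm x₀).comp continuousOn_snd fun p hp => hp.2) p (hCs hp)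
      filter_upwards [hcont.eventually (Filter.Eventually.filter_mono
        (nhds_le_nhdsSet hpn) (h1 n))] with q hq
      simp only [Function.uncurry, inChart, hq, one_mul]
    have h2 : iteratedFDerivWithin ℝ k
        (Function.uncurry (inChart (fun t x => χ n x * zeroExtend H.1 t x) x₀))
        (chartDomain d δ x₀) p = H.chartDeriv k x₀ p :=
      heq.iteratedFDerivWithin_eq (heq.self_of_nhdsWithin (hCs hp)) k
    rw [h2, dist_self]
    exact hε
  · refine Filter.Eventually.of_forall fun n => ?_
    refine flowDomain_eq_univ_of_compact_support hδ σ _ (K.isCompact (n + 1)) fun t ht x hx => ?_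
    rw [HamiltonianSpace.zeroExtend_ofFun _ ht, h0 n x hx, zero_mul]

end Completeness

/-! ## Flows and smooth maps in charts -/

section ChartRepresentation

theorem C1Family.sub {Λ E F : Type*} [TopologicalSpace Λ] [NormedAddCommGroup E] [NormedSpace ℝ E]
    [NormedAddCommGroup F] [NormedSpace ℝ F] {l₀ : Λ} {Θ Ψ : Λ → E → F} {x₀ : E}
    (hΘ : C1Family Θ l₀ x₀) (hΨ : C1Family Ψ l₀ x₀) :
    C1Family (fun l x => Θ l x - Ψ l x) l₀ x₀ := by
  refine ⟨hΘ.continuousAt.sub hΨ.continuousAt, ?_, ?_⟩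
  · filter_upwards [hΘ.contDiffAt, hΨ.contDiffAt] with q h1 h2
    exact h1.sub h2
  · refine (hΘ.continuousAt_fderiv.sub hΨ.continuousAt_fderiv).congr ?_
    filter_upwards [hΘ.contDiffAt, hΨ.contDiffAt] with q h1 h2
    exact (fderiv_sub (h1.differentiableAt (by simp)) (h2.differentiableAt (by simp))).symm

theorem C1Family.pi {Λ E κ : Type*} {F : κ → Type*} [TopologicalSpace Λ] [NormedAddCommGroup E]
    [NormedSpace ℝ E] [Fintype κ] [∀ k, NormedAddCommGroup (F k)] [∀ k, NormedSpace ℝ (F k)]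
    {l₀ : Λ} {Θ : Λ → E → ∀ k, F k} {x₀ : E} (hΘ : ∀ k, C1Family (fun l x => Θ l x k) l₀ x₀) :
    C1Family Θ l₀ x₀ := by
  classical
  have hd : ∀ᶠ q : Λ × E in 𝓝 (l₀, x₀), ∀ k, ContDiffAt ℝ ∞ (fun x => Θ q.1 x k) q.2 :=
    Filter.eventually_all.2 fun k => (hΘ k).contDiffAt
  refine ⟨continuousAt_pi.2 fun k => (hΘ k).continuousAt, hd.mono fun q hq => contDiffAt_pi.2 hq, ?_⟩
  have h : ContinuousAt (fun q : Λ × E => ∑ k, (ContinuousLinearMap.single ℝ F k).comp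
      (fderiv ℝ (fun x => Θ q.1 x k) q.2)) (l₀, x₀) :=
    tendsto_finsetSum _ fun k _ => continuousAt_const.clm_comp (hΘ k).continuousAt_fderiv
  refine h.congr ?_
  filter_upwards [hd] with q hq
  have h1 := (hasFDerivAt_pi.2 fun k => ((hq k).differentiableAt (by simp)).hasFDerivAt).fderiv
  refine Eq.trans ?_ h1.symm
  ext v k
  simp [Finset.sum_apply]

variable {d : ℕ} {M : Type*} [TopologicalSpace M] [ChartedSpace (EuclideanSpace ℝ (Fin d)) M]
  {δ : ℝ}

/-- The derivative of a map between manifolds, as a map between the model spaces. -/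
noncomputable def derivAt {n : ℕ} {Q : Type*} [TopologicalSpace Q]
    [ChartedSpace (EuclideanSpace ℝ (Fin n)) Q] (f : Q → M) (p : Q) :
    EuclideanSpace ℝ (Fin n) →L[ℝ] EuclideanSpace ℝ (Fin d) :=
  mfderiv (𝓡 n) (𝓡 d) f p

/-- A map between manifolds in the preferred charts around `p₀` and `b`. -/
noncomputable def writtenInCharts {n : ℕ} {Q : Type*} [TopologicalSpace Q]
    [ChartedSpace (EuclideanSpace ℝ (Fin n)) Q] (f : Q → M) (p₀ : Q) (b : M)
    (x : EuclideanSpace ℝ (Fin n)) : EuclideanSpace ℝ (Fin d) :=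
  extChartAt (𝓡 d) b (f ((extChartAt (𝓡 n) p₀).symm x))

variable [IsManifold (𝓡 d) ∞ M]

theorem bijective_chartD (b : M) {x : M} (hx : x ∈ (extChartAt (𝓡 d) b).source) :
    Function.Bijective (chartD (d := d) b x) := by
  have h1 := (extChartAt (𝓡 d) b).map_source hx
  have h2 := (extChartAt (𝓡 d) b).left_inv hx
  refine Function.bijective_iff_has_inverse.2
    ⟨chartSymmD b (extChartAt (𝓡 d) b x), fun v => ?_, fun v => ?_⟩
  · have := chartSymmD_chartD b h1 v
    rwa [h2] at this
  · have := chartD_chartSymmD b h1 v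
    rwa [h2] at this

section

variable {n : ℕ} {Q : Type*} [TopologicalSpace Q] [ChartedSpace (EuclideanSpace ℝ (Fin n)) Q]
  [IsManifold (𝓡 n) ∞ Q]

theorem contDiffOn_writtenInCharts {f : Q → M} (hf : ContMDiff (𝓡 n) (𝓡 d) ∞ f) (p₀ : Q) (b : M) :
    IsOpen ((extChartAt (𝓡 n) p₀).target ∩ (extChartAt (𝓡 n) p₀).symm ⁻¹'
      (f ⁻¹' (extChartAt (𝓡 d) b).source)) ∧
    ContDiffOn ℝ ∞ (writtenInCharts (d := d) (n := n) f p₀ b) ((extChartAt (𝓡 n) p₀).target ∩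
      (extChartAt (𝓡 n) p₀).symm ⁻¹' (f ⁻¹' (extChartAt (𝓡 d) b).source)) := by
  refine ⟨(continuousOn_extChartAt_symm p₀).isOpen_inter_preimage (isOpen_target p₀)
    ((isOpen_extChartAt_source b).preimage hf.continuous), ?_⟩
  rw [← contMDiffOn_iff_contDiffOn]
  have h1 : ContMDiffOn (𝓡 d) 𝓘(ℝ, EuclideanSpace ℝ (Fin d)) ∞ (extChartAt (𝓡 d) b)
      (extChartAt (𝓡 d) b).source := fun x hx =>
    (contMDiffAt_extChartAt' (by simpa using hx)).contMDiffWithinAt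
  exact h1.comp (hf.comp_contMDiffOn ((contMDiffOn_extChartAt_symm p₀).mono inter_subset_left))
    fun x hx => hx.2

theorem hasFDerivAt_writtenInCharts {f : Q → M} (hf : ContMDiff (𝓡 n) (𝓡 d) ∞ f) {p₀ : Q} {b : M}
    {p : Q} (hp : p ∈ (extChartAt (𝓡 n) p₀).source) (hb : f p ∈ (extChartAt (𝓡 d) b).source) :
    HasFDerivAt (writtenInCharts (d := d) (n := n) f p₀ b)
      ((chartD b (f p)).comp ((derivAt f p).comp (chartSymmD p₀ (extChartAt (𝓡 n) p₀ p))))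
      (extChartAt (𝓡 n) p₀ p) := by
  have h2 := (extChartAt (𝓡 n) p₀).left_inv hp
  have h3 : HasMFDerivAt (𝓡 n) (𝓡 d) f p (derivAt f p) :=
    (hf.contMDiffAt.mdifferentiableAt (by simp)).hasMFDerivAt
  have h4 := hasMFDerivAt_chart b hb
  have h5 := hasMFDerivAt_chart_symm p₀ ((extChartAt (𝓡 n) p₀).map_source hp)
  have h6 : HasMFDerivAt (𝓡 n) 𝓘(ℝ, EuclideanSpace ℝ (Fin d)) (extChartAt (𝓡 d) b ∘ f)
      ((extChartAt (𝓡 n) p₀).symm (extChartAt (𝓡 n) p₀ p)) ((chartD b (f p)).comp (derivAt f p)) := by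
    rw [h2]
    exact h4.comp p h3
  exact (h6.comp _ h5).hasFDerivAt

end

/-- Trajectories are unique, so their end points determine the flow. As they are given for all `y`
near the point, the flow coincides locally with `f` read in charts, and so does its derivative. -/
theorem flow_of_chart_representation [T2Space M] (hδ : 0 < δ) {σ : SymplecticForm d M}
    {H : HamiltonianSpace d M δ} {a b m : M}
    {f : EuclideanSpace ℝ (Fin d) → EuclideanSpace ℝ (Fin d)}
    (ha : m ∈ (extChartAt (𝓡 d) a).source)
    (hf : DifferentiableAt ℝ f (extChartAt (𝓡 d) a m))
    (hb : f (extChartAt (𝓡 d) a m) ∈ (extChartAt (𝓡 d) b).target)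
    (htraj : ∀ᶠ y in 𝓝 (extChartAt (𝓡 d) a m), ∃ γ : ℝ → M,
      γ 0 = (extChartAt (𝓡 d) a).symm y ∧ γ δ = (extChartAt (𝓡 d) b).symm (f y) ∧
      IsTrajectoryOn σ (zeroExtend H.1) 0 δ γ) :
    m ∈ flowDomain σ H ∧
    hamiltonianFlow σ H m = (extChartAt (𝓡 d) b).symm (f (extChartAt (𝓡 d) a m)) ∧
    ∀ v, chartD b (hamiltonianFlow σ H m) (derivAt (hamiltonianFlow σ H) m v) =
      fderiv ℝ f (extChartAt (𝓡 d) a m) (chartD a m v) := by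
  have hpt : ∀ x ∈ (extChartAt (𝓡 d) a).source, (∃ γ : ℝ → M,
      γ 0 = (extChartAt (𝓡 d) a).symm (extChartAt (𝓡 d) a x) ∧
      γ δ = (extChartAt (𝓡 d) b).symm (f (extChartAt (𝓡 d) a x)) ∧
      IsTrajectoryOn σ (zeroExtend H.1) 0 δ γ) → x ∈ flowDomain σ H ∧
      hamiltonianFlow σ H x = (extChartAt (𝓡 d) b).symm (f (extChartAt (𝓡 d) a x)) := by
    rintro x hx ⟨γ, g0, g1, hγ⟩
    rw [(extChartAt (𝓡 d) a).left_inv hx] at g0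
    have := hamiltonianFlow_eq hδ hγ
    rwa [g0, g1] at this
  obtain ⟨h1, h2⟩ := hpt m ha htraj.self_of_nhds
  refine ⟨h1, h2, fun v => ?_⟩
  have hev : hamiltonianFlow σ H =ᶠ[𝓝 m] fun x =>
      (extChartAt (𝓡 d) b).symm (f (extChartAt (𝓡 d) a x)) := by
    filter_upwards [(isOpen_extChartAt_source a).mem_nhds ha,
      (continuousAt_extChartAt' ha).eventually htraj] with x hx hx'
    exact (hpt x hx hx').2
  have h3 : HasMFDerivAt (𝓡 d) (𝓡 d) (hamiltonianFlow σ H) m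
      ((chartSymmD b (f (extChartAt (𝓡 d) a m))).comp
        ((fderiv ℝ f (extChartAt (𝓡 d) a m)).comp (chartD a m))) :=
    ((hasMFDerivAt_chart_symm b hb).comp m (hf.hasFDerivAt.hasMFDerivAt.comp m
      (hasMFDerivAt_chart a ha))).congr_of_eventuallyEq hev
  have h4 : derivAt (hamiltonianFlow σ H) m = _ := h3.mfderiv
  rw [h4, h2]
  exact chartD_chartSymmD b hb _

theorem tendsto_hamiltonianFlow [T2Space M] (hδ : 0 < δ) {σ : SymplecticForm d M}
    {H₀ : HamiltonianSpace d M δ} {m₀ : M} (hm₀ : m₀ ∈ flowDomain σ H₀) :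
    ContinuousAt (fun q : HamiltonianSpace d M δ × M => hamiltonianFlow σ q.1 q.2) (H₀, m₀) := by
  obtain ⟨γ₀, rfl, hγ₀⟩ := mem_flowDomain_iff.1 hm₀
  obtain ⟨F, cF, eF, ht⟩ := hγ₀.flowNear hδ hδ subset_rfl
  have hc : ContinuousAt (fun q : HamiltonianSpace d M δ × M => (q.1, extChartAt (𝓡 d) (γ₀ 0) q.2))
      (H₀, γ₀ 0) := continuousAt_fst.prodMk
        (ContinuousAt.comp (x := (H₀, γ₀ 0)) (continuousAt_extChartAt (γ₀ 0)) continuousAt_snd)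
  have h1 : Filter.Tendsto (fun q : HamiltonianSpace d M δ × M =>
      (extChartAt (𝓡 d) (γ₀ δ)).symm (F q.1 (extChartAt (𝓡 d) (γ₀ 0) q.2))) (𝓝 (H₀, γ₀ 0))
      (𝓝 (γ₀ δ)) := by
    have h2 := continuousAt_extChartAt_symm (I := 𝓡 d) (γ₀ δ)
    rw [ContinuousAt, extChartAt_to_inv, ← eF] at h2
    exact h2.comp (cF.continuousAt.tendsto.comp hc)
  rw [ContinuousAt, (hamiltonianFlow_eq hδ hγ₀).2]
  refine h1.congr' ?_
  filter_upwards [hc.eventually ht, continuousAt_snd.eventually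
    ((isOpen_extChartAt_source (I := 𝓡 d) (γ₀ 0)).mem_nhds (mem_extChartAt_source _))]
  rintro q ⟨γ, ga, gb, hγ⟩ hq
  have h3 := (hamiltonianFlow_eq hδ hγ).2
  rw [ga, gb] at h3
  rw [← h3]
  congr 1
  exact (extChartAt (𝓡 d) (γ₀ 0)).left_inv hq

end ChartRepresentation

/-! ## The defining equations near a solution -/

section LocalModel

/-- Data on `M (j + 1)` arise indexed by `j`. Shifting a dependent family along the bijection `j ↦ j
+ 1` avoids transport along `(i - 1) + 1 = i`. -/
theorem exists_reindex {r : ℕ} {A : Fin (r + 1) → Type*} (f : ∀ j : Fin (r + 1), A (j + 1)) :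
    ∃ g : ∀ i, A i, ∀ j, g (j + 1) = f j :=
  ⟨Equiv.piCongrLeft A (Equiv.addRight 1) f,
    fun j => Equiv.piCongrLeft_apply_apply A (Equiv.addRight 1) f j⟩

theorem forall_of_forall_add_one {r : ℕ} {P : Fin (r + 1) → Prop} (h : ∀ j, P (j + 1)) (i) : P i := by
  have := h (i - 1)
  rwa [sub_add_cancel] at this

/-- The values of the defining equations of a fiber product in coordinates. -/
abbrev Constraints {r : ℕ} (d : Fin (r + 1) → ℕ) (I : Set (Fin (r + 1))) : Type :=
  ∀ j : {j : Fin (r + 1) // j + 1 ∈ I}, EuclideanSpace ℝ (Fin (d (j.1 + 1)))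

/-- Coordinates on the product of the correspondences. -/
abbrev Coordinates {r : ℕ} (n : Fin (r + 1) → ℕ) : Type := ∀ j, EuclideanSpace ℝ (Fin (n j))

/-- Controls are only needed in the factors indexed by `I`; the others are left unperturbed by
extending with zero. -/
theorem exists_extension {r : ℕ} (d : Fin (r + 1) → ℕ) (I : Set (Fin (r + 1))) :
    ∃ L : Constraints d I →L[ℝ] Coordinates d, ∀ s (j : {j : Fin (r + 1) // j + 1 ∈ I}),
      L s (j.1 + 1) = s j := by
  classical
  set e := LinearEquiv.piCongrLeft ℝ (fun i => EuclideanSpace ℝ (Fin (d i)))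
    (Equiv.addRight (1 : Fin (r + 1)))
  set f : Constraints d I →ₗ[ℝ] ∀ j, EuclideanSpace ℝ (Fin (d (j + 1))) := LinearMap.pi fun j =>
    if hj : j + 1 ∈ I then
      LinearMap.proj (φ := fun j : {j : Fin (r + 1) // j + 1 ∈ I} =>
        EuclideanSpace ℝ (Fin (d (j.1 + 1)))) ⟨j, hj⟩
    else 0 with hf
  refine ⟨LinearMap.toContinuousLinearMap (e.toLinearMap ∘ₗ f), fun s j => ?_⟩
  have h1 : e (f s) (j.1 + 1) = f s j.1 :=
    Equiv.piCongrLeft_apply_apply (fun i => EuclideanSpace ℝ (Fin (d i))) (Equiv.addRight 1) (f s) j.1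
  refine h1.trans ?_
  simp only [hf, LinearMap.pi_apply, dif_pos j.2]
  rfl

variable {r : ℕ} {d n : Fin (r + 1) → ℕ} {M Q : Fin (r + 1) → Type*} {δ : Fin (r + 1) → ℝ}
  [∀ j, TopologicalSpace (M j)] [∀ j, ChartedSpace (EuclideanSpace ℝ (Fin (d j))) (M j)]
  [∀ j, TopologicalSpace (Q j)] [∀ j, ChartedSpace (EuclideanSpace ℝ (Fin (n j))) (Q j)]

/-- Transversality of the defining equations of a partial fiber product at a single point. -/
def TransversalAt (σ : ∀ j, SymplecticForm (d j) (M j)) (ι : ∀ j, Q j → M j × M (j + 1))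
    (I : Set (Fin (r + 1))) (H : ∀ j, HamiltonianSpace (d j) (M j) (δ j)) (p : ∀ j, Q j) : Prop :=
  p ∈ partialFiberProduct σ ι H I →
    Function.Surjective
      (fun (u : ∀ j, TangentSpace (𝓡 (n j)) (p j)) (j : {j : Fin (r + 1) // j + 1 ∈ I}) =>
        linearizedEquation σ ι H p u j.1)

/-- The linearized equations in terms of the components of the correspondences. -/
noncomputable def linearizedMap (σ : ∀ j, SymplecticForm (d j) (M j))
    (ι : ∀ j, Q j → M j × M (j + 1)) (I : Set (Fin (r + 1)))
    (H : ∀ j, HamiltonianSpace (d j) (M j) (δ j)) (p : ∀ j, Q j) (u : Coordinates n) :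
    Constraints d I := fun j =>
  derivAt (d := d (j.1 + 1)) (n := n (j.1 + 1)) (fun q => (ι (j.1 + 1) q).1) (p (j.1 + 1))
      (u (j.1 + 1)) -
    derivAt (d := d (j.1 + 1)) (n := d (j.1 + 1)) (hamiltonianFlow (σ (j.1 + 1)) (H (j.1 + 1)))
      (ι j.1 (p j.1)).2 (derivAt (d := d (j.1 + 1)) (n := n j.1) (fun q => (ι j.1 q).2) (p j.1) (u j.1))

theorem transversalAt_iff {σ : ∀ j, SymplecticForm (d j) (M j)} {ι : ∀ j, Q j → M j × M (j + 1)}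
    (hι : ∀ j, ContMDiff (𝓡 (n j)) ((𝓡 (d j)).prod (𝓡 (d (j + 1)))) ∞ (ι j))
    {I : Set (Fin (r + 1))} {H : ∀ j, HamiltonianSpace (d j) (M j) (δ j)} {p : ∀ j, Q j} :
    TransversalAt (n := n) σ ι I H p ↔ (p ∈ partialFiberProduct σ ι H I →
      Function.Surjective (linearizedMap (n := n) σ ι I H p)) := by
  have hd : ∀ j, MDifferentiableAt (𝓡 (n j)) ((𝓡 (d j)).prod (𝓡 (d (j + 1)))) (ι j) (p j) :=
    fun j => (hι j).contMDiffAt.mdifferentiableAt (by simp)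
  have h1 : ∀ j u, derivAt (d := d j) (n := n j) (fun q => (ι j q).1) (p j) u =
      (mfderiv (𝓡 (n j)) ((𝓡 (d j)).prod (𝓡 (d (j + 1)))) (ι j) (p j) u).1 := fun j u =>
    DFunLike.congr_fun ((hasMFDerivAt_fst (ι j (p j))).comp (p j) (hd j).hasMFDerivAt).mfderiv u
  have h2 : ∀ j u, derivAt (d := d (j + 1)) (n := n j) (fun q => (ι j q).2) (p j) u =
      (mfderiv (𝓡 (n j)) ((𝓡 (d j)).prod (𝓡 (d (j + 1)))) (ι j) (p j) u).2 := fun j u =>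
    DFunLike.congr_fun ((hasMFDerivAt_snd (ι j (p j))).comp (p j) (hd j).hasMFDerivAt).mfderiv u
  have h3 : ∀ (u : ∀ j, TangentSpace (𝓡 (n j)) (p j)) (j : {j : Fin (r + 1) // j + 1 ∈ I}),
      linearizedMap (n := n) σ ι I H p u j = linearizedEquation σ ι H p u j.1 := fun u j =>
    congrArg₂ (fun v w : EuclideanSpace ℝ (Fin (d (j.1 + 1))) => v - w)
      (h1 (j.1 + 1) (u (j.1 + 1)))
      (congrArg (derivAt (d := d (j.1 + 1)) (n := d (j.1 + 1))
        (hamiltonianFlow (σ (j.1 + 1)) (H (j.1 + 1))) (ι j.1 (p j.1)).2) (h2 j.1 (u j.1)))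
  refine ⟨fun h hp y => ?_, fun h hp y => ?_⟩
  · obtain ⟨u, hu⟩ := h hp y
    exact ⟨u, funext fun j => (h3 u j).trans (congrFun hu j)⟩
  · obtain ⟨u, hu⟩ := h hp y
    exact ⟨u, funext fun j => (h3 u j).symm.trans (congrFun hu j)⟩

/-- The sign appears because the equation in coordinates is flow minus target, while the linearized
equation is `v' - Dφ v`. -/
theorem Function.Bijective.surjective_iff_of_comp_eq_neg {X X' Y Y' : Type*} [AddGroup Y']
    {A : X → Y} {B : X' → Y'} {T : Y → Y'} {R : X → X'} (hT : Function.Bijective T)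
    (hR : Function.Bijective R) (h : ∀ u, T (A u) = -B (R u)) :
    Function.Surjective A ↔ Function.Surjective B := by
  constructor
  · intro hA y
    obtain ⟨z, hz⟩ := hT.2 (-y)
    obtain ⟨u, rfl⟩ := hA z
    exact ⟨R u, by rw [← neg_inj, ← h, hz]⟩
  · intro hB y
    obtain ⟨x, hx⟩ := hB (-T y)
    obtain ⟨u, rfl⟩ := hR.2 x
    exact ⟨u, hT.1 (by rw [h, hx, neg_neg])⟩

theorem bijective_piMap {κ : Type*} {A B : κ → Type*} {f : ∀ k, A k → B k}
    (hf : ∀ k, Function.Bijective (f k)) : Function.Bijective fun (v : ∀ k, A k) k => f k (v k) :=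
  ⟨fun _ _ h => funext fun k => (hf k).1 (congrFun h k), fun b =>
    ⟨fun k => ((hf k).2 (b k)).choose, funext fun k => ((hf k).2 (b k)).choose_spec⟩⟩

variable [∀ j, IsManifold (𝓡 (d j)) ∞ (M j)] [∀ j, IsManifold (𝓡 (n j)) ∞ (Q j)]

/-- If the flows are represented by maps `f j` in charts, then so are the defining equations of the
partial fiber product. -/
theorem transversalAt_iff_of_chart_representation [∀ j, T2Space (M j)] (hδ : ∀ j, 0 < δ j)
    {σ : ∀ j, SymplecticForm (d j) (M j)} {ι : ∀ j, Q j → M j × M (j + 1)}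
    (hι : ∀ j, ContMDiff (𝓡 (n j)) ((𝓡 (d j)).prod (𝓡 (d (j + 1)))) ∞ (ι j))
    {I : Set (Fin (r + 1))} {H : ∀ j, HamiltonianSpace (d j) (M j) (δ j)} {p₀ p : ∀ j, Q j}
    {a b : ∀ i, M i} {f : ∀ j : {j : Fin (r + 1) // j + 1 ∈ I},
      EuclideanSpace ℝ (Fin (d (j.1 + 1))) → EuclideanSpace ℝ (Fin (d (j.1 + 1)))}
    (hp : ∀ j, p j ∈ (extChartAt (𝓡 (n j)) (p₀ j)).source)
    (ha : ∀ j : {j : Fin (r + 1) // j + 1 ∈ I},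
      (ι j.1 (p j.1)).2 ∈ (extChartAt (𝓡 (d (j.1 + 1))) (a (j.1 + 1))).source)
    (hb : ∀ j : {j : Fin (r + 1) // j + 1 ∈ I},
      (ι (j.1 + 1) (p (j.1 + 1))).1 ∈ (extChartAt (𝓡 (d (j.1 + 1))) (b (j.1 + 1))).source)
    (hf : ∀ j, DifferentiableAt ℝ (f j)
      (extChartAt (𝓡 (d (j.1 + 1))) (a (j.1 + 1)) (ι j.1 (p j.1)).2))
    (hfb : ∀ j, f j (extChartAt (𝓡 (d (j.1 + 1))) (a (j.1 + 1)) (ι j.1 (p j.1)).2) ∈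
      (extChartAt (𝓡 (d (j.1 + 1))) (b (j.1 + 1))).target)
    (htraj : ∀ j : {j : Fin (r + 1) // j + 1 ∈ I},
      ∀ᶠ y in 𝓝 (extChartAt (𝓡 (d (j.1 + 1))) (a (j.1 + 1)) (ι j.1 (p j.1)).2),
      ∃ γ : ℝ → M (j.1 + 1), γ 0 = (extChartAt (𝓡 (d (j.1 + 1))) (a (j.1 + 1))).symm y ∧
      γ (δ (j.1 + 1)) = (extChartAt (𝓡 (d (j.1 + 1))) (b (j.1 + 1))).symm (f j y) ∧
      IsTrajectoryOn (σ (j.1 + 1)) (zeroExtend (H (j.1 + 1)).1) 0 (δ (j.1 + 1)) γ)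
    {g : Coordinates n → Constraints d I}
    (hg : ∀ x j, g x j = f j (writtenInCharts (fun q => (ι j.1 q).2) (p₀ j.1) (a (j.1 + 1)) (x j.1)) -
      writtenInCharts (fun q => (ι (j.1 + 1) q).1) (p₀ (j.1 + 1)) (b (j.1 + 1)) (x (j.1 + 1))) :
    TransversalAt (n := n) σ ι I H p ↔ (g (fun j => extChartAt (𝓡 (n j)) (p₀ j) (p j)) = 0 →
      Function.Surjective (fderiv ℝ g fun j => extChartAt (𝓡 (n j)) (p₀ j) (p j))) := by
  set x : Coordinates n := fun j => extChartAt (𝓡 (n j)) (p₀ j) (p j) with hx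
  have hflow := fun j : {j : Fin (r + 1) // j + 1 ∈ I} =>
    flow_of_chart_representation (hδ (j.1 + 1)) (ha j) (hf j) (hfb j) (htraj j)
  have hsymm : ∀ j, (extChartAt (𝓡 (n j)) (p₀ j)).symm (x j) = p j := fun j =>
    (extChartAt (𝓡 (n j)) (p₀ j)).left_inv (hp j)
  have hu : ∀ j : {j : Fin (r + 1) // j + 1 ∈ I},
      writtenInCharts (fun q => (ι j.1 q).2) (p₀ j.1) (a (j.1 + 1)) (x j.1) =
      extChartAt (𝓡 (d (j.1 + 1))) (a (j.1 + 1)) (ι j.1 (p j.1)).2 := fun j => by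
    rw [writtenInCharts, hsymm]
  have hw : ∀ j : {j : Fin (r + 1) // j + 1 ∈ I},
      writtenInCharts (fun q => (ι (j.1 + 1) q).1) (p₀ (j.1 + 1)) (b (j.1 + 1)) (x (j.1 + 1)) =
      extChartAt (𝓡 (d (j.1 + 1))) (b (j.1 + 1)) (ι (j.1 + 1) (p (j.1 + 1))).1 := fun j => by
    rw [writtenInCharts, hsymm]
  have hzero : p ∈ partialFiberProduct σ ι H I ↔ g x = 0 := by
    rw [funext_iff, Subtype.forall]
    refine forall_congr' fun j => forall_congr' fun hj => ?_
    obtain ⟨h1, h2, -⟩ := hflow ⟨j, hj⟩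
    rw [hg, hu, hw, Pi.zero_apply, sub_eq_zero]
    dsimp only at h1 h2 ⊢
    rw [and_iff_right h1, h2]
    refine ⟨fun h => ?_, fun h => ?_⟩
    · rw [← h, (extChartAt _ _).right_inv (hfb ⟨j, hj⟩)]
    · rw [h, (extChartAt _ _).left_inv (hb ⟨j, hj⟩)]
  rw [transversalAt_iff hι, hzero]
  refine forall_congr' fun hgx => ?_
  have hpf := hzero.2 hgx
  have hι1 : ∀ j, ContMDiff (𝓡 (n j)) (𝓡 (d j)) ∞ fun q => (ι j q).1 := fun j =>
    contMDiff_fst.comp (hι j)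
  have hι2 : ∀ j, ContMDiff (𝓡 (n j)) (𝓡 (d (j + 1))) ∞ fun q => (ι j q).2 := fun j =>
    contMDiff_snd.comp (hι j)
  have hderiv : ∀ j : {j : Fin (r + 1) // j + 1 ∈ I}, HasFDerivAt (fun x => g x j)
      ((fderiv ℝ (f j) (extChartAt (𝓡 (d (j.1 + 1))) (a (j.1 + 1)) (ι j.1 (p j.1)).2)).comp
        (((chartD (a (j.1 + 1)) (ι j.1 (p j.1)).2).comp ((derivAt (fun q => (ι j.1 q).2) (p j.1)).comp
          (chartSymmD (p₀ j.1) (x j.1)))).comp (ContinuousLinearMap.proj j.1)) -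
        ((chartD (b (j.1 + 1)) (ι (j.1 + 1) (p (j.1 + 1))).1).comp
          ((derivAt (fun q => (ι (j.1 + 1) q).1) (p (j.1 + 1))).comp
          (chartSymmD (p₀ (j.1 + 1)) (x (j.1 + 1))))).comp (ContinuousLinearMap.proj (j.1 + 1))) x := by
    intro j
    have e1 := (hasFDerivAt_writtenInCharts (hι2 j.1) (hp j.1) (ha j)).comp x
      (hasFDerivAt_apply (𝕜 := ℝ) j.1 x)
    have e2 := (hasFDerivAt_writtenInCharts (hι1 (j.1 + 1)) (hp (j.1 + 1)) (hb j)).comp x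
      (hasFDerivAt_apply (𝕜 := ℝ) (j.1 + 1) x)
    have e3 := (hf j).hasFDerivAt
    rw [← hu j] at e3
    have e4 := (e3.comp x e1).sub e2
    rw [hu j] at e4
    exact e4.congr_of_eventuallyEq (Filter.Eventually.of_forall fun y => hg y j)
  have hfd := (hasFDerivAt_pi.2 hderiv).fderiv
  -- At a solution the flow ends at `m_i'`, so the derivatives of the charts there and at `p`
  -- intertwine the intrinsic linearization with minus the derivative of `g`.
  refine Function.Bijective.surjective_iff_of_comp_eq_neg
    (bijective_piMap fun j : {j : Fin (r + 1) // j + 1 ∈ I} => bijective_chartD (b (j.1 + 1)) (hb j))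
    (bijective_piMap fun j => bijective_chartD (p₀ j) (hp j)) fun u => ?_
  funext j
  obtain ⟨-, -, h3⟩ := hflow j
  rw [(hpf j.1 j.2).2] at h3
  have hcs : ∀ j, chartSymmD (p₀ j) (x j) (chartD (p₀ j) (p j) (u j)) = u j := fun j => by
    have := chartSymmD_chartD (p₀ j) ((extChartAt (𝓡 (n j)) (p₀ j)).map_source (hp j)) (u j)
    rwa [(extChartAt (𝓡 (n j)) (p₀ j)).left_inv (hp j)] at this
  rw [Pi.neg_apply]
  erw [hfd]
  simp only [linearizedMap, map_sub, h3, ContinuousLinearMap.pi_apply, sub_apply,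
    ContinuousLinearMap.comp_apply, ContinuousLinearMap.proj_apply, hcs, neg_sub]

end LocalModel

theorem HamiltonianSpace.perturb_zero {d : ℕ} {M : Type*} [TopologicalSpace M]
    [ChartedSpace (EuclideanSpace ℝ (Fin d)) M] {δ : ℝ} {S : Type} [NormedAddCommGroup S]
    [NormedSpace ℝ S] (H : HamiltonianSpace d M δ) {Φ : ℝ → M → S →L[ℝ] ℝ}
    (hΦ : ContMDiffOn (𝓘(ℝ, ℝ).prod (𝓡 d)) 𝓘(ℝ, S →L[ℝ] ℝ) ∞ (fun p : ℝ × M => Φ p.1 p.2)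
      (Icc 0 δ ×ˢ univ)) : H.perturb hΦ 0 = H := by
  refine Subtype.ext (funext fun t => funext fun x => ?_)
  change zeroExtend H.1 t x + Φ t x 0 = H.1 t x
  rw [map_zero, add_zero, zeroExtend, dif_pos t.2]

/-! ### Coordinate model of the perturbed equations -/

section LocalModel

variable {r : ℕ} {d n : Fin (r + 1) → ℕ} {M Q : Fin (r + 1) → Type*} {δ : Fin (r + 1) → ℝ}
  [∀ j, TopologicalSpace (M j)] [∀ j, ChartedSpace (EuclideanSpace ℝ (Fin (d j))) (M j)]
  [∀ j, TopologicalSpace (Q j)] [∀ j, ChartedSpace (EuclideanSpace ℝ (Fin (n j))) (Q j)]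
  [∀ j, IsManifold (𝓡 (d j)) ∞ (M j)] [∀ j, IsManifold (𝓡 (n j)) ∞ (Q j)]

/-- Near a solution `p₀` of the defining equations for `H₀`, the equations for perturbations
`P H s` of nearby Hamiltonians `H` are represented in coordinates by a `C1Family` which, at the
given solution, is a submersion in the parameter `s`. -/
theorem exists_local_model [∀ j, T2Space (M j)] (hδ : ∀ j, 0 < δ j)
    {σ : ∀ j, SymplecticForm (d j) (M j)} {ι : ∀ j, Q j → M j × M (j + 1)}
    (hι : ∀ j, ContMDiff (𝓡 (n j)) ((𝓡 (d j)).prod (𝓡 (d (j + 1)))) ∞ (ι j))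
    {I : Set (Fin (r + 1))} [DecidablePred fun j : Fin (r + 1) => j + 1 ∈ I]
    {H₀ : ∀ j, HamiltonianSpace (d j) (M j) (δ j)} {p₀ : ∀ j, Q j}
    (hdom : ∀ j, (ι j (p₀ j)).2 ∈ flowDomain (σ (j + 1)) (H₀ (j + 1)))
    (hp₀ : p₀ ∈ partialFiberProduct σ ι H₀ I) :
    ∃ (G : (∀ j, HamiltonianSpace (d j) (M j) (δ j)) → Constraints d I × Coordinates n →
        Constraints d I)
      (P : (∀ j, HamiltonianSpace (d j) (M j) (δ j)) → Constraints d I →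
        ∀ j, HamiltonianSpace (d j) (M j) (δ j)),
      C1Family G H₀ (0, fun j => extChartAt (𝓡 (n j)) (p₀ j) (p₀ j)) ∧
      (∀ s, fderiv ℝ (G H₀) (0, fun j => extChartAt (𝓡 (n j)) (p₀ j) (p₀ j)) (s, 0) = s) ∧
      (∀ H, Filter.Tendsto (P H) (𝓝 0) (𝓝 H)) ∧ (∀ H, P H 0 = H) ∧
      ∀ᶠ q : (∀ j, HamiltonianSpace (d j) (M j) (δ j)) × (Constraints d I × ∀ j, Q j) in
        𝓝 (H₀, (0, p₀)), TransversalAt (n := n) σ ι I (P q.1 q.2.1) q.2.2 ↔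
          (G q.1 (q.2.1, fun j => extChartAt (𝓡 (n j)) (p₀ j) (q.2.2 j)) = 0 →
            Function.Surjective ((fderiv ℝ (G q.1)
              (q.2.1, fun j => extChartAt (𝓡 (n j)) (p₀ j) (q.2.2 j))).comp
                (ContinuousLinearMap.inr ℝ (Constraints d I) (Coordinates n)))) := by
  choose γ' hγ'0 hγ' using fun j => mem_flowDomain_iff.1 (hdom j)
  obtain ⟨γ, hγeq⟩ := exists_reindex (A := fun i => ℝ → M i) γ'
  have hγ : ∀ i, IsTrajectoryOn (σ i) (zeroExtend (H₀ i).1) 0 (δ i) (γ i) :=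
    forall_of_forall_add_one fun j => by rw [hγeq]; exact hγ' j
  have hγ0 : ∀ j, γ (j + 1) 0 = (ι j (p₀ j)).2 := fun j => by rw [hγeq]; exact hγ'0 j
  have hγδ : ∀ j, j + 1 ∈ I → γ (j + 1) (δ (j + 1)) = (ι (j + 1) (p₀ (j + 1))).1 := fun j hj => by
    rw [← (hp₀ j hj).2, ← hγ0, (hamiltonianFlow_eq (hδ (j + 1)) (hγ (j + 1))).2]
  choose Φ hΦ F cF eF tF dF using fun i => exists_control (hδ i) (hγ i)
  obtain ⟨L, hL⟩ := exists_extension d I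
  set x₀ : Coordinates n := fun j => extChartAt (𝓡 (n j)) (p₀ j) (p₀ j) with hx₀
  set a : ∀ i, M i := fun i => γ i 0 with ha
  set b : ∀ i, M i := fun i => γ i (δ i) with hb
  have hι1 : ∀ j, ContMDiff (𝓡 (n j)) (𝓡 (d j)) ∞ fun q => (ι j q).1 := fun j =>
    contMDiff_fst.comp (hι j)
  have hι2 : ∀ j, ContMDiff (𝓡 (n j)) (𝓡 (d (j + 1))) ∞ fun q => (ι j q).2 := fun j =>
    contMDiff_snd.comp (hι j)
  have hsymm : ∀ j, (extChartAt (𝓡 (n j)) (p₀ j)).symm (x₀ j) = p₀ j := fun j =>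
    extChartAt_to_inv (p₀ j)
  set u : ∀ j : Fin (r + 1), EuclideanSpace ℝ (Fin (n j)) → EuclideanSpace ℝ (Fin (d (j + 1))) :=
    fun j => writtenInCharts (fun q => (ι j q).2) (p₀ j) (a (j + 1)) with hu
  set w : ∀ j : Fin (r + 1), EuclideanSpace ℝ (Fin (n (j + 1))) →
      EuclideanSpace ℝ (Fin (d (j + 1))) :=
    fun j => writtenInCharts (fun q => (ι (j + 1) q).1) (p₀ (j + 1)) (b (j + 1)) with hw
  have hsa : ∀ j, (ι j (p₀ j)).2 ∈ (extChartAt (𝓡 (d (j + 1))) (a (j + 1))).source := fun j => by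
    rw [← hγ0 j]; exact mem_extChartAt_source _
  have hsb : ∀ j, j + 1 ∈ I →
      (ι (j + 1) (p₀ (j + 1))).1 ∈ (extChartAt (𝓡 (d (j + 1))) (b (j + 1))).source := fun j hj => by
    rw [← hγδ j hj]; exact mem_extChartAt_source _
  have hux : ∀ j, u j (x₀ j) = extChartAt (𝓡 (d (j + 1))) (γ (j + 1) 0) (γ (j + 1) 0) := fun j => by
    simp only [hu, writtenInCharts, hsymm, ← hγ0, ha]
  -- For each `i = j + 1` in `I`: the controlled end point reached from `m_i`, minus `m_i'`, both in
  -- charts. Each equation has its own control `z.1 j`.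
  set G : (∀ j, HamiltonianSpace (d j) (M j) (δ j)) → Constraints d I × Coordinates n →
    Constraints d I := fun H z j =>
      F (j.1 + 1) (H (j.1 + 1)) (u j.1 (z.2 j.1), z.1 j) - w j.1 (z.2 (j.1 + 1)) with hG
  have cκ : ∀ j : {j : Fin (r + 1) // j + 1 ∈ I}, C1Family
      (fun (_ : ∀ j, HamiltonianSpace (d j) (M j) (δ j)) (z : Constraints d I × Coordinates n) =>
        (u j.1 (z.2 j.1), z.1 j)) H₀ (0, x₀) := by
    intro j
    obtain ⟨hUo, hUs⟩ := contDiffOn_writtenInCharts (hι2 j.1) (p₀ j.1) (a (j.1 + 1))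
    have hz : ContDiff ℝ ∞ fun z : Constraints d I × Coordinates n => z.2 j.1 :=
      ((ContinuousLinearMap.proj j.1).comp
        (ContinuousLinearMap.snd ℝ (Constraints d I) (Coordinates n))).contDiff
    have hz' : ContDiff ℝ ∞ fun z : Constraints d I × Coordinates n => z.1 j :=
      ((ContinuousLinearMap.proj j).comp
        (ContinuousLinearMap.fst ℝ (Constraints d I) (Coordinates n))).contDiff
    refine C1Family.const (hUo.preimage hz.continuous)
      ((hUs.comp hz.contDiffOn fun z hz => hz).prodMk hz'.contDiffOn) ⟨mem_extChartAt_target _, ?_⟩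
    change ((ι j.1 ((extChartAt (𝓡 (n j.1)) (p₀ j.1)).symm (x₀ j.1))).2) ∈
      (extChartAt (𝓡 (d (j.1 + 1))) (a (j.1 + 1))).source
    rw [hsymm]
    exact hsa j.1
  have cw : ∀ j : {j : Fin (r + 1) // j + 1 ∈ I}, C1Family
      (fun (_ : ∀ j, HamiltonianSpace (d j) (M j) (δ j)) (z : Constraints d I × Coordinates n) =>
        w j.1 (z.2 (j.1 + 1))) H₀ (0, x₀) := by
    intro j
    obtain ⟨hUo, hUs⟩ := contDiffOn_writtenInCharts (hι1 (j.1 + 1)) (p₀ (j.1 + 1)) (b (j.1 + 1))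
    have hz : ContDiff ℝ ∞ fun z : Constraints d I × Coordinates n => z.2 (j.1 + 1) :=
      ((ContinuousLinearMap.proj (j.1 + 1)).comp
        (ContinuousLinearMap.snd ℝ (Constraints d I) (Coordinates n))).contDiff
    refine C1Family.const (hUo.preimage hz.continuous)
      (hUs.comp hz.contDiffOn fun z hz => hz) ⟨mem_extChartAt_target _, ?_⟩
    change ((ι (j.1 + 1) ((extChartAt (𝓡 (n (j.1 + 1))) (p₀ (j.1 + 1))).symm (x₀ (j.1 + 1)))).1) ∈
      (extChartAt (𝓡 (d (j.1 + 1))) (b (j.1 + 1))).source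
    rw [hsymm]
    exact hsb j.1 j.2
  have cF' : ∀ j : {j : Fin (r + 1) // j + 1 ∈ I}, C1Family
      (fun (H : ∀ j, HamiltonianSpace (d j) (M j) (δ j)) => F (j.1 + 1) (H (j.1 + 1))) H₀
      (u j.1 (x₀ j.1), 0) := by
    intro j
    rw [hux]
    exact (cF (j.1 + 1)).comp_param (g := fun H : ∀ j, HamiltonianSpace (d j) (M j) (δ j) =>
      H (j.1 + 1)) (continuousAt_apply _ _)
  have cFκ : ∀ j : {j : Fin (r + 1) // j + 1 ∈ I}, C1Family
      (fun (H : ∀ j, HamiltonianSpace (d j) (M j) (δ j)) (z : Constraints d I × Coordinates n) =>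
        F (j.1 + 1) (H (j.1 + 1)) (u j.1 (z.2 j.1), z.1 j)) H₀ (0, x₀) := fun j =>
    (cF' j).comp_of_eq (cκ j) rfl
  have cG : C1Family G H₀ (0, x₀) := C1Family.pi fun j => (cFκ j).sub (cw j)
  refine ⟨G, fun H s i => (H i).perturb (hΦ i) (L s i), cG, fun s => ?_, fun H => ?_, fun H => ?_, ?_⟩
  -- The operators `A` and `B` see only the coordinate part and vanish on `(s, 0)`. What remains is
  -- the derivative of `F` in the control, which is the identity, so their exact form is irrelevant.
  · have hcomp : ∀ j : {j : Fin (r + 1) // j + 1 ∈ I}, ∃ A : EuclideanSpace ℝ (Fin (n (j.1 + 1))) →L[ℝ] _,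
        ∃ B : EuclideanSpace ℝ (Fin (n j.1)) →L[ℝ] _, HasFDerivAt (fun z => G H₀ z j)
          ((fderiv ℝ (F (j.1 + 1) (H₀ (j.1 + 1))) (u j.1 (x₀ j.1), 0)).comp
            ((B.comp ((ContinuousLinearMap.proj j.1).comp
              (ContinuousLinearMap.snd ℝ (Constraints d I) (Coordinates n)))).prod
              ((ContinuousLinearMap.proj j).comp (ContinuousLinearMap.fst ℝ _ _))) -
            A.comp ((ContinuousLinearMap.proj (j.1 + 1)).comp
              (ContinuousLinearMap.snd ℝ (Constraints d I) (Coordinates n)))) (0, x₀) := by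
      intro j
      have e1 := hasFDerivAt_writtenInCharts (hι2 j.1) (mem_extChartAt_source (I := 𝓡 (n j.1)) (p₀ j.1))
        (hsa j.1)
      have e2 := hasFDerivAt_writtenInCharts (hι1 (j.1 + 1))
        (mem_extChartAt_source (I := 𝓡 (n (j.1 + 1))) (p₀ (j.1 + 1))) (hsb j.1 j.2)
      have e3 : HasFDerivAt (F (j.1 + 1) (H₀ (j.1 + 1))) _ (u j.1 (x₀ j.1), 0) :=
        ((cF' j).contDiffAt.self_of_nhds.differentiableAt (by simp)).hasFDerivAt
      have hs : HasFDerivAt (fun z : Constraints d I × Coordinates n => z.2 j.1)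
          ((ContinuousLinearMap.proj j.1).comp
            (ContinuousLinearMap.snd ℝ (Constraints d I) (Coordinates n))) (0, x₀) :=
        ((ContinuousLinearMap.proj j.1).comp
            (ContinuousLinearMap.snd ℝ (Constraints d I) (Coordinates n))).hasFDerivAt
      have hs' : HasFDerivAt (fun z : Constraints d I × Coordinates n => z.2 (j.1 + 1))
          ((ContinuousLinearMap.proj (j.1 + 1)).comp
            (ContinuousLinearMap.snd ℝ (Constraints d I) (Coordinates n))) (0, x₀) :=
        ((ContinuousLinearMap.proj (j.1 + 1)).comp
            (ContinuousLinearMap.snd ℝ (Constraints d I) (Coordinates n))).hasFDerivAt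
      have hf : HasFDerivAt (fun z : Constraints d I × Coordinates n => z.1 j)
          ((ContinuousLinearMap.proj j).comp
            (ContinuousLinearMap.fst ℝ (Constraints d I) (Coordinates n))) (0, x₀) :=
        ((ContinuousLinearMap.proj j).comp
            (ContinuousLinearMap.fst ℝ (Constraints d I) (Coordinates n))).hasFDerivAt
      have e4 := HasFDerivAt.comp (0, x₀) e3 ((HasFDerivAt.comp (0, x₀) e1 hs).prodMk hf)
      exact ⟨_, _, e4.sub (HasFDerivAt.comp (g := w j.1) (0, x₀) e2 hs')⟩
    choose A B hAB using hcomp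
    have h1 := (hasFDerivAt_pi.2 hAB).fderiv
    refine (DFunLike.congr_fun h1 (s, 0)).trans ?_
    funext j
    have h2 := dF (j.1 + 1) (s j)
    rw [← hux] at h2
    simpa using h2
  · refine tendsto_pi_nhds.2 fun i => ((H i).tendsto_perturb (hδ i) (hΦ i)).comp ?_
    have : Continuous fun s => L s i := (continuous_apply i).comp L.continuous
    simpa using this.tendsto 0
  · funext i
    simp only [map_zero]
    exact (H i).perturb_zero (hΦ i)
  · set ζ : (∀ j, HamiltonianSpace (d j) (M j) (δ j)) × (Constraints d I × ∀ j, Q j) →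
        (∀ j, HamiltonianSpace (d j) (M j) (δ j)) × (Constraints d I × Coordinates n) := fun q =>
      (q.1, (q.2.1, fun j => extChartAt (𝓡 (n j)) (p₀ j) (q.2.2 j))) with hζ
    have hpj : ∀ j, Filter.Tendsto (fun q : (∀ j, HamiltonianSpace (d j) (M j) (δ j)) ×
        (Constraints d I × ∀ j, Q j) => q.2.2 j) (𝓝 (H₀, (0, p₀))) (𝓝 (p₀ j)) := fun j =>
      (((continuous_apply j).comp continuous_snd).comp continuous_snd).tendsto _
    have hζc : Filter.Tendsto ζ (𝓝 (H₀, (0, p₀))) (𝓝 (H₀, (0, x₀))) := by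
      refine continuousAt_fst.prodMk_nhds (Filter.Tendsto.prodMk_nhds continuousAt_snd.fst
        (tendsto_pi_nhds.2 fun j => ?_))
      exact (continuousAt_extChartAt (p₀ j)).tendsto.comp (hpj j)
    have E1 := Filter.eventually_all.2 fun j =>
      (hpj j).eventually (extChartAt_source_mem_nhds (I := 𝓡 (n j)) (p₀ j))
    have E2 := Filter.eventually_all.2 fun j : {j : Fin (r + 1) // j + 1 ∈ I} =>
      (((hι2 j.1).continuous.tendsto _).comp (hpj j.1)).eventually
        ((isOpen_extChartAt_source _).mem_nhds (hsa j.1))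
    have E3 := Filter.eventually_all.2 fun j : {j : Fin (r + 1) // j + 1 ∈ I} =>
      (((hι1 (j.1 + 1)).continuous.tendsto _).comp (hpj (j.1 + 1))).eventually
        ((isOpen_extChartAt_source _).mem_nhds (hsb j.1 j.2))
    have hκc : ∀ j : {j : Fin (r + 1) // j + 1 ∈ I}, Filter.Tendsto
        (fun q : (∀ j, HamiltonianSpace (d j) (M j) (δ j)) × (Constraints d I × ∀ j, Q j) =>
          (u j.1 ((ζ q).2.2 j.1), q.2.1 j)) (𝓝 (H₀, (0, p₀))) (𝓝 (u j.1 (x₀ j.1), 0)) := fun j =>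
      (cκ j).continuousAt.tendsto.comp hζc
    have E4 := Filter.eventually_all.2 fun j =>
      (continuousAt_fst.tendsto.prodMk_nhds (hκc j)).eventually (cF' j).contDiffAt
    have E5 := Filter.eventually_all.2 fun j : {j : Fin (r + 1) // j + 1 ∈ I} =>
      ((cFκ j).continuousAt.tendsto.comp hζc).eventually
        (show (extChartAt (𝓡 (d (j.1 + 1))) (b (j.1 + 1))).target ∈ 𝓝 _ by
          refine (isOpen_target _).mem_nhds ?_
          change F (j.1 + 1) (H₀ (j.1 + 1)) (u j.1 (x₀ j.1), 0) ∈ _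
          rw [hux, eF]
          exact mem_extChartAt_target _)
    -- The nested `eventually` is required because identifying the derivative of the flow uses
    -- trajectories from a whole neighbourhood of each initial point.
    have E6 := Filter.eventually_all.2 fun j : {j : Fin (r + 1) // j + 1 ∈ I} =>
      (Filter.Tendsto.prodMk_nhds (((continuous_apply (j.1 + 1)).comp continuous_fst).tendsto
        ((H₀, (0, p₀)) : (∀ j, HamiltonianSpace (d j) (M j) (δ j)) × (Constraints d I × ∀ j, Q j)))
        (hκc j)).eventually (show ∀ᶠ q' in 𝓝 (H₀ (j.1 + 1), (u j.1 (x₀ j.1), 0)), _ by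
          rw [hux]; exact (eventually_eventually_nhds.2 (tF (j.1 + 1))))
    filter_upwards [E1, E2, E3, E4, E5, E6, hζc.eventually cG.contDiffAt]
      with q h1 h2 h3 h4 h5 h6 h7
    obtain ⟨H, s, p⟩ := q
    dsimp only [hζ] at h1 h2 h3 h4 h5 h6 h7 ⊢
    have hup : ∀ j, u j (extChartAt (𝓡 (n j)) (p₀ j) (p j)) =
        extChartAt (𝓡 (d (j + 1))) (a (j + 1)) (ι j (p j)).2 := fun j => by
      simp only [hu, writtenInCharts, (extChartAt (𝓡 (n j)) (p₀ j)).left_inv (h1 j)]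
    have h7' : HasFDerivAt (G H) (fderiv ℝ (G H)
        (s, fun j => extChartAt (𝓡 (n j)) (p₀ j) (p j)))
        (s, fun j => extChartAt (𝓡 (n j)) (p₀ j) (p j)) :=
      (h7.differentiableAt (by simp)).hasFDerivAt
    have h8 : fderiv ℝ (fun x => G H (s, x)) (fun j => extChartAt (𝓡 (n j)) (p₀ j) (p j)) =
        (fderiv ℝ (G H) (s, fun j => extChartAt (𝓡 (n j)) (p₀ j) (p j))).comp
          (ContinuousLinearMap.inr ℝ (Constraints d I) (Coordinates n)) :=
      (HasFDerivAt.comp (f := fun x => (s, x)) _ h7' (hasFDerivAt_prodMk_right s _)).fderiv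
    rw [← h8]
    refine transversalAt_iff_of_chart_representation (a := a) (b := b)
      (f := fun j y => F (j.1 + 1) (H (j.1 + 1)) (y, s j)) hδ hι h1 h2 h3 (fun j => ?_) (fun j => ?_)
      (fun j => ?_) fun x j => rfl
    · rw [← hup]
      exact DifferentiableAt.comp (f := fun y => (y, s j)) _ ((h4 j).differentiableAt (by simp))
        (differentiableAt_id.prodMk (differentiableAt_const (s j)))
    · have := h5 j
      rwa [← hup]
    · have hc : Filter.Tendsto (fun y => (H (j.1 + 1), (y, s j)))
          (𝓝 (extChartAt (𝓡 (d (j.1 + 1))) (a (j.1 + 1)) (ι j.1 (p j.1)).2))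
          (𝓝 (H (j.1 + 1), (u j.1 (extChartAt (𝓡 (n j.1)) (p₀ j.1) (p j.1)), s j))) := by
        rw [hup]
        exact tendsto_const_nhds.prodMk_nhds (Filter.tendsto_id.prodMk_nhds tendsto_const_nhds)
      filter_upwards [hc.eventually (h6 j)] with y hy
      rw [hL]
      exact hy

end LocalModel

/-! ## Density of transversality -/

/-- Finiteness replaces the Baire property of the space. -/
theorem Set.Finite.dense_biInter_of_isOpen {X κ : Type*} [TopologicalSpace X] {t : Set κ}
    (ht : t.Finite) {f : κ → Set X} (ho : ∀ k ∈ t, IsOpen (f k)) (hd : ∀ k ∈ t, Dense (f k)) :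
    Dense (⋂ k ∈ t, f k) := by
  induction t, ht using Set.Finite.induction_on with
  | empty => simp
  | @insert a s _ hs ih =>
    rw [biInter_insert]
    exact (hd a (mem_insert _ _)).inter_of_isOpen_left
      (ih (fun k hk => ho k (mem_insert_of_mem _ hk)) fun k hk => hd k (mem_insert_of_mem _ hk))
      (ho a (mem_insert _ _))

/-- The tube lemma: a condition open in pairs and valid along a compact set persists for nearby
parameters. -/
theorem isOpen_inter_setOf_forall {Λ X : Type*} [TopologicalSpace Λ] [TopologicalSpace X]
    {D : Set Λ} (hD : IsOpen D) {T : Λ → X → Prop}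
    (hT : ∀ H ∈ D, ∀ p, T H p → ∀ᶠ q : Λ × X in 𝓝 (H, p), T q.1 q.2) {K : Set X}
    (hK : IsCompact K) : IsOpen (D ∩ {H | ∀ p ∈ K, T H p}) := by
  refine isOpen_iff_mem_nhds.2 fun H hH => Filter.inter_mem (hD.mem_nhds hH.1) ?_
  exact hK.eventually_forall_of_forall_eventually fun p hp => hT H hH.1 p (hH.2 p hp)

/-- If an open condition on `Λ × X`, with `X` compact, is locally in `X` dense in `Λ`, then it is
dense. -/
theorem dense_inter_setOf_forall {Λ X : Type*} [TopologicalSpace Λ] [TopologicalSpace X]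
    [CompactSpace X] [LocallyCompactSpace X] {D : Set Λ} (hD : IsOpen D) (hDd : Dense D)
    {T : Λ → X → Prop} (hT : ∀ H ∈ D, ∀ p, T H p → ∀ᶠ q : Λ × X in 𝓝 (H, p), T q.1 q.2)
    (hl : ∀ H₀ ∈ D, ∀ p, ∃ K ∈ 𝓝 p, ∀ᶠ H in 𝓝 H₀, H ∈ closure {H' | ∀ x ∈ K, T H' x}) :
    Dense (D ∩ {H | ∀ p, T H p}) := by
  refine dense_closure.1 (hDd.mono fun H₀ hH₀ => ?_)
  have hmono : ∀ {K K' : Set X}, K' ⊆ K → {H | ∀ x ∈ K, T H x} ⊆ {H | ∀ x ∈ K', T H x} :=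
    fun hs _ h x hx => h x (hs hx)
  have hl' : ∀ p, ∃ K ∈ 𝓝 p, IsCompact K ∧
      ∀ᶠ H in 𝓝 H₀, H ∈ closure {H' | ∀ x ∈ K, T H' x} := fun p => by
    obtain ⟨K, hK, h⟩ := hl H₀ hH₀ p
    obtain ⟨K', hK', hs, hc⟩ := local_compact_nhds hK
    exact ⟨K', hK', hc, h.mono fun H hH => closure_mono (hmono hs) hH⟩
  choose K hK hKc hKl using hl'
  obtain ⟨t, -, ht⟩ := isCompact_univ.elim_nhds_subcover K fun p _ => hK p
  have hV := (Filter.eventually_all_finset t).2 fun p _ => hKl p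
  obtain ⟨V, hVs, hVo, hV₀⟩ := eventually_nhds_iff.1 (hV.and (hD.mem_nhds hH₀))
  -- Each condition is dense only near `H₀`. Adding the complement of `closure V` makes it open and
  -- dense everywhere, so the finite intersection is dense; on `V` the added part is empty.
  have hB : Dense (⋂ p ∈ (t : Set X), (D ∩ {H | ∀ x ∈ K p, T H x}) ∪ (closure V)ᶜ) := by
    refine t.finite_toSet.dense_biInter_of_isOpen
      (fun p _ => (isOpen_inter_setOf_forall hD hT (hKc p)).union isClosed_closure.isOpen_compl)
      fun p hp H => ?_
    by_cases hH : H ∈ closure V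
    · refine closure_mono subset_union_left (closure_minimal (fun H' hH' => ?_) isClosed_closure hH)
      exact hD.inter_closure ⟨(hVs H' hH').2, (hVs H' hH').1 p hp⟩
    · exact subset_closure (Or.inr hH)
  refine closure_mono ?_ (hVo.inter_closure ⟨hV₀, hB H₀⟩)
  rintro H ⟨hHV, hH⟩
  refine ⟨(hVs H hHV).2, fun x => ?_⟩
  obtain ⟨p, hp, hx⟩ := mem_iUnion₂.1 (ht (mem_univ x))
  exact ((mem_iInter₂.1 hH p hp).resolve_right (fun h => h (subset_closure hHV))).2 x hx

/-! ### Openness and local density of transversality -/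

section Density

variable {r : ℕ} {d n : Fin (r + 1) → ℕ} {M Q : Fin (r + 1) → Type*} {δ : Fin (r + 1) → ℝ}
  [∀ j, TopologicalSpace (M j)] [∀ j, ChartedSpace (EuclideanSpace ℝ (Fin (d j))) (M j)]
  [∀ j, TopologicalSpace (Q j)] [∀ j, ChartedSpace (EuclideanSpace ℝ (Fin (n j))) (Q j)]
  [∀ j, IsManifold (𝓡 (d j)) ∞ (M j)] [∀ j, T2Space (M j)]

/-- All flows involved are defined at `p₀`, so some equation must fail there. Both of its sides are
continuous in `(H, p)` with values in a Hausdorff space, and it keeps failing nearby. -/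
theorem eventually_notMem_partialFiberProduct (hδ : ∀ j, 0 < δ j)
    {σ : ∀ j, SymplecticForm (d j) (M j)} {ι : ∀ j, Q j → M j × M (j + 1)}
    (hι : ∀ j, Continuous (ι j)) {I : Set (Fin (r + 1))}
    {H₀ : ∀ j, HamiltonianSpace (d j) (M j) (δ j)} {p₀ : ∀ j, Q j}
    (hdom : ∀ j, (ι j (p₀ j)).2 ∈ flowDomain (σ (j + 1)) (H₀ (j + 1)))
    (hp₀ : p₀ ∉ partialFiberProduct σ ι H₀ I) :
    ∀ᶠ q : (∀ j, HamiltonianSpace (d j) (M j) (δ j)) × (∀ j, Q j) in 𝓝 (H₀, p₀),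
      q.2 ∉ partialFiberProduct σ ι q.1 I := by
  simp only [partialFiberProduct, mem_ofPred_eq, not_forall] at hp₀
  obtain ⟨j, hj, hne⟩ := hp₀
  replace hne := fun h => hne ⟨hdom j, h⟩
  have hp : ∀ j, ContinuousAt (fun q : (∀ j, HamiltonianSpace (d j) (M j) (δ j)) × (∀ j, Q j) =>
      ι j (q.2 j)) (H₀, p₀) := fun j =>
    ((hι j).comp ((continuous_apply j).comp continuous_snd)).continuousAt
  have hH : ContinuousAt (fun q : (∀ j, HamiltonianSpace (d j) (M j) (δ j)) × (∀ j, Q j) =>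
      q.1 (j + 1)) (H₀, p₀) := ((continuous_apply (j + 1)).comp continuous_fst).continuousAt
  have h1 : ContinuousAt (fun q : (∀ j, HamiltonianSpace (d j) (M j) (δ j)) × (∀ j, Q j) =>
      hamiltonianFlow (σ (j + 1)) (q.1 (j + 1)) (ι j (q.2 j)).2) (H₀, p₀) :=
    ContinuousAt.comp (x := (H₀, p₀)) (f := fun q => (q.1 (j + 1), (ι j (q.2 j)).2))
      (g := fun q : HamiltonianSpace (d (j + 1)) (M (j + 1)) (δ (j + 1)) × M (j + 1) =>
        hamiltonianFlow (σ (j + 1)) q.1 q.2) (tendsto_hamiltonianFlow (hδ (j + 1)) (hdom j))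
      (hH.prodMk (hp j).snd)
  filter_upwards [(h1.ne_iff_eventually_ne (hp (j + 1)).fst).1 hne] with q hq hq'
  exact hq (hq' j hj).2

variable [∀ j, IsManifold (𝓡 (n j)) ∞ (Q j)]

/-- Away from solutions the condition is vacuous nearby. At a solution, the local model with `s = 0`
turns it into surjectivity of a derivative varying continuously with `(H, p)`. -/
theorem eventually_transversalAt (hδ : ∀ j, 0 < δ j)
    {σ : ∀ j, SymplecticForm (d j) (M j)} {ι : ∀ j, Q j → M j × M (j + 1)}
    (hι : ∀ j, ContMDiff (𝓡 (n j)) ((𝓡 (d j)).prod (𝓡 (d (j + 1)))) ∞ (ι j))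
    {I : Set (Fin (r + 1))} {H₀ : ∀ j, HamiltonianSpace (d j) (M j) (δ j)} {p₀ : ∀ j, Q j}
    (hdom : ∀ j, (ι j (p₀ j)).2 ∈ flowDomain (σ (j + 1)) (H₀ (j + 1)))
    (h₀ : TransversalAt (n := n) σ ι I H₀ p₀) :
    ∀ᶠ q : (∀ j, HamiltonianSpace (d j) (M j) (δ j)) × (∀ j, Q j) in 𝓝 (H₀, p₀),
      TransversalAt (n := n) σ ι I q.1 q.2 := by
  classical
  by_cases hp₀ : p₀ ∈ partialFiberProduct σ ι H₀ I
  swap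
  · exact (eventually_notMem_partialFiberProduct hδ (fun j => (hι j).continuous) hdom hp₀).mono
      fun q hq hq' => absurd hq' hq
  obtain ⟨G, P, cG, -, -, hP, hev⟩ := exists_local_model hδ hι hdom hp₀
  set x₀ : Coordinates n := fun j => extChartAt (𝓡 (n j)) (p₀ j) (p₀ j) with hx₀
  have hc : Filter.Tendsto (fun q : (∀ j, HamiltonianSpace (d j) (M j) (δ j)) × (∀ j, Q j) =>
      (q.1, ((0 : Constraints d I), q.2))) (𝓝 (H₀, p₀)) (𝓝 (H₀, (0, p₀))) :=
    continuousAt_fst.prodMk_nhds (tendsto_const_nhds.prodMk_nhds continuousAt_snd)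
  have hc' : Filter.Tendsto (fun q : (∀ j, HamiltonianSpace (d j) (M j) (δ j)) × (∀ j, Q j) =>
      (q.1, ((0 : Constraints d I), (fun j => extChartAt (𝓡 (n j)) (p₀ j) (q.2 j) : Coordinates n))))
      (𝓝 (H₀, p₀)) (𝓝 (H₀, (0, x₀))) := by
    refine continuousAt_fst.prodMk_nhds (tendsto_const_nhds.prodMk_nhds
      (tendsto_pi_nhds.2 fun j => ?_))
    exact (continuousAt_extChartAt (p₀ j)).tendsto.comp
      ((continuous_apply j).comp continuous_snd).continuousAt
  have h0 := (hev.self_of_nhds).1 (by rw [hP]; exact h₀)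
  by_cases hG : G H₀ (0, x₀) = 0
  · have hs : Function.Surjective ((fderiv ℝ (G H₀) (0, x₀)).comp
      (ContinuousLinearMap.inr ℝ (Constraints d I) (Coordinates n))) := h0 hG
    have hcd : Filter.Tendsto (fun q : (∀ j, HamiltonianSpace (d j) (M j) (δ j)) × (∀ j, Q j) =>
        (fderiv ℝ (G q.1) (0, fun j => extChartAt (𝓡 (n j)) (p₀ j) (q.2 j))).comp
          (ContinuousLinearMap.inr ℝ (Constraints d I) (Coordinates n))) (𝓝 (H₀, p₀))
        (𝓝 ((fderiv ℝ (G H₀) (0, x₀)).comp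
          (ContinuousLinearMap.inr ℝ (Constraints d I) (Coordinates n)))) :=
      (((ContinuousLinearMap.compL ℝ (Coordinates n) (Constraints d I × Coordinates n)
        (Constraints d I)).flip (ContinuousLinearMap.inr ℝ _ _)).continuous.tendsto _).comp
        (cG.continuousAt_fderiv.tendsto.comp hc')
    filter_upwards [hcd.eventually (isOpen_setOf_surjective.mem_nhds hs), hc.eventually hev]
      with q h1 h2
    have := h2.2 fun _ => h1
    rwa [hP] at this
  · have hcG := cG.continuousAt.tendsto.comp hc'
    filter_upwards [hcG.eventually_ne hG, hc.eventually hev] with q h1 h2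
    have := h2.2 fun h => absurd h h1
    rwa [hP] at this

/-- Invertibility of the derivative in `s` at `H₀` persists on a neighbourhood of the form `U × B ×
V`, so `K` can be chosen before `H`. For each `H ∈ U`, regular parameters accumulate at `0`, and the
perturbations `P H s` tend to `H`. -/
theorem exists_nhds_eventually_mem_closure (hδ : ∀ j, 0 < δ j)
    {σ : ∀ j, SymplecticForm (d j) (M j)} {ι : ∀ j, Q j → M j × M (j + 1)}
    (hι : ∀ j, ContMDiff (𝓡 (n j)) ((𝓡 (d j)).prod (𝓡 (d (j + 1)))) ∞ (ι j))
    {I : Set (Fin (r + 1))} {H₀ : ∀ j, HamiltonianSpace (d j) (M j) (δ j)} {p₀ : ∀ j, Q j}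
    (hdom : ∀ j, (ι j (p₀ j)).2 ∈ flowDomain (σ (j + 1)) (H₀ (j + 1))) :
    ∃ K ∈ 𝓝 p₀, ∀ᶠ H in 𝓝 H₀, H ∈ closure {H' | ∀ p ∈ K, TransversalAt (n := n) σ ι I H' p} := by
  classical
  by_cases hp₀ : p₀ ∈ partialFiberProduct σ ι H₀ I
  swap
  · obtain ⟨U, hU, K, hK, h⟩ := Filter.eventually_prod_iff.1 (nhds_prod_eq (x := H₀) (y := p₀) ▸
      eventually_notMem_partialFiberProduct hδ (fun j => (hι j).continuous) hdom hp₀)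
    exact ⟨{p | K p}, hK, hU.mono fun H hH => subset_closure fun p hp hp' => absurd hp' (h hH hp)⟩
  obtain ⟨G, P, cG, hid, hPt, -, hev⟩ := exists_local_model hδ hι hdom hp₀
  set x₀ : Coordinates n := fun j => extChartAt (𝓡 (n j)) (p₀ j) (p₀ j) with hx₀
  have hcd : ContinuousAt (fun q : (∀ j, HamiltonianSpace (d j) (M j) (δ j)) ×
      (Constraints d I × Coordinates n) => (fderiv ℝ (G q.1) q.2).comp
        (ContinuousLinearMap.inl ℝ (Constraints d I) (Coordinates n))) (H₀, (0, x₀)) :=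
    (((ContinuousLinearMap.compL ℝ (Constraints d I) (Constraints d I × Coordinates n)
      (Constraints d I)).flip (ContinuousLinearMap.inl ℝ _ _)).continuous.tendsto _).comp
      cG.continuousAt_fderiv.tendsto
  have hsurj : ∀ᶠ q in 𝓝 (H₀, ((0 : Constraints d I), x₀)), Function.Surjective
      ((fderiv ℝ (G q.1) q.2).comp (ContinuousLinearMap.inl ℝ (Constraints d I) (Coordinates n))) :=
    hcd.eventually (isOpen_setOf_surjective.mem_nhds fun s => ⟨s, hid s⟩)
  have hreg := cG.contDiffAt.and hsurj
  rw [nhds_prod_eq, nhds_prod_eq] at hreg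
  obtain ⟨U₁, hU₁, Z, hZ, h1⟩ := Filter.eventually_prod_iff.1 hreg
  obtain ⟨B₁, hB₁, N, hN, h2⟩ := Filter.eventually_prod_iff.1 hZ
  rw [nhds_prod_eq, nhds_prod_eq] at hev
  obtain ⟨U₂, hU₂, Z', hZ', h3⟩ := Filter.eventually_prod_iff.1 hev
  obtain ⟨B₂, hB₂, K, hK, h4⟩ := Filter.eventually_prod_iff.1 hZ'
  obtain ⟨B, hBs, hBo, hB0⟩ := eventually_nhds_iff.1 hB₁
  obtain ⟨V, hVs, hVo, hV0⟩ := eventually_nhds_iff.1 hN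
  have hφ : ContinuousAt (fun (p : ∀ j, Q j) j => extChartAt (𝓡 (n j)) (p₀ j) (p j)) p₀ :=
    continuousAt_pi.2 fun j =>
      (continuousAt_extChartAt (p₀ j)).tendsto.comp (continuousAt_apply j p₀)
  refine ⟨{p | K p} ∩ (fun p j => extChartAt (𝓡 (n j)) (p₀ j) (p j)) ⁻¹' V,
    Filter.inter_mem hK (hφ.preimage_mem_nhds (hVo.mem_nhds hV0)), ?_⟩
  filter_upwards [hU₁, hU₂] with H hH₁ hH₂
  have hO : ∀ z ∈ B ×ˢ V, ContDiffAt ℝ ∞ (G H) z ∧ Function.Surjective ((fderiv ℝ (G H) z).comp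
      (ContinuousLinearMap.inl ℝ (Constraints d I) (Coordinates n))) := fun z hz =>
    h1 hH₁ (h2 (hBs z.1 hz.1) (hVs z.2 hz.2))
  -- The parameter space equals the space of constraints, so the surjective derivative in `s` is
  -- automatically injective.
  have hdense := dense_setOf_regular (hBo.prod hVo) (fun z hz => (hO z hz).1.contDiffWithinAt)
    fun z hz _ => ⟨LinearMap.injective_iff_surjective.2 (hO z hz).2, (hO z hz).2⟩
  have hfreq := ((mem_closure_iff_frequently.1 (hdense 0)).and_eventually
    (Filter.inter_mem (hBo.mem_nhds hB0) hB₂))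
  refine mem_closure_of_frequently_of_tendsto (hfreq.mono ?_) (hPt H)
  rintro s ⟨hs, hsB, hsB₂⟩ p ⟨hpK, hpV⟩
  exact (h3 hH₂ (h4 hsB₂ hpK)).2 (hs _ ⟨hsB, hpV⟩)

end Density

/-! ### Assembly of the theorem -/

theorem theorem2p2 (r : ℕ) (d n : Fin (r + 1) → ℕ) (M Q : Fin (r + 1) → Type*)
    [∀ j, TopologicalSpace (M j)] [∀ j, T2Space (M j)] [∀ j, SecondCountableTopology (M j)]
    [∀ j, ChartedSpace (EuclideanSpace ℝ (Fin (d j))) (M j)]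
    [∀ j, IsManifold (𝓡 (d j)) ∞ (M j)]
    [∀ j, TopologicalSpace (Q j)] [∀ j, CompactSpace (Q j)]
    [∀ j, ChartedSpace (EuclideanSpace ℝ (Fin (n j))) (Q j)]
    [∀ j, IsManifold (𝓡 (n j)) ∞ (Q j)]
    (σ : ∀ j, SymplecticForm (d j) (M j))
    (ι : ∀ j, Q j → M j × M (j + 1))
    (hι : ∀ j, IsLagrangianCorrespondence (n := n j) (σ j) (σ (j + 1)) (ι j))
    (δ : Fin (r + 1) → ℝ) (hδ : ∀ j, 0 < δ j) :
    ∃ Ham : Set (∀ j, HamiltonianSpace (d j) (M j) (δ j)), IsOpen Ham ∧ Dense Ham ∧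
      ∀ H ∈ Ham,
        (∀ (j : Fin (r + 1)) (p : Q j),
          (ι j p).2 ∈ flowDomain (σ (j + 1)) (H (j + 1))) ∧
        ∀ I : Set (Fin (r + 1)), DefiningEquationsTransversal (n := n) σ ι H I := by
  have hs : ∀ j, ContMDiff (𝓡 (n j)) ((𝓡 (d j)).prod (𝓡 (d (j + 1)))) ∞ (ι j) := fun j =>
    (hι j).isSmoothEmbedding.contMDiff
  have : ∀ j, LocallyCompactSpace (Q j) := fun j =>
    ChartedSpace.locallyCompactSpace (EuclideanSpace ℝ (Fin (n j))) (Q j)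
  set D : Set (∀ j, HamiltonianSpace (d j) (M j) (δ j)) :=
    {H | ∀ (j : Fin (r + 1)) (p : Q j), (ι j p).2 ∈ flowDomain (σ (j + 1)) (H (j + 1))} with hDdef
  have hDo : IsOpen D := by
    refine isOpen_iff_mem_nhds.2 fun H hH => Filter.eventually_all.2 fun j => ?_
    have h : ∀ᶠ H' in 𝓝 H, ∀ p ∈ (univ : Set (Q j)),
        (ι j p).2 ∈ flowDomain (σ (j + 1)) (H' (j + 1)) := by
      refine isCompact_univ.eventually_forall_of_forall_eventually fun p _ => ?_
      have hH' : ContinuousAt (fun q : (∀ j, HamiltonianSpace (d j) (M j) (δ j)) × Q j =>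
          q.1 (j + 1)) (H, p) := ((continuous_apply (j + 1)).comp continuous_fst).continuousAt
      have hp : ContinuousAt (fun q : (∀ j, HamiltonianSpace (d j) (M j) (δ j)) × Q j =>
          (ι j q.2).2) (H, p) := (((hs j).continuous.comp continuous_snd).snd).continuousAt
      exact (hH'.tendsto.prodMk_nhds hp).eventually
        (eventually_mem_flowDomain (hδ (j + 1)) (hH j p))
    exact h.mono fun H' h p => h p (mem_univ p)
  have hDd : Dense D :=
    (dense_pi univ fun j _ => dense_complete_hamiltonians (hδ j) (σ j)).mono fun H hH j p => by
      rw [show flowDomain (σ (j + 1)) (H (j + 1)) = univ from hH (j + 1) (mem_univ _)]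
      exact mem_univ _
  have hT : ∀ I : Set (Fin (r + 1)), ∀ H ∈ D, ∀ p : ∀ j, Q j, TransversalAt (n := n) σ ι I H p →
      ∀ᶠ q : (∀ j, HamiltonianSpace (d j) (M j) (δ j)) × (∀ j, Q j) in 𝓝 (H, p),
        TransversalAt (n := n) σ ι I q.1 q.2 := fun I H hH p hp =>
    eventually_transversalAt hδ hs (fun j => hH j (p j)) hp
  have hopen : ∀ I : Set (Fin (r + 1)),
      IsOpen (D ∩ {H | ∀ p : ∀ j, Q j, TransversalAt (n := n) σ ι I H p}) := fun I => by
    simpa using isOpen_inter_setOf_forall hDo (hT I) isCompact_univ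
  have hdense : ∀ I : Set (Fin (r + 1)),
      Dense (D ∩ {H | ∀ p : ∀ j, Q j, TransversalAt (n := n) σ ι I H p}) := fun I =>
    dense_inter_setOf_forall hDo hDd (hT I) fun H hH p =>
      exists_nhds_eventually_mem_closure hδ hs fun j => hH j (p j)
  -- There are finitely many subsets `I`, so the open dense sets can be intersected directly.
  -- Membership for any one of them, here `∅`, already gives `H ∈ D`.
  refine ⟨⋂ I ∈ (univ : Set (Set (Fin (r + 1)))),
    D ∩ {H | ∀ p : ∀ j, Q j, TransversalAt (n := n) σ ι I H p},
    finite_univ.isOpen_biInter fun I _ => hopen I,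
    finite_univ.dense_biInter_of_isOpen (fun I _ => hopen I) fun I _ => hdense I, fun H hH => ?_⟩
  have hH' := fun I => mem_iInter₂.1 hH I (mem_univ I)
  exact ⟨(hH' ∅).1, fun I p hp => (hH' I).2 p hp⟩
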